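/- Let $n\ge 1$, $M\ge 0$ and $k\ge 2$ be integers, all logarithms to base $2$, and $[A]=\{1,\dots,A\}$. A stream is a finite sequence of updates $(i,v)\in[n]\times\{-M,\dots,M\}$, each meaning $f_i\leftarrow f_i+v$ for a vector $f\in\mathbb Z^n$ that is initially $0$; $L_1=\sum_i|f_i|$ at the end of the stream. Put $B=\lceil k/\log k\rceil$, $t=2\lceil\log k\rceil+12$, $s=2t+\lceil\log k\rceil$ and $C=4(5\lceil\log k\rceil+24)^2B+1$. Let $p$ be a prime with $C\le p\le 2C$, $g$ a generator of $\mathbb F_p^*$, and $T_1[i]=g^i \bmod p$ ($0\le i\le p-2$), $T_2[x]=\log_g x$ ($1\le x\le p-1$) precomputed tables. The algorithm TwoLevelEstimator picks independently a random $h_1:[n]\to[B]$ from a $t$-wise independent family and a random $h_2:[n]\to[p-1]$ from a pairwise independent family. It keeps counters $X^j_z$ modulo $p$ ($j\in[B]$, $z\in[2s]$), initially $0$; on an update $(i,v)$ it adds $v\cdot h_2(i)^z$ to $X_z^{h_1(i)}$ for every $z\in[2s]$. At the end, for each $j$ it recovers an $s$-sparse vector $f_j=((f_j)_x)_{x\in\mathbb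 F_p^*}$ with $\sum_x (f_j)_x x^z=X^j_z$ for all $z\in[2s]$ (taking $f_j=0$ if there is none), and it outputs $\sum_j\sum_x|\sigma((f_j)_x)|$, where $\sigma(\alpha)=\alpha$ for $0\le\alpha\le p/2$ and $\sigma(\alpha)=\alpha-p$ for $p/2<\alpha<p$. Here an $m$-wise independent family $[a]\to[b]$ is one for which the values of a uniformly random member at any at most $m$ distinct points are independent and at each point no value of $[b]$ is more than twice as likely as another. In the implementation, $h_1(x)=((\sum_{j<t}c_jx^j \bmod \ell_1)\bmod B)+1$ and $h_2(x)=((d_0+d_1x\bmod \ell_2)\bmod (p-1))+1$ with uniformly random coefficients and arbitrary primes $2\max\{n,B\}\le\ell_1\le4\max\{n,B\}$, $2\max\{n,p-1\}\le\ell_2\le4\max\{n,p-1\}$. The implementation runs on a word RAM with unit-cost integer arithmetic and comparison, whose words have at least $a\log(n+M+k)$ bits for a suitable absolute constant $a$. Space is the number of bits of memory; the memory consists of packed arrays, is the only thing kept between updates, and is set up (tables, hash coefficients, parameters, zero counters) before the stream. **Theorem.** With absolute constants in all $O(\cdot)$: 1. Apart from the hash functions $h_1,h_2$ and the tables $T_1,T_2$,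 TwoLevelEstimator (including the computation of the output from the final counters) uses $O(k\log k)$ bits of space. 2. The hash functions and tables need an additional $O((\log k)(\log n)+k\log^2k)$ bits. 3. Every stream update is processed in time $O(\log k)$. 4. For every stream with $L_1\le k$, the output equals $L_1$ exactly with probability at least $3/4$ over the choice of $h_1,h_2$; this holds both for the implementation and for any independent choice of $h_1$ from a $t$-wise and $h_2$ from a pairwise independent family. -/

import Mathlib

/-! ### Word RAM

A structured word RAM.  Registers hold signed words (integers of absolute value `< 2 ^ w`).  The
memory is a list of packed arrays; array `a` has a number of fields and a width in bits, and a field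
of width `b` holds a natural number `< 2 ^ b`.  The space is the total number of bits of the arrays.
Each instruction and each test costs one step, and there is no run at all through an overflow, an
access outside an array, a value too wide for its field, or a division by zero. -/

/-- Integer arithmetic and comparison on words. -/
inductive WordOp
  | add | sub | mul | div | mod | lt

/-- Integer division and remainder are the Euclidean ones, so `mod` by a positive word is
nonnegative. -/
def WordOp.eval : WordOp → ℤ → ℤ → ℤ
  | .add, x, y => x + y
  | .sub, x, y => x - y
  | .mul, x, y => x * y
  | .div, x, y => x / y
  | .mod, x, y => x % y
  | .lt, x, y => if x < y then 1 else 0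

/-- The operation is legal on these operands: a divisor is not zero. -/
def WordOp.Legal : WordOp → ℤ → ℤ → Prop
  | .div, _, y => y ≠ 0
  | .mod, _, y => y ≠ 0
  | _, _, _ => True

/-- Programs.  Registers and arrays are named by natural numbers, fixed in the program text. -/
inductive Prog
  | skip
  /-- `R[d] := c` -/
  | const (d : ℕ) (c : ℤ)
  /-- `R[d] := R[a] o R[b]` -/
  | op (o : WordOp) (d a b : ℕ)
  /-- `R[d] := A[R[a]]` -/
  | load (d A a : ℕ)
  /-- `A[R[a]] := R[b]` -/
  | store (A a b : ℕ)
  | seq (P Q : Prog)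
  /-- if `R[a] ≠ 0` then `P` else `Q` -/
  | branch (a : ℕ) (P Q : Prog)
  /-- while `R[a] ≠ 0` do `P` -/
  | loop (a : ℕ) (P : Prog)

/-- Sequential composition of a list of programs. -/
def Prog.block (l : List Prog) : Prog := l.foldr Prog.seq Prog.skip

/-- Contents of the memory: array, index, field. -/
abbrev Mem := ℕ → ℕ → ℕ

structure RamState where
  reg : ℕ → ℤ
  mem : Mem

def RamState.setReg (σ : RamState) (d : ℕ) (x : ℤ) : RamState :=
  ⟨fun r => if r = d then x else σ.reg r, σ.mem⟩

def RamState.setMem (σ : RamState) (A i x : ℕ) : RamState :=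
  ⟨σ.reg, fun A' i' => if A' = A ∧ i' = i then x else σ.mem A' i'⟩

/-- The memory layout: for each array its number of fields and the width of a field in bits. -/
abbrev Layout := List (ℕ × ℕ)

def Layout.len (L : Layout) (A : ℕ) : ℕ := (L.getD A (0, 0)).1

def Layout.width (L : Layout) (A : ℕ) : ℕ := (L.getD A (0, 0)).2

/-- The space of a layout, in bits. -/
def Layout.bits (L : Layout) : ℕ := (L.map fun a => a.1 * a.2).sum

/-- The contents of every field fit into its width. -/
def Layout.Fits (L : Layout) (m : Mem) : Prop :=
  ∀ A i, i < L.len A → m A i < 2 ^ L.width A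

/-- `Exec w L P σ σ' T`: with words of `w` bits (and a sign) and memory layout `L`, the program `P`
started in `σ` halts in `σ'` after `T` steps. -/
inductive Exec (w : ℕ) (L : Layout) : Prog → RamState → RamState → ℕ → Prop
  | skip (σ : RamState) : Exec w L .skip σ σ 0
  | const (σ : RamState) (d : ℕ) (c : ℤ) (hc : |c| < 2 ^ w) :
      Exec w L (.const d c) σ (σ.setReg d c) 1
  | op (σ : RamState) (o : WordOp) (d a b : ℕ) (hl : o.Legal (σ.reg a) (σ.reg b))
      (hw : |o.eval (σ.reg a) (σ.reg b)| < 2 ^ w) :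
      Exec w L (.op o d a b) σ (σ.setReg d (o.eval (σ.reg a) (σ.reg b))) 1
  | load (σ : RamState) (d A a i : ℕ) (hi : σ.reg a = i) (hL : i < L.len A)
      (hw : σ.mem A i < 2 ^ w) :
      Exec w L (.load d A a) σ (σ.setReg d (σ.mem A i)) 1
  | store (σ : RamState) (A a b i x : ℕ) (hi : σ.reg a = i) (hL : i < L.len A)
      (hx : σ.reg b = x) (hf : x < 2 ^ L.width A) :
      Exec w L (.store A a b) σ (σ.setMem A i x) 1
  | seq {P Q : Prog} {σ σ' σ'' : RamState} {T T' : ℕ}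
      (hP : Exec w L P σ σ' T) (hQ : Exec w L Q σ' σ'' T') :
      Exec w L (.seq P Q) σ σ'' (T + T')
  | branchTrue {a : ℕ} {P Q : Prog} {σ σ' : RamState} {T : ℕ}
      (ha : σ.reg a ≠ 0) (hP : Exec w L P σ σ' T) :
      Exec w L (.branch a P Q) σ σ' (T + 1)
  | branchFalse {a : ℕ} {P Q : Prog} {σ σ' : RamState} {T : ℕ}
      (ha : σ.reg a = 0) (hQ : Exec w L Q σ σ' T) :
      Exec w L (.branch a P Q) σ σ' (T + 1)
  | loopDone {a : ℕ} {P : Prog} {σ : RamState} (ha : σ.reg a = 0) :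
      Exec w L (.loop a P) σ σ 1
  | loopStep {a : ℕ} {P : Prog} {σ σ' σ'' : RamState} {T T' : ℕ}
      (ha : σ.reg a ≠ 0) (hP : Exec w L P σ σ' T) (hQ : Exec w L (.loop a P) σ' σ'' T') :
      Exec w L (.loop a P) σ σ'' (T + T' + 1)

/-- Runs are unique. -/
theorem Exec.unique {w : ℕ} {L : Layout} {P : Prog} {σ σ₁ : RamState} {T₁ : ℕ}
    (h₁ : Exec w L P σ σ₁ T₁) :
    ∀ {σ₂ : RamState} {T₂ : ℕ}, Exec w L P σ σ₂ T₂ → σ₁ = σ₂ ∧ T₁ = T₂ := by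
  induction h₁ with
  | skip σ => intro _ _ h; cases h; exact ⟨rfl, rfl⟩
  | const σ d c hc => intro _ _ h; cases h; exact ⟨rfl, rfl⟩
  | op σ o d a b hl hw => intro _ _ h; cases h; exact ⟨rfl, rfl⟩
  | load σ d A a i hi hL hw =>
    intro _ _ h
    cases h with
    | load _ _ _ _ i' hi' _ _ =>
      have : i = i' := by exact_mod_cast hi.symm.trans hi'
      subst this; exact ⟨rfl, rfl⟩
  | store σ A a b i x hi hL hx hf =>
    intro _ _ h
    cases h with
    | store _ _ _ _ i' x' hi' _ hx' _ =>
      have h1 : i = i' := by exact_mod_cast hi.symm.trans hi'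
      have h2 : x = x' := by exact_mod_cast hx.symm.trans hx'
      subst h1; subst h2; exact ⟨rfl, rfl⟩
  | seq _ _ ihP ihQ =>
    intro _ _ h
    cases h with
    | seq hP hQ =>
      obtain ⟨rfl, rfl⟩ := ihP hP
      obtain ⟨rfl, rfl⟩ := ihQ hQ
      exact ⟨rfl, rfl⟩
  | branchTrue ha _ ih =>
    intro _ _ h
    cases h with
    | branchTrue _ hP => obtain ⟨rfl, rfl⟩ := ih hP; exact ⟨rfl, rfl⟩
    | branchFalse ha' _ => exact absurd ha' ha
  | branchFalse ha _ ih =>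
    intro _ _ h
    cases h with
    | branchTrue ha' _ => exact absurd ha ha'
    | branchFalse _ hP => obtain ⟨rfl, rfl⟩ := ih hP; exact ⟨rfl, rfl⟩
  | loopDone ha =>
    intro _ _ h
    cases h with
    | loopDone _ => exact ⟨rfl, rfl⟩
    | loopStep ha' _ _ => exact absurd ha ha'
  | loopStep ha _ _ ihP ihQ =>
    intro _ _ h
    cases h with
    | loopDone ha' => exact absurd ha' ha
    | loopStep _ hP hQ =>
      obtain ⟨rfl, rfl⟩ := ihP hP
      obtain ⟨rfl, rfl⟩ := ihQ hQ
      exact ⟨rfl, rfl⟩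

/-! ### Random hash functions -/

/-- The probability of an event for a uniformly random element of a finite type. -/
noncomputable def prob {Ω : Type} [Fintype Ω] (E : Ω → Prop) : ℝ :=
  (Nat.card {ω : Ω // E ω} : ℝ) / (Fintype.card Ω : ℝ)

/-- `h` is an `m`-wise independent family of functions from an `a`-element set to
`[b] = {1, …, b}`: for a uniformly random member, the values at any at most `m` points are
independent, and no value is more than twice as likely as another.  (A family with exactly uniform
values is a special case.) -/
def IsHashFamily (m a b : ℕ) {Ω : Type} [Fintype Ω] (h : Ω → Fin a → ℕ) : Prop :=
  (∀ ω x, h ω x ∈ Finset.Icc 1 b) ∧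
  (∀ S : Finset (Fin a), S.card ≤ m → ∀ y : Fin a → ℕ,
    prob (fun ω => ∀ x ∈ S, h ω x = y x) = ∏ x ∈ S, prob (fun ω => h ω x = y x)) ∧
  (∀ x, ∀ y ∈ Finset.Icc 1 b, ∀ y' ∈ Finset.Icc 1 b,
    prob (fun ω => h ω x = y) ≤ 2 * prob (fun ω => h ω x = y'))

/-- The polynomial hash function with coefficients `c` modulo `ℓ`, reduced to `[b]`:
`x ↦ ((∑ⱼ cⱼ xʲ mod ℓ) mod b) + 1` on `[a] = {1, …, a}`; `i : Fin a` stands for `i + 1 ∈ [a]`. -/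
def polyHash {m ℓ : ℕ} (a b : ℕ) (c : Fin m → Fin ℓ) (i : Fin a) : ℕ :=
  ((∑ j : Fin m, (c j : ℕ) * ((i : ℕ) + 1) ^ (j : ℕ)) % ℓ) % b + 1

/-! ### The algorithm TwoLevelEstimator -/

namespace TLE

/-- `⌈log₂ k⌉` -/
def ceilLog (k : ℕ) : ℕ := Nat.clog 2 k

/-- The number `⌈k / log₂ k⌉` of buckets. -/
noncomputable def buckets (k : ℕ) : ℕ := ⌈(k : ℝ) / Real.logb 2 k⌉₊

/-- `t = 2 ⌈log₂ k⌉ + 12` -/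
def tPar (k : ℕ) : ℕ := 2 * ceilLog k + 12

/-- `s = 2 t + ⌈log₂ k⌉` -/
def sPar (k : ℕ) : ℕ := 2 * tPar k + ceilLog k

/-- `C = 4 (5 ⌈log₂ k⌉ + 24)² ⌈k / log₂ k⌉ + 1` -/
noncomputable def cPar (k : ℕ) : ℕ := 4 * (5 * ceilLog k + 24) ^ 2 * buckets k + 1

/-- The frequency vector of a stream of updates `(i, v)`, each meaning `f_i ← f_i + v`. -/
def freq {n : ℕ} (stream : List (Fin n × ℤ)) (i : Fin n) : ℤ :=
  ((stream.filter fun u => u.1 = i).map Prod.snd).sum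

/-- `L₁ = ‖f‖₁` at the end of the stream. -/
def normL1 {n : ℕ} (stream : List (Fin n × ℤ)) : ℤ := ∑ i, |freq stream i|

/-- The effect of an update `(i, v)` on the counters `X j z = X_z^j`: increment `X_z^{h₁(i)}` by
`v · h₂(i)^z` modulo `p`. -/
def updateCounters {n : ℕ} (p : ℕ) (h₁ h₂ : Fin n → ℕ) (X : ℕ → ℕ → ZMod p) (u : Fin n × ℤ) :
    ℕ → ℕ → ZMod p :=
  fun j z => if j = h₁ u.1 then X j z + (u.2 : ZMod p) * (h₂ u.1 : ZMod p) ^ z else X j z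

/-- The counters at the end of the stream. -/
def counters {n : ℕ} (p : ℕ) (h₁ h₂ : Fin n → ℕ) (stream : List (Fin n × ℤ)) :
    ℕ → ℕ → ZMod p :=
  stream.foldl (updateCounters p h₁ h₂) (fun _ _ => 0)

/-- `r` is an `s`-sparse vector indexed by `𝔽_p^*` with `∑ₓ r_x x^z = Y_z` for `z ∈ [2s]`. -/
def IsSparseSolution (p s : ℕ) [Fact p.Prime] (Y : ℕ → ZMod p) (r : (ZMod p)ˣ → ZMod p) : Prop :=
  (Finset.univ.filter fun x => r x ≠ 0).card ≤ s ∧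
  ∀ z ∈ Finset.Icc 1 (2 * s), ∑ x : (ZMod p)ˣ, r x * (x : ZMod p) ^ z = Y z

open Classical in
/-- The vector recovered from the power sums of a bucket (zero if the attempt must fail because
there is no `s`-sparse solution). -/
noncomputable def recover (p s : ℕ) [Fact p.Prime] (Y : ℕ → ZMod p) : (ZMod p)ˣ → ZMod p :=
  if h : ∃ r, IsSparseSolution p s Y r then Classical.choose h else 0

/-- `σ : GF(p) → ℤ`, `σ(α) = α` if `α ≤ p / 2` and `α - p` otherwise. -/
def signed {p : ℕ} (α : ZMod p) : ℤ := if 2 * α.val ≤ p then (α.val : ℤ) else (α.val : ℤ) - p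

/-- The output computed from the final counters. -/
noncomputable def outputOf (k p : ℕ) [Fact p.Prime] (X : ℕ → ℕ → ZMod p) : ℤ :=
  ∑ j ∈ Finset.Icc 1 (buckets k), ∑ x : (ZMod p)ˣ, |signed (recover p (sPar k) (X j) x)|

/-- The output of TwoLevelEstimator with hash functions `h₁`, `h₂` on a stream. -/
noncomputable def output {n : ℕ} (k p : ℕ) [Fact p.Prime] (h₁ h₂ : Fin n → ℕ)
    (stream : List (Fin n × ℤ)) : ℤ :=
  outputOf k p (counters p h₁ h₂ stream)

/-! #### Implementation on the word RAM

Arrays: `0` the counters, `X_z^j` at index `(j - 1) · 2s + (z - 1)`; `1` the numbers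
`p`, `⌈k / log k⌉`, `t`, `2s`; `2`, `3` the coefficients of `h₁`, `h₂`; `4`, `5` their moduli
`ℓ₁`, `ℓ₂`; `6` the table `T₁`, with `T₁[i]` at index `i`; `7` the table `T₂`, with `T₂[x]` at index
`x - 1`; from `8` on, work space for the post-processing. -/

/-- The arrays other than hash functions and tables (without work space). -/
noncomputable def coreLayout (k p : ℕ) : Layout :=
  [(2 * sPar k * buckets k, Nat.size p), (4, Nat.size p)]

/-- The hash functions `h₁`, `h₂` and the tables `T₁`, `T₂`. -/
def auxLayout (k p ℓ₁ ℓ₂ : ℕ) : Layout :=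
  [(tPar k, Nat.size ℓ₁), (2, Nat.size ℓ₂), (1, Nat.size ℓ₁), (1, Nat.size ℓ₂),
    (p - 1, Nat.size p), (p - 1, Nat.size p)]

/-- `T₁[i] = g^i mod p` -/
def table₁ {p : ℕ} (g : (ZMod p)ˣ) (i : ℕ) : ℕ := ((g : ZMod p) ^ i).val

/-- `T₂[x] = dlog x`, the least `i` with `g^i ≡ x (mod p)`. -/
noncomputable def table₂ {p : ℕ} (g : (ZMod p)ˣ) (x : ℕ) : ℕ :=
  sInf {i : ℕ | (g : ZMod p) ^ i = (x : ZMod p)}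

/-- The memory before the stream: counters and work space are zero. -/
noncomputable def initMem (k : ℕ) {p ℓ₁ ℓ₂ : ℕ} (g : (ZMod p)ˣ)
    (c : Fin (tPar k) → Fin ℓ₁) (d : Fin 2 → Fin ℓ₂) : Mem
  | 1, i => [p, buckets k, tPar k, 2 * sPar k].getD i 0
  | 2, i => if h : i < tPar k then c ⟨i, h⟩ else 0
  | 3, i => if h : i < 2 then d ⟨i, h⟩ else 0
  | 4, _ => ℓ₁
  | 5, _ => ℓ₂
  | 6, i => table₁ g i
  | 7, i => table₂ g (i + 1)
  | _, _ => 0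

/-- The processing of a stream update `(i, v)`, with `i ∈ [n]` in register `0` and `v` in
register `1`. -/
def updateProg : Prog := .block [
  .const 2 0,                 -- R2 = 0
  .const 3 1,                 -- R3 = 1
  .load 4 1 2,                -- R4 = p
  .load 5 1 3,                -- R5 = number of buckets
  .const 6 2,
  .load 6 1 6,                -- R6 = t
  .const 7 3,
  .load 7 1 7,                -- R7 = 2s
  .load 8 4 2,                -- R8 = ℓ₁
  .load 9 5 2,                -- R9 = ℓ₂
  -- R10 = h₁(i) - 1, by Horner's rule
  .const 10 0,
  .loop 6 (.block [
    .op .sub 6 6 3,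
    .load 11 2 6,
    .op .mul 10 10 0,
    .op .add 10 10 11,
    .op .mod 10 10 8]),
  .op .mod 10 10 5,
  -- R12 = h₂(i) - 1
  .load 11 3 3,
  .op .mul 12 11 0,
  .load 11 3 2,
  .op .add 12 12 11,
  .op .mod 12 12 9,
  .op .sub 13 4 3,            -- R13 = p - 1
  .op .mod 12 12 13,
  .load 14 7 12,              -- R14 = dlog h₂(i)
  .op .mod 15 1 4,            -- R15 = v mod p
  .op .mul 16 10 7,           -- R16 = index of the first counter of the bucket h₁(i)
  -- for z = 2s, …, 1: X_z += v · T₁[z · dlog h₂(i) mod (p - 1)]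
  .loop 7 (.block [
    .op .mul 17 7 14,
    .op .mod 17 17 13,
    .load 18 6 17,
    .op .mul 18 18 15,
    .op .sub 7 7 3,
    .op .add 19 16 7,
    .load 20 0 19,
    .op .add 20 20 18,
    .op .mod 20 20 4,
    .store 0 19 20])]

/-- The registers at the start of an update: nothing but the update itself.  Only the memory is kept
from one update to the next. -/
def inputRegs {n : ℕ} (u : Fin n × ℤ) (r : ℕ) : ℤ :=
  if r = 0 then (u.1 : ℤ) + 1 else if r = 1 then u.2 else 0

/-- `StreamRun w L T m stream m'`: processing the stream turns the memory `m` into `m'`, with at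
most `T` steps for each update. -/
inductive StreamRun {n : ℕ} (w : ℕ) (L : Layout) (T : ℝ) :
    Mem → List (Fin n × ℤ) → Mem → Prop
  | nil (m : Mem) : StreamRun w L T m [] m
  | cons {m m' : Mem} {u : Fin n × ℤ} {us : List (Fin n × ℤ)} {σ : RamState} {τ : ℕ}
      (hu : Exec w L updateProg ⟨inputRegs u, m⟩ σ τ) (hτ : (τ : ℝ) ≤ T)
      (hus : StreamRun w L T σ.mem us m') : StreamRun w L T m (u :: us) m'

/-- The program `P`, started on the memory `m` with all registers zero, halts with `y` in
register `0`. -/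
def Returns (w : ℕ) (L : Layout) (P : Prog) (m : Mem) (y : ℤ) : Prop :=
  ∃ (σ : RamState) (τ : ℕ), Exec w L P ⟨fun _ => 0, m⟩ σ τ ∧ σ.reg 0 = y

end TLE

/-! Correctness. A nonzero integer frequency contributes at least 1 to `L₁`, so at most `k` elements
are in the support. Two bad events are excluded. A bucket receives more than `s` support elements
with total probability at most 1/100: such a bucket contains many `t`-subsets of the support, each
landing there with probability at most `(2 / B) ^ t` (`prob_bucket_le`, `tail_le`). Two support
elements agree under both hash functions with probability at most 1/25, since `p` exceeds a multiple
of `s² B` (`collision_le`). Otherwise the frequencies of bucket `j`, placed at the positions `h₂ i`,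
form an `s`-sparse vector whose power sums are the counters. A vector on the units with at most `2s`
nonzero entries is determined by `2s` power sums (`eq_zero_of_power_sums`), so recovery returns this
vector, and `2|f_i| ≤ 2k < p` makes the signed representatives exact (`output_eq_normL1`). The
polynomial families qualify because evaluation at few distinct points is a surjective homomorphism,
hence maps uniform to uniform (`isHashFamily_polyHash`).

Resources. There are `2sB` counters of `O(log k)` bits with `s = O(log k)` and `B log k = O(k)`. The
tables have `p - 1 = O(k log k)` entries. An update takes `O(t)` steps for Horner's rule and `O(1)`
steps for each of `2s` counters, because `x ^ z` is a table lookup: `T₁[z · T₂[x] mod (p - 1)]`.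

Post-processing has a space bound but no time bound, so it is an exhaustive search: an `s`-digit
number in base `p (p - 1)` runs through all lists of exponent-value pairs. Strictly increasing
exponents make the positions distinct. Every list with the right power sums yields the same sum of
absolute values, by uniqueness, and padding with zero values ensures that every sparse solution is
represented (`bucketOut_eq`, `bucketOut_eq_zero`).

The programs are verified by weakest preconditions and loop invariants indexed by the number of
remaining iterations. -/

/-! ### Weakest preconditions for programs -/

/-- The program halts, in a state and after a number of steps satisfying `Q`. -/
def Wp (w : ℕ) (L : Layout) (P : Prog) (Q : RamState → ℕ → Prop) (σ : RamState) : Prop :=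
  ∃ σ' T, Exec w L P σ σ' T ∧ Q σ' T

@[simp] theorem RamState.setReg_reg (σ : RamState) (d : ℕ) (x : ℤ) (r : ℕ) :
    (σ.setReg d x).reg r = if r = d then x else σ.reg r := rfl

@[simp] theorem RamState.setReg_mem (σ : RamState) (d : ℕ) (x : ℤ) :
    (σ.setReg d x).mem = σ.mem := rfl

@[simp] theorem RamState.setMem_reg (σ : RamState) (A i x : ℕ) :
    (σ.setMem A i x).reg = σ.reg := rfl

@[simp] theorem RamState.setMem_mem (σ : RamState) (A i x A' i' : ℕ) :
    (σ.setMem A i x).mem A' i' = if A' = A ∧ i' = i then x else σ.mem A' i' := rfl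

namespace Wp

variable {w : ℕ} {L : Layout} {P P' : Prog} {Q R : RamState → ℕ → Prop} {σ : RamState}

theorem mono (h : Wp w L P Q σ) (hQ : ∀ σ' T, Q σ' T → R σ' T) : Wp w L P R σ := by
  obtain ⟨σ', T, he, hq⟩ := h
  exact ⟨σ', T, he, hQ _ _ hq⟩

theorem skip (h : Q σ 0) : Wp w L .skip Q σ := ⟨σ, 0, .skip σ, h⟩

theorem seq (h : Wp w L P (fun σ' T => Wp w L P' (fun σ'' T' => Q σ'' (T + T')) σ') σ) :
    Wp w L (.seq P P') Q σ := by
  obtain ⟨σ', T, he, σ'', T', he', hq⟩ := h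
  exact ⟨σ'', T + T', .seq he he', hq⟩

/-- A block is a right-nested sequence, so this rule and those below peel off its first instruction
and leave a goal about the rest. -/
theorem const {d : ℕ} {c : ℤ} (hc : |c| < 2 ^ w)
    (h : Wp w L P (fun σ' T => Q σ' (1 + T)) (σ.setReg d c)) :
    Wp w L (.seq (.const d c) P) Q σ :=
  seq ⟨_, _, .const σ d c hc, h⟩

theorem op {o : WordOp} {d a b : ℕ} (x : ℤ) (hl : o.Legal (σ.reg a) (σ.reg b))
    (hx : o.eval (σ.reg a) (σ.reg b) = x) (hw : |x| < 2 ^ w)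
    (h : Wp w L P (fun σ' T => Q σ' (1 + T)) (σ.setReg d x)) :
    Wp w L (.seq (.op o d a b) P) Q σ := by
  subst hx
  exact seq ⟨_, _, .op σ o d a b hl hw, h⟩

theorem natCast_lt {x : ℕ} (h : x < 2 ^ w) : |(x : ℤ)| < 2 ^ w := by
  rw [Nat.abs_cast]; exact_mod_cast h

/-- The operands are named as natural numbers, which keeps the overflow conditions inside `ℕ`. The
few steps with possibly negative words go through `op` directly. -/
theorem add {d a b : ℕ} (x y : ℕ) (ha : σ.reg a = x) (hb : σ.reg b = y) (hw : x + y < 2 ^ w)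
    (h : Wp w L P (fun σ' T => Q σ' (1 + T)) (σ.setReg d ((x + y : ℕ) : ℤ))) :
    Wp w L (.seq (.op .add d a b) P) Q σ :=
  op _ trivial (by simp [WordOp.eval, ha, hb]) (natCast_lt hw) h

theorem sub {d a b : ℕ} (x y : ℕ) (ha : σ.reg a = x) (hb : σ.reg b = y) (hxy : y ≤ x)
    (hw : x < 2 ^ w)
    (h : Wp w L P (fun σ' T => Q σ' (1 + T)) (σ.setReg d ((x - y : ℕ) : ℤ))) :
    Wp w L (.seq (.op .sub d a b) P) Q σ :=
  op _ trivial (by simp [WordOp.eval, ha, hb, hxy]) (natCast_lt (lt_of_le_of_lt (Nat.sub_le _ _) hw)) h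

theorem mul {d a b : ℕ} (x y : ℕ) (ha : σ.reg a = x) (hb : σ.reg b = y) (hw : x * y < 2 ^ w)
    (h : Wp w L P (fun σ' T => Q σ' (1 + T)) (σ.setReg d ((x * y : ℕ) : ℤ))) :
    Wp w L (.seq (.op .mul d a b) P) Q σ :=
  op _ trivial (by simp [WordOp.eval, ha, hb]) (natCast_lt hw) h

theorem div {d a b : ℕ} (x y : ℕ) (ha : σ.reg a = x) (hb : σ.reg b = y) (hy : 0 < y)
    (hw : x < 2 ^ w)
    (h : Wp w L P (fun σ' T => Q σ' (1 + T)) (σ.setReg d ((x / y : ℕ) : ℤ))) :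
    Wp w L (.seq (.op .div d a b) P) Q σ :=
  op _ (by simp [WordOp.Legal, hb]; omega) (by simp [WordOp.eval, ha, hb])
    (natCast_lt (lt_of_le_of_lt (Nat.div_le_self _ _) hw)) h

theorem mod {d a b : ℕ} (x y : ℕ) (ha : σ.reg a = x) (hb : σ.reg b = y) (hy : 0 < y)
    (hw : x < 2 ^ w)
    (h : Wp w L P (fun σ' T => Q σ' (1 + T)) (σ.setReg d ((x % y : ℕ) : ℤ))) :
    Wp w L (.seq (.op .mod d a b) P) Q σ :=
  op _ (by simp [WordOp.Legal, hb]; omega) (by simp [WordOp.eval, ha, hb])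
    (natCast_lt (lt_of_le_of_lt (Nat.mod_le _ _) hw)) h

theorem lt {d a b : ℕ} (x y : ℕ) (ha : σ.reg a = x) (hb : σ.reg b = y) (hw : 0 < w)
    (h : Wp w L P (fun σ' T => Q σ' (1 + T)) (σ.setReg d ((if x < y then 1 else 0 : ℕ) : ℤ))) :
    Wp w L (.seq (.op .lt d a b) P) Q σ := by
  refine op _ trivial (by simp [WordOp.eval, ha, hb]) (natCast_lt ?_) h
  have : 1 < 2 ^ w := Nat.one_lt_two_pow hw.ne'
  split_ifs <;> omega

theorem load {d A a : ℕ} (i x : ℕ) (hi : σ.reg a = i) (hx : σ.mem A i = x) (hL : i < L.len A)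
    (hw : x < 2 ^ w)
    (h : Wp w L P (fun σ' T => Q σ' (1 + T)) (σ.setReg d x)) :
    Wp w L (.seq (.load d A a) P) Q σ := by
  subst hx
  exact seq ⟨_, _, .load σ d A a i hi hL hw, h⟩

theorem store {A a b : ℕ} (i x : ℕ) (hi : σ.reg a = i) (hx : σ.reg b = x) (hL : i < L.len A)
    (hf : x < 2 ^ L.width A)
    (h : Wp w L P (fun σ' T => Q σ' (1 + T)) (σ.setMem A i x)) :
    Wp w L (.seq (.store A a b) P) Q σ :=
  seq ⟨_, _, .store σ A a b i x hi hL hx hf, h⟩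

theorem branch {a : ℕ} (h₁ : σ.reg a ≠ 0 → Wp w L P (fun σ' T => Q σ' (T + 1)) σ)
    (h₂ : σ.reg a = 0 → Wp w L P' (fun σ' T => Q σ' (T + 1)) σ) :
    Wp w L (.branch a P P') Q σ := by
  by_cases ha : σ.reg a = 0
  · obtain ⟨σ', T, he, hq⟩ := h₂ ha
    exact ⟨σ', T + 1, .branchFalse ha he, hq⟩
  · obtain ⟨σ', T, he, hq⟩ := h₁ ha
    exact ⟨σ', T + 1, .branchTrue ha he, hq⟩

/-- A loop whose invariant `I m` is indexed by the number `m` of remaining iterations, each taking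
at most `c` steps. -/
theorem loop_time {a : ℕ} (I : ℕ → RamState → Prop) (c : ℕ)
    (ha : ∀ m σ, I m σ → (σ.reg a = 0 ↔ m = 0))
    (step : ∀ m σ, I (m + 1) σ → Wp w L P (fun σ' T => T ≤ c ∧ I m σ') σ) :
    ∀ m σ, I m σ → Wp w L (.loop a P) (fun σ' T => T ≤ m * (c + 1) + 1 ∧ I 0 σ') σ := by
  intro m
  induction m with
  | zero => exact fun σ h => ⟨σ, 1, .loopDone ((ha 0 σ h).2 rfl), by simp, h⟩
  | succ m ih =>
    intro σ h
    obtain ⟨σ', T, he, hT, h'⟩ := step m σ h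
    obtain ⟨σ'', T', he', hT', h''⟩ := ih σ' h'
    refine ⟨σ'', T + T' + 1, .loopStep (fun h0 => ?_) he he', ?_, h''⟩
    · exact absurd ((ha _ _ h).1 h0) (by simp)
    · rw [Nat.succ_mul]; omega

/-- Only termination matters in the post-processing, and the index of the invariant guarantees it.
-/
theorem loop {a : ℕ} (I : ℕ → RamState → Prop)
    (ha : ∀ m σ, I m σ → (σ.reg a = 0 ↔ m = 0))
    (step : ∀ m σ, I (m + 1) σ → Wp w L P (fun σ' _ => I m σ') σ) :
    ∀ m σ, I m σ → Wp w L (.loop a P) (fun σ' _ => I 0 σ') σ := by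
  intro m
  induction m with
  | zero => exact fun σ h => ⟨σ, 1, .loopDone ((ha 0 σ h).2 rfl), h⟩
  | succ m ih =>
    intro σ h
    obtain ⟨σ', T, he, h'⟩ := step m σ h
    obtain ⟨σ'', T', he', h''⟩ := ih σ' h'
    exact ⟨σ'', T + T' + 1, .loopStep (fun h0 => absurd ((ha _ _ h).1 h0) (by simp)) he he', h''⟩

end Wp

/-! ### Parameters and space bounds -/

namespace TLE

variable {k : ℕ}

theorem one_le_logb (hk : 2 ≤ k) : 1 ≤ Real.logb 2 k := by
  rw [Real.le_logb_iff_rpow_le (by norm_num) (by positivity)]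
  exact_mod_cast (by simpa using hk)

theorem logb_le_ceilLog (k : ℕ) (hk : 2 ≤ k) : Real.logb 2 k ≤ ceilLog k := by
  rw [Real.logb_le_iff_le_rpow (by norm_num) (by positivity), Real.rpow_natCast]
  exact_mod_cast Nat.le_pow_clog (by norm_num) k

theorem ceilLog_le (k : ℕ) (hk : 2 ≤ k) : (ceilLog k : ℝ) ≤ Real.logb 2 k + 1 := by
  have h1 : 1 ≤ ceilLog k := Nat.clog_pos (by norm_num) hk
  have h : 2 ^ (ceilLog k - 1) < k := Nat.pow_pred_clog_lt_self (by norm_num) (by omega)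
  have h2 : ((ceilLog k - 1 : ℕ) : ℝ) ≤ Real.logb 2 k := by
    rw [Real.le_logb_iff_rpow_le (by norm_num) (by positivity), Real.rpow_natCast]
    exact_mod_cast h.le
  rw [Nat.cast_sub h1] at h2
  push_cast at h2
  linarith

theorem ceilLog_le_self (k : ℕ) : ceilLog k ≤ k :=
  Nat.clog_le_of_le_pow Nat.lt_two_pow_self.le

theorem le_buckets_mul (hk : 2 ≤ k) : (k : ℝ) ≤ buckets k * Real.logb 2 k := by
  have h := one_le_logb hk
  rw [← div_le_iff₀ (by linarith)]
  exact Nat.le_ceil _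

theorem buckets_le (hk : 2 ≤ k) : buckets k ≤ k :=
  Nat.ceil_le.2 (div_le_self (by positivity) (one_le_logb hk))

theorem one_le_buckets (hk : 2 ≤ k) : 1 ≤ buckets k :=
  Nat.one_le_ceil_iff.2 (div_pos (by positivity) (by linarith [one_le_logb hk]))

theorem logb_le_self (hk : 2 ≤ k) : Real.logb 2 k ≤ k :=
  (logb_le_ceilLog k hk).trans (by exact_mod_cast ceilLog_le_self k)

theorem buckets_mul_le (hk : 2 ≤ k) : (buckets k : ℝ) * Real.logb 2 k ≤ 2 * k := by
  have h := one_le_logb hk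
  have h1 : (buckets k : ℝ) ≤ k / Real.logb 2 k + 1 := (Nat.ceil_lt_add_one (by positivity)).le
  calc (buckets k : ℝ) * Real.logb 2 k ≤ (k / Real.logb 2 k + 1) * Real.logb 2 k := by gcongr
    _ = k + Real.logb 2 k := by field_simp
    _ ≤ 2 * k := by linarith [logb_le_self hk]

theorem sPar_eq (k : ℕ) : sPar k = 5 * ceilLog k + 24 := by
  unfold sPar tPar; ring

theorem sPar_pos (k : ℕ) : 0 < sPar k := by rw [sPar_eq]; omega

theorem cPar_eq (k : ℕ) : cPar k = 4 * sPar k ^ 2 * buckets k + 1 := by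
  rw [sPar_eq]; rfl

/-- A crude polynomial bound is enough: it serves only for `log p = O(log k)` and for the word
length. -/
theorem cPar_le (hk : 2 ≤ k) : 2 * cPar k ≤ 2313 * k ^ 3 := by
  have h1 := ceilLog_le_self k
  have h2 := buckets_le hk
  have h3 : 5 * ceilLog k + 24 ≤ 17 * k := by omega
  have h4 : 8 ≤ k ^ 3 := Nat.pow_le_pow_left hk 3
  calc 2 * cPar k ≤ 2 * (4 * (17 * k) ^ 2 * k + 1) := by unfold cPar; gcongr
    _ = 2312 * k ^ 3 + 2 := by ring
    _ ≤ _ := by omega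

/-- The relations between `p` and the other parameters used by the algorithm. -/
theorem param_lt {p : ℕ} (hk : 2 ≤ k) (hp : cPar k ≤ p) :
    2 * k < p ∧ 2 * sPar k < p ∧ tPar k < p ∧ buckets k < p ∧ 4 * sPar k ^ 2 * buckets k + 1 ≤ p := by
  have hB := one_le_buckets hk
  have hs : 24 ≤ sPar k := by rw [sPar_eq]; omega
  have ht : tPar k ≤ sPar k := by unfold sPar; omega
  rw [cPar_eq] at hp
  have h1 : sPar k * 24 ≤ sPar k ^ 2 * buckets k := by nlinarith
  have h2 : buckets k ≤ sPar k ^ 2 * buckets k := Nat.le_mul_of_pos_left _ (by positivity)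
  -- This is what makes `p` larger than `2k`, as `B s ≤ s² B`.
  have h3 : k ≤ buckets k * sPar k := by
    have h := le_buckets_mul hk
    have h' : (Real.logb 2 k) ≤ sPar k := (logb_le_ceilLog k hk).trans (by
      rw [sPar_eq]; exact_mod_cast (by omega))
    have : (k : ℝ) ≤ buckets k * sPar k := h.trans (by gcongr)
    exact_mod_cast this
  have h4 : buckets k * sPar k ≤ sPar k ^ 2 * buckets k := by nlinarith
  refine ⟨?_, ?_, ?_, ?_, hp⟩ <;> nlinarith

theorem size_le_logb {m : ℕ} (hm : 1 ≤ m) : (Nat.size m : ℝ) ≤ Real.logb 2 m + 1 := by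
  have h0 : 0 < Nat.size m := Nat.size_pos.2 hm
  have h : 2 ^ (Nat.size m - 1) ≤ m := Nat.lt_size.1 (by omega)
  have h2 : ((Nat.size m - 1 : ℕ) : ℝ) ≤ Real.logb 2 m := by
    rw [Real.le_logb_iff_rpow_le (by norm_num) (by positivity), Real.rpow_natCast]
    exact_mod_cast h
  rw [Nat.cast_sub h0] at h2
  push_cast at h2
  linarith

/-- Since `k ≥ 2`, the constant 2313 is absorbed into `k ^ 12`, which gives `p ≤ k ^ 15`. -/
theorem logb_prime_le {p : ℕ} (hk : 2 ≤ k) (h0 : 1 ≤ p) (hp : p ≤ 2 * cPar k) :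
    Real.logb 2 p ≤ 15 * Real.logb 2 k := by
  have h : p ≤ k ^ 15 := by
    calc p ≤ 2313 * k ^ 3 := hp.trans (cPar_le hk)
      _ ≤ 2 ^ 12 * k ^ 3 := by gcongr; norm_num
      _ ≤ k ^ 12 * k ^ 3 := by gcongr
      _ = k ^ 15 := by ring
  have h' : (p : ℝ) ≤ (k : ℝ) ^ 15 := by exact_mod_cast h
  calc Real.logb 2 p ≤ Real.logb 2 ((k : ℝ) ^ 15) :=
        Real.logb_le_logb_of_le (by norm_num) (by exact_mod_cast h0) h'
    _ = _ := by rw [Real.logb_pow]; norm_num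

/-- Work space of the post-processing: the digits of one candidate for the vector of a bucket. -/
def workLayout (k p : ℕ) : Layout := [(sPar k, 2 * Nat.size p)]

/-- The counters dominate. Both `s` and the width are `O(log k)`, and one of these two logarithms
cancels against `B log k ≤ 2k`. -/
theorem core_bits_le {p : ℕ} (hk : 2 ≤ k) (h0 : 1 ≤ p) (hp : p ≤ 2 * cPar k) :
    ((Layout.bits (coreLayout k p ++ workLayout k p) : ℕ) : ℝ) ≤
      1000000 * ((k : ℝ) * Real.logb 2 k) := by
  have hl := one_le_logb hk
  have hlk := logb_le_self hk
  have hB := buckets_mul_le hk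
  have hc := ceilLog_le k hk
  have hz := (size_le_logb h0).trans (add_le_add_left (logb_prime_le hk h0 hp) 1)
  have hs : (sPar k : ℝ) ≤ 34 * Real.logb 2 k := by
    rw [sPar_eq]; push_cast; linarith
  have e : ((Layout.bits (coreLayout k p ++ workLayout k p) : ℕ) : ℝ) =
      2 * sPar k * buckets k * Nat.size p + 4 * Nat.size p + sPar k * (2 * Nat.size p) := by
    simp [Layout.bits, coreLayout, workLayout]; ring
  rw [e]
  generalize Real.logb 2 (k : ℝ) = l at *
  have hz' : (Nat.size p : ℝ) ≤ 16 * l := by linarith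
  have hk0 : (0 : ℝ) ≤ k := by positivity
  have h1 : 2 * (sPar k : ℝ) * buckets k * Nat.size p ≤ 2176 * (k * l) := by
    calc 2 * (sPar k : ℝ) * buckets k * Nat.size p
        ≤ 2 * (34 * l) * buckets k * (16 * l) := by gcongr
      _ = 1088 * l * (buckets k * l) := by ring
      _ ≤ 1088 * l * (2 * k) := by gcongr
      _ = _ := by ring
  have h2 : (sPar k : ℝ) * (2 * Nat.size p) ≤ 1088 * (k * l) := by
    calc (sPar k : ℝ) * (2 * Nat.size p) ≤ (34 * l) * (2 * (16 * l)) := by gcongr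
      _ = 1088 * (l * l) := by ring
      _ ≤ _ := by gcongr
  have h3 : l ≤ k * l := by nlinarith
  nlinarith

/-- The bound `max n b ≤ n * b` turns the logarithm of the maximum into a sum. -/
theorem size_modulus_le {n b ℓ : ℕ} (hn : 1 ≤ n) (hb : 1 ≤ b) (h0 : 1 ≤ ℓ) (h : ℓ ≤ 4 * max n b) :
    (Nat.size ℓ : ℝ) ≤ Real.logb 2 n + Real.logb 2 b + 3 := by
  have h1 : ℓ ≤ 2 ^ 2 * (n * b) := h.trans (by
    have : max n b ≤ n * b := max_le (by nlinarith) (by nlinarith)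
    omega)
  have h2 : (ℓ : ℝ) ≤ 2 ^ 2 * (n * b) := by exact_mod_cast h1
  have hn' : (n : ℝ) ≠ 0 := by positivity
  have hb' : (b : ℝ) ≠ 0 := by positivity
  have h3 : Real.logb 2 ℓ ≤ Real.logb 2 (2 ^ 2 * (n * b)) :=
    Real.logb_le_logb_of_le (by norm_num) (by exact_mod_cast h0) h2
  rw [Real.logb_mul (by norm_num) (mul_ne_zero hn' hb'), Real.logb_mul hn' hb', Real.logb_pow,
    Real.logb_self_eq_one (by norm_num)] at h3
  have := size_le_logb h0
  push_cast at h3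
  linarith

/-- The tables account for `k log² k`, since `p = O(s² B) = O(k log k)`. The `t` coefficients of
`h₁` account for `log k · log n`. -/
theorem aux_bits_le {n p ℓ₁ ℓ₂ : ℕ} (hn : 1 ≤ n) (hk : 2 ≤ k) (h0 : 2 ≤ p) (hp : p ≤ 2 * cPar k)
    (h₁ : 1 ≤ ℓ₁) (h₁' : ℓ₁ ≤ 4 * max n (buckets k))
    (h₂ : 1 ≤ ℓ₂) (h₂' : ℓ₂ ≤ 4 * max n (p - 1)) :
    ((Layout.bits (auxLayout k p ℓ₁ ℓ₂) : ℕ) : ℝ) ≤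
      1000000 * (Real.logb 2 k * Real.logb 2 n + (k : ℝ) * Real.logb 2 k ^ 2) := by
  have hl := one_le_logb hk
  have hlk := logb_le_self hk
  have hB := buckets_mul_le hk
  have hc := ceilLog_le k hk
  have hpl := logb_prime_le hk (by omega) hp
  have hz := size_le_logb (m := p) (by omega)
  have hs : (sPar k : ℝ) ≤ 34 * Real.logb 2 k := by
    rw [sPar_eq]; push_cast; linarith
  have ht : (tPar k : ℝ) ≤ 16 * Real.logb 2 k := by
    unfold tPar; push_cast; linarith
  have hb : Real.logb 2 (buckets k) ≤ Real.logb 2 k :=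
    Real.logb_le_logb_of_le (by norm_num) (by exact_mod_cast one_le_buckets hk)
      (by exact_mod_cast buckets_le hk)
  have hp1 : Real.logb 2 ((p - 1 : ℕ) : ℝ) ≤ Real.logb 2 p :=
    Real.logb_le_logb_of_le (by norm_num) (by exact_mod_cast (by omega : 0 < p - 1))
      (by exact_mod_cast Nat.sub_le p 1)
  have hz₁ := size_modulus_le hn (one_le_buckets hk) h₁ h₁'
  have hz₂ := size_modulus_le hn (by omega) h₂ h₂'
  have hln : 0 ≤ Real.logb 2 n := Real.logb_nonneg (by norm_num) (by exact_mod_cast hn)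
  have hP : (p : ℝ) ≤ 8 * (sPar k : ℝ) ^ 2 * buckets k + 2 := by
    have : p ≤ 8 * sPar k ^ 2 * buckets k + 2 := by rw [cPar_eq] at hp; linarith
    exact_mod_cast this
  have e : ((Layout.bits (auxLayout k p ℓ₁ ℓ₂) : ℕ) : ℝ) =
      tPar k * Nat.size ℓ₁ + 3 * Nat.size ℓ₂ + Nat.size ℓ₁ + 2 * (((p - 1 : ℕ) : ℝ) * Nat.size p) := by
    simp [Layout.bits, auxLayout]; ring
  rw [e]
  have hp2 : ((p - 1 : ℕ) : ℝ) ≤ p := by exact_mod_cast Nat.sub_le p 1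
  have hk2 : (2 : ℝ) ≤ k := by exact_mod_cast hk
  generalize Real.logb 2 (k : ℝ) = l at *
  generalize Real.logb 2 (n : ℝ) = m at *
  have hz' : (Nat.size p : ℝ) ≤ 16 * l := by linarith
  have hz₁' : (Nat.size ℓ₁ : ℝ) ≤ m + 4 * l := by linarith
  have hz₂' : (Nat.size ℓ₂ : ℝ) ≤ m + 18 * l := by linarith
  have hP' : (p : ℝ) ≤ 18498 * (k * l) := by
    calc (p : ℝ) ≤ 8 * (34 * l) ^ 2 * buckets k + 2 := hP.trans (by gcongr)
      _ = 9248 * l * (buckets k * l) + 2 := by ring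
      _ ≤ 9248 * l * (2 * k) + 2 := by gcongr
      _ ≤ _ := by nlinarith
  have h1 : (tPar k : ℝ) * Nat.size ℓ₁ ≤ 16 * l * (m + 4 * l) := by gcongr
  have h2 : ((p - 1 : ℕ) : ℝ) * Nat.size p ≤ 18498 * (k * l) * (16 * l) := by
    gcongr; linarith
  have h3 : m ≤ l * m := by nlinarith
  have h4 : l ≤ k * l ^ 2 := by nlinarith [mul_nonneg (by linarith : 0 ≤ l) (by linarith : 0 ≤ l)]
  have h5 : l ^ 2 ≤ k * l ^ 2 := by nlinarith [sq_nonneg l]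
  nlinarith

end TLE

/-! ### Sparse recovery -/

namespace TLE

/-- A vector on the units of a field with at most `m` nonzero entries vanishes if its power sums
with exponents `1, …, m` do. -/
theorem eq_zero_of_power_sums {F : Type*} [Field F] [Fintype Fˣ] [DecidableEq F] (m : ℕ)
    (u : Fˣ → F) (hm : (Finset.univ.filter fun x => u x ≠ 0).card ≤ m)
    (hu : ∀ z ∈ Finset.Icc 1 m, ∑ x : Fˣ, u x * (x : F) ^ z = 0) : u = 0 := by
  classical
  by_contra hne
  obtain ⟨x₀, hx₀⟩ : ∃ x, u x ≠ 0 := by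
    by_contra! h; exact hne (funext h)
  set T := Finset.univ.filter fun x => u x ≠ 0
  have hT : x₀ ∈ T := by simp [T, hx₀]
  -- Pairing `u` with `q` isolates `x₀`, as `q` vanishes on the rest of the support. The factor `X`
  -- removes the constant term, because the exponent 0 is not available; it does not vanish at the
  -- unit `x₀`.
  let q : Polynomial F := Polynomial.X * ∏ x ∈ T.erase x₀, (Polynomial.X - Polynomial.C (x : F))
  have hdeg : q.natDegree ≤ m := by
    refine (Polynomial.natDegree_mul_le).trans ?_
    rw [Polynomial.natDegree_X]
    have : (∏ x ∈ T.erase x₀, (Polynomial.X - Polynomial.C (x : F))).natDegree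
        = (T.erase x₀).card := by
      rw [Polynomial.natDegree_prod_of_monic _ _ (fun x _ => Polynomial.monic_X_sub_C _)]
      simp
    rw [this, Finset.card_erase_of_mem hT]
    have : 0 < T.card := Finset.card_pos.2 ⟨_, hT⟩
    omega
  have h1 : ∑ x : Fˣ, u x * q.eval (x : F) = 0 := by
    have : ∀ x : Fˣ, u x * q.eval (x : F) =
        ∑ z ∈ Finset.range (m + 1), q.coeff z * (u x * (x : F) ^ z) := by
      intro x
      rw [Polynomial.eval_eq_sum_range' (Nat.lt_succ_of_le hdeg), Finset.mul_sum]
      exact Finset.sum_congr rfl fun z _ => by ring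
    simp_rw [this]
    rw [Finset.sum_comm]
    refine Finset.sum_eq_zero fun z hz => ?_
    rw [← Finset.mul_sum]
    rcases Nat.eq_zero_or_pos z with rfl | hz0
    · simp [q, Polynomial.mul_coeff_zero]
    · rw [hu z (by simp at hz ⊢; omega), mul_zero]
  rw [Finset.sum_eq_single x₀] at h1
  · have : q.eval (x₀ : F) ≠ 0 := by
      simp only [q, Polynomial.eval_mul, Polynomial.eval_X, Polynomial.eval_prod,
        Polynomial.eval_sub, Polynomial.eval_C]
      refine mul_ne_zero x₀.ne_zero (Finset.prod_ne_zero_iff.2 fun x hx => ?_)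
      rw [sub_ne_zero]
      exact fun h => (Finset.mem_erase.1 hx).1 (Units.ext h.symm)
    exact (mul_ne_zero hx₀ this) h1
  · intro x _ hx
    by_cases hxT : x ∈ T
    · have : q.eval (x : F) = 0 := by
        simp only [q, Polynomial.eval_mul, Polynomial.eval_prod]
        rw [Finset.prod_eq_zero (Finset.mem_erase.2 ⟨hx, hxT⟩) (by simp), mul_zero]
      rw [this, mul_zero]
    · have : u x = 0 := by simpa [T] using hxT
      rw [this, zero_mul]
  · simp

variable {p : ℕ} [Fact p.Prime] {s : ℕ} {Y : ℕ → ZMod p}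

/-- The difference of two solutions has at most `2s` nonzero entries, exactly the number of power
sums that vanish. -/
theorem IsSparseSolution.unique {r r' : (ZMod p)ˣ → ZMod p} (h : IsSparseSolution p s Y r)
    (h' : IsSparseSolution p s Y r') : r = r' := by
  have : r - r' = 0 := by
    refine eq_zero_of_power_sums (2 * s) (r - r') ?_ fun z hz => ?_
    · calc _ ≤ ((Finset.univ.filter fun x => r x ≠ 0) ∪
            (Finset.univ.filter fun x => r' x ≠ 0)).card := by
            refine Finset.card_le_card fun x hx => ?_
            simp only [Finset.mem_filter, Finset.mem_univ, true_and, Finset.mem_union,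
              Pi.sub_apply] at hx ⊢
            by_contra! h0
            exact hx (by rw [h0.1, h0.2, sub_self])
        _ ≤ _ := (Finset.card_union_le _ _).trans (by have := h.1; have := h'.1; omega)
    · simp only [Pi.sub_apply, sub_mul, Finset.sum_sub_distrib]
      rw [h.2 z hz, h'.2 z hz, sub_self]
  exact sub_eq_zero.1 this

theorem IsSparseSolution.recover_eq {r : (ZMod p)ˣ → ZMod p} (h : IsSparseSolution p s Y r) :
    recover p s Y = r := by
  have hex : ∃ r, IsSparseSolution p s Y r := ⟨r, h⟩
  unfold recover
  rw [dif_pos hex]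
  exact (Classical.choose_spec hex).unique h

@[simp] theorem signed_zero : signed (0 : ZMod p) = 0 := by simp [signed]

theorem signed_intCast {v : ℤ} (hv : 2 * |v| < p) : signed (v : ZMod p) = v := by
  have hp : 0 < p := (Fact.out : p.Prime).pos
  rcases le_or_gt 0 v with h0 | h0
  · rw [abs_of_nonneg h0] at hv
    have : (((v : ZMod p)).val : ℤ) = v := by
      rw [ZMod.val_intCast, Int.emod_eq_of_lt h0 (by omega)]
    unfold signed
    rw [if_pos (by omega), this]
  · rw [abs_of_neg h0] at hv
    have : (((v : ZMod p)).val : ℤ) = v + p := by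
      rw [ZMod.val_intCast, ← Int.add_emod_right, Int.emod_eq_of_lt (by omega) (by omega)]
    unfold signed
    rw [if_neg (by omega), this]; ring

/-! ### Discrete logarithms -/

variable {g : (ZMod p)ˣ}

theorem orderOf_generator (hg : ∀ x : (ZMod p)ˣ, x ∈ Subgroup.zpowers g) : orderOf g = p - 1 := by
  rw [orderOf_eq_card_of_forall_mem_zpowers hg, Nat.card_eq_fintype_card, ZMod.card_units]

theorem exists_dlog (hg : ∀ x : (ZMod p)ˣ, x ∈ Subgroup.zpowers g) (x : (ZMod p)ˣ) :
    ∃ i < p - 1, g ^ i = x := by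
  have h := hg x
  rw [← mem_powers_iff_mem_zpowers, mem_powers_iff_mem_range_orderOf, orderOf_generator hg] at h
  obtain ⟨i, hi, rfl⟩ := Finset.mem_image.1 h
  exact ⟨i, Finset.mem_range.1 hi, rfl⟩

theorem pow_generator_injOn (hg : ∀ x : (ZMod p)ˣ, x ∈ Subgroup.zpowers g) {i j : ℕ}
    (hi : i < p - 1) (hj : j < p - 1) (h : g ^ i = g ^ j) : i = j :=
  pow_injOn_Iio_orderOf (by rw [orderOf_generator hg]; exact hi)
    (by rw [orderOf_generator hg]; exact hj) h

theorem table₂_spec (hg : ∀ x : (ZMod p)ˣ, x ∈ Subgroup.zpowers g) {x : ℕ} (h1 : 1 ≤ x)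
    (h2 : x ≤ p - 1) : table₂ g x < p - 1 ∧ (g : ZMod p) ^ table₂ g x = (x : ZMod p) := by
  have hp : 1 < p := (Fact.out : p.Prime).one_lt
  have hx : (x : ZMod p) ≠ 0 := by
    rw [Ne, ZMod.natCast_eq_zero_iff]
    exact fun h => absurd (Nat.le_of_dvd h1 h) (by omega)
  obtain ⟨i, hi, hx'⟩ := exists_dlog hg (Units.mk0 _ hx)
  have hmem : i ∈ {i : ℕ | (g : ZMod p) ^ i = (x : ZMod p)} := by
    have := congrArg Units.val hx'
    simpa using this
  exact ⟨(Nat.sInf_le hmem).trans_lt hi, Nat.sInf_mem (⟨i, hmem⟩ : Set.Nonempty _)⟩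

theorem table₁_lt (g : (ZMod p)ˣ) (i : ℕ) : table₁ g i < p := ZMod.val_lt _

/-- By Fermat's little theorem exponents may be reduced modulo `p - 1`, so a table of that length
yields all powers. -/
theorem table₁_mod (g : (ZMod p)ˣ) (i : ℕ) :
    ((table₁ g (i % (p - 1)) : ℕ) : ZMod p) = (g : ZMod p) ^ i := by
  have h : g ^ (i % (p - 1)) = g ^ i := by
    conv_rhs => rw [← Nat.div_add_mod i (p - 1), pow_add, pow_mul, ZMod.units_pow_card_sub_one_eq_one,
      one_pow, one_mul]
  rw [table₁, ZMod.natCast_zmod_val]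
  exact_mod_cast congrArg Units.val h

end TLE

/-! ### Processing of an update -/

namespace TLE

/-- All arrays of the implementation. -/
noncomputable def fullLayout (k p ℓ₁ ℓ₂ : ℕ) : Layout :=
  coreLayout k p ++ auxLayout k p ℓ₁ ℓ₂ ++ workLayout k p

/-- The bounds on intermediate results that the length `w` of a word has to accommodate. -/
structure WordBounds (w n k p ℓ₁ ℓ₂ : ℕ) : Prop where
  hash₁ : n * ℓ₁ + ℓ₁ < 2 ^ w
  hash₂ : n * ℓ₂ + ℓ₂ < 2 ^ w
  prime_sq : p * p + p < 2 ^ w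
  exponent : 2 * sPar k * p < 2 ^ w
  index : buckets k * (2 * sPar k) < 2 ^ w
  total : buckets k * (sPar k * p) < 2 ^ w
  four : 4 < 2 ^ w

/-- With `m` coefficients unread, the accumulator is the polynomial formed by the others, shifted
down by `m`. Reduction after every step keeps it in a word. -/
theorem horner_step (c : ℕ → ℕ) (x ℓ t m : ℕ) (hm : m + 1 ≤ t) :
    ((∑ j ∈ Finset.range (t - (m + 1)), c (m + 1 + j) * x ^ j) % ℓ * x + c m) % ℓ =
      (∑ j ∈ Finset.range (t - m), c (m + j) * x ^ j) % ℓ := by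
  have : t - m = t - (m + 1) + 1 := by omega
  rw [this, Finset.sum_range_succ', Nat.add_mod, Nat.mod_mul_mod, ← Nat.add_mod, Finset.sum_mul]
  congr 2
  · refine Finset.sum_congr rfl fun j _ => ?_
    rw [pow_succ, ← mul_assoc, add_right_comm, add_assoc m j 1]
  · simp

/-- The body of the loop of `updateProg` that evaluates a polynomial by Horner's rule. -/
def hornerBody : Prog := .block [
    .op .sub 6 6 3,
    .load 11 2 6,
    .op .mul 10 10 0,
    .op .add 10 10 11,
    .op .mod 10 10 8]

theorem hornerBody_wp {w : ℕ} {L : Layout} {t ℓ x r acc c : ℕ} (hℓ : 0 < ℓ) {σ : RamState}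
    (h0 : σ.reg 0 = x) (h3 : σ.reg 3 = 1) (h6 : σ.reg 6 = (r + 1 : ℕ)) (h8 : σ.reg 8 = ℓ)
    (h10 : σ.reg 10 = acc) (hr : r < t) (htw : t < 2 ^ w) (hL : L.len 2 = t) (hc : σ.mem 2 r = c)
    (hw : acc * x + c < 2 ^ w) :
    Wp w L hornerBody (fun σ' T => T ≤ 5 ∧ σ'.mem = σ.mem ∧ σ'.reg 6 = r ∧
      σ'.reg 10 = ((acc * x + c) % ℓ : ℕ) ∧
      ∀ a, a ≠ 6 → a ≠ 10 → a ≠ 11 → σ'.reg a = σ.reg a) σ := by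
  unfold hornerBody Prog.block
  simp only [List.foldr]
  refine Wp.sub (r + 1) 1 h6 h3 (by omega) (by omega) ?_
  refine Wp.load r c rfl hc (by omega) (by omega) ?_
  refine Wp.mul acc x h10 h0 (by omega) ?_
  refine Wp.add (acc * x) c rfl rfl (by omega) ?_
  refine Wp.mod (acc * x + c) ℓ rfl h8 hℓ (by omega) ?_
  refine Wp.skip ⟨le_rfl, rfl, rfl, rfl, fun a h6 h10 h11 => ?_⟩
  simp [h6, h10, h11]

/-- The body of the loop of `updateProg` that updates the counters of a bucket. -/
def counterBody : Prog := .block [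
    .op .mul 17 7 14,
    .op .mod 17 17 13,
    .load 18 6 17,
    .op .mul 18 18 15,
    .op .sub 7 7 3,
    .op .add 19 16 7,
    .load 20 0 19,
    .op .add 20 20 18,
    .op .mod 20 20 4,
    .store 0 19 20]

theorem counterBody_wp {w : ℕ} {L : Layout} {p r e v o y c : ℕ} (hp : 2 ≤ p) {σ : RamState}
    (h3 : σ.reg 3 = 1) (h4 : σ.reg 4 = p) (h7 : σ.reg 7 = (r + 1 : ℕ))
    (h13 : σ.reg 13 = (p - 1 : ℕ)) (h14 : σ.reg 14 = e) (h15 : σ.reg 15 = v) (h16 : σ.reg 16 = o)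
    (hr : (r + 1) * e < 2 ^ w) (hr' : r + 1 < 2 ^ w) (ho : o + r < 2 ^ w)
    (hL : o + r < L.len 0) (hL6 : L.len 6 = p - 1)
    (hy : σ.mem 6 (((r + 1) * e) % (p - 1)) = y) (hc : σ.mem 0 (o + r) = c)
    (hyv : c + y * v < 2 ^ w) (hyw : y < 2 ^ w) (hL0 : L.width 0 = Nat.size p) :
    Wp w L counterBody (fun σ' T => T ≤ 10 ∧
      σ'.mem = (σ.setMem 0 (o + r) ((c + y * v) % p)).mem ∧ σ'.reg 7 = r ∧
      ∀ a, a ≠ 7 → a < 17 → σ'.reg a = σ.reg a) σ := by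
  have hmod : ((r + 1) * e) % (p - 1) < p - 1 := Nat.mod_lt _ (by omega)
  unfold counterBody Prog.block
  simp only [List.foldr]
  refine Wp.mul (r + 1) e h7 h14 hr ?_
  refine Wp.mod ((r + 1) * e) (p - 1) rfl h13 (by omega) hr ?_
  refine Wp.load (((r + 1) * e) % (p - 1)) y rfl hy (by omega) hyw ?_
  refine Wp.mul y v rfl h15 (by omega) ?_
  refine Wp.sub (r + 1) 1 h7 h3 (by omega) hr' ?_
  refine Wp.add o r h16 rfl ho ?_
  refine Wp.load (o + r) c rfl hc hL (by omega) ?_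
  refine Wp.add c (y * v) rfl rfl hyv ?_
  refine Wp.mod (c + y * v) p rfl h4 (by omega) hyv ?_
  refine Wp.store (o + r) ((c + y * v) % p) rfl rfl hL
    ((Nat.mod_lt _ (by omega)).trans (by rw [hL0]; exact Nat.lt_size_self p)) ?_
  refine Wp.skip ⟨le_rfl, rfl, rfl, fun a h7 ha => ?_⟩
  have h17 : a ≠ 17 := by omega
  have h18 : a ≠ 18 := by omega
  have h19 : a ≠ 19 := by omega
  have h20 : a ≠ 20 := by omega
  simp [h7, h17, h18, h19, h20]

theorem updateProg_eq : updateProg = .block [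
  .const 2 0, .const 3 1, .load 4 1 2, .load 5 1 3, .const 6 2, .load 6 1 6, .const 7 3,
  .load 7 1 7, .load 8 4 2, .load 9 5 2, .const 10 0, .loop 6 hornerBody, .op .mod 10 10 5,
  .load 11 3 3, .op .mul 12 11 0, .load 11 3 2, .op .add 12 12 11, .op .mod 12 12 9,
  .op .sub 13 4 3, .op .mod 12 12 13, .load 14 7 12, .op .mod 15 1 4, .op .mul 16 10 7,
  .loop 7 counterBody] := rfl

/-- The effect is described on natural numbers only; its meaning in the field is supplied by
`Holds.update`. In the time bound, an iteration costs `5 + 1` or `10 + 1` steps, and 24 counts the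
22 straight-line instructions and the final tests of the two loops. -/
theorem updateProg_wp {w n k p ℓ₁ ℓ₂ : ℕ} (hW : WordBounds w n k p ℓ₁ ℓ₂)
    (hB : 0 < buckets k) (hp : 2 ≤ p) (hpar : 2 * sPar k < p ∧ tPar k < p ∧ buckets k < p)
    (hℓ₁ : 0 < ℓ₁) (hℓ₂ : 0 < ℓ₂) (x : ℕ) (hx : x ≤ n) (v : ℤ) (m : Mem)
    (hm10 : m 1 0 = p) (hm11 : m 1 1 = buckets k) (hm12 : m 1 2 = tPar k)
    (hm13 : m 1 3 = 2 * sPar k) (hm2 : ∀ j < tPar k, m 2 j < ℓ₁) (hm3 : ∀ j < 2, m 3 j < ℓ₂)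
    (hm4 : m 4 0 = ℓ₁) (hm5 : m 5 0 = ℓ₂) (hm6 : ∀ i < p - 1, m 6 i < p)
    (hm7 : ∀ i < p - 1, m 7 i < p) (hm0 : ∀ i < 2 * sPar k * buckets k, m 0 i < p)
    (σ : RamState) (hσ : σ.mem = m) (hσ0 : σ.reg 0 = x) (hσ1 : σ.reg 1 = v)
    (b e : ℕ) (hb : b = (∑ j ∈ Finset.range (tPar k), m 2 j * x ^ j) % ℓ₁ % buckets k)
    (he : e = m 7 ((m 3 1 * x + m 3 0) % ℓ₂ % (p - 1))) :
    Wp w (fullLayout k p ℓ₁ ℓ₂) updateProg (fun σ' T => T ≤ 6 * tPar k + 22 * sPar k + 24 ∧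
      (∀ A ≠ 0, ∀ i, σ'.mem A i = m A i) ∧
      ∀ i, σ'.mem 0 i = if b * (2 * sPar k) ≤ i ∧ i < b * (2 * sPar k) + 2 * sPar k then
        (m 0 i + m 6 (((i - b * (2 * sPar k) + 1) * e) % (p - 1)) * (v % p).toNat) % p
        else m 0 i) σ := by
  obtain ⟨hW1, hW2, hW3, hW4, hW5, -, hW7⟩ := hW
  obtain ⟨hs, ht, hBp⟩ := hpar
  set s2 := 2 * sPar k with hs2
  set t := tPar k with ht'
  set B := buckets k with hB'
  have hpw : p < 2 ^ w := by omega
  have hb1 : b < B := hb ▸ Nat.mod_lt _ hB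
  have hv0 : (0 : ℤ) ≤ v % p := Int.emod_nonneg _ (by omega)
  have hvlt : v % p < p := Int.emod_lt_of_pos _ (by omega)
  set vv := (v % p).toNat with hvv
  have hvv' : v % p = (vv : ℤ) := by omega
  have hvvp : vv < p := by omega
  have he1 : e < p := he ▸ hm7 _ (Nat.mod_lt _ (by omega))
  have hbs : b * s2 + s2 ≤ B * s2 := (Nat.succ_mul b s2).symm.trans_le (Nat.mul_le_mul_right _ hb1)
  have hcomm : s2 * B = B * s2 := mul_comm _ _
  have hx1 : ∀ y < ℓ₁, y * x ≤ n * ℓ₁ := fun y hy => by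
    rw [mul_comm y]; exact Nat.mul_le_mul hx hy.le
  have hx2 : ∀ y < ℓ₂, y * x ≤ n * ℓ₂ := fun y hy => by
    rw [mul_comm y]; exact Nat.mul_le_mul hx hy.le
  rw [updateProg_eq, Prog.block]
  simp only [List.foldr]
  refine Wp.const (by simp) ?_
  refine Wp.const (by rw [abs_one]; exact_mod_cast (by omega : 1 < 2 ^ w)) ?_
  refine Wp.load 0 p rfl (hσ ▸ hm10) (show _ < 4 by norm_num)
    hpw ?_
  refine Wp.load 1 B rfl (hσ ▸ hm11) (show _ < 4 by norm_num)
    (by omega) ?_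
  refine Wp.const (by exact_mod_cast (by omega : 2 < 2 ^ w)) ?_
  refine Wp.load 2 t rfl (hσ ▸ hm12) (show _ < 4 by norm_num)
    (by omega) ?_
  refine Wp.const (by exact_mod_cast (by omega : 3 < 2 ^ w)) ?_
  refine Wp.load 3 s2 rfl (hσ ▸ hm13) (show _ < 4 by norm_num)
    (by omega) ?_
  refine Wp.load 0 ℓ₁ rfl (hσ ▸ hm4)
    (show 0 < 1 by norm_num) (by omega) ?_
  refine Wp.load 0 ℓ₂ rfl (hσ ▸ hm5)
    (show 0 < 1 by norm_num) (by omega) ?_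
  refine Wp.const (by simp) ?_
  refine Wp.seq ?_
  refine Wp.mono (Wp.loop_time (fun r τ => r ≤ t ∧ τ.mem = m ∧ τ.reg 0 = x ∧ τ.reg 1 = v ∧
    τ.reg 2 = 0 ∧ τ.reg 3 = 1 ∧ τ.reg 4 = p ∧ τ.reg 5 = B ∧ τ.reg 6 = r ∧ τ.reg 7 = s2 ∧
    τ.reg 8 = ℓ₁ ∧ τ.reg 9 = ℓ₂ ∧
    τ.reg 10 = ((∑ j ∈ Finset.range (t - r), m 2 (r + j) * x ^ j) % ℓ₁ : ℕ)) 5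
    (fun r τ h => by rw [h.2.2.2.2.2.2.2.2.1]; simp) ?_ t _ ?_) ?_
  · rintro r τ ⟨hr, hmem, h0, h1, h2, h3, h4, h5, h6, h7, h8, h9, h10⟩
    have hlt : (∑ j ∈ Finset.range (t - (r + 1)), m 2 (r + 1 + j) * x ^ j) % ℓ₁ < ℓ₁ :=
      Nat.mod_lt _ hℓ₁
    have hc := hm2 r (by omega)
    have hmul := hx1 _ hlt
    refine Wp.mono (hornerBody_wp hℓ₁ h0 h3 h6 h8 h10 (t := t) (by omega) (by omega) rfl rfl
      (by rw [hmem]; omega)) ?_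
    rintro τ' T ⟨hT, hmem', h6', h10', hreg⟩
    refine ⟨hT, by omega, hmem'.trans hmem, ?_⟩
    rw [h10', hmem, horner_step _ _ _ _ _ hr]
    simp [h6', hreg, h0, h1, h2, h3, h4, h5, h7, h8, h9]
  · simp [hσ, hσ0, hσ1]
  rintro τ T ⟨hT, -, hmem, h0, h1, h2, h3, h4, h5, -, h7, h8, h9, h10⟩
  simp only [Nat.sub_zero, zero_add] at h10
  have hlt : (∑ j ∈ Finset.range t, m 2 j * x ^ j) % ℓ₁ < ℓ₁ := Nat.mod_lt _ hℓ₁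
  have hd0 := hm3 0 (by norm_num)
  have hd1 := hm3 1 (by norm_num)
  have hdx := hx2 _ hd1
  have hq : (m 3 1 * x + m 3 0) % ℓ₂ < ℓ₂ := Nat.mod_lt _ hℓ₂
  refine Wp.mod _ B h10 h5 hB (by omega) ?_
  rw [← hb]
  refine Wp.load 1 (m 3 1) h3 (congrFun (congrFun hmem _) _)
    (show 1 < 2 by norm_num) (by omega) ?_
  refine Wp.mul (m 3 1) x rfl h0 (by omega) ?_
  refine Wp.load 0 (m 3 0) h2 (congrFun (congrFun hmem _) _)
    (show 0 < 2 by norm_num) (by omega) ?_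
  refine Wp.add (m 3 1 * x) (m 3 0) rfl rfl (by omega) ?_
  refine Wp.mod (m 3 1 * x + m 3 0) ℓ₂ rfl h9 hℓ₂ (by omega) ?_
  refine Wp.sub p 1 h4 h3 (by omega) hpw ?_
  refine Wp.mod ((m 3 1 * x + m 3 0) % ℓ₂) (p - 1) rfl rfl (by omega) (by omega) ?_
  refine Wp.load ((m 3 1 * x + m 3 0) % ℓ₂ % (p - 1)) e rfl (by rw [he, ← hmem]; rfl)
    (Nat.mod_lt _ (by omega))
    (by omega) ?_
  -- Here the operand `v` may be negative. Its Euclidean remainder is a natural number, and from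
  -- here on no signed value occurs.
  refine Wp.op (vv : ℤ) (by simp [WordOp.Legal, h4]; omega)
    (by simp [WordOp.eval, h4, h1, hvv']) (Wp.natCast_lt (by omega)) ?_
  refine Wp.mul b s2 rfl h7 (by omega) ?_
  refine Wp.seq ?_
  -- The loop runs downwards: with `r` iterations left, exactly the counters at offsets `r, …, 2s -
  -- 1` of the bucket have their new values.
  refine Wp.mono (Wp.loop_time (fun r τ => r ≤ s2 ∧ (∀ A ≠ 0, ∀ i, τ.mem A i = m A i) ∧
    (∀ i, τ.mem 0 i = if b * s2 + r ≤ i ∧ i < b * s2 + s2 then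
        (m 0 i + m 6 (((i - b * s2 + 1) * e) % (p - 1)) * vv) % p else m 0 i) ∧
    τ.reg 3 = 1 ∧ τ.reg 4 = p ∧ τ.reg 7 = r ∧ τ.reg 13 = (p - 1 : ℕ) ∧ τ.reg 14 = e ∧
    τ.reg 15 = vv ∧ τ.reg 16 = (b * s2 : ℕ)) 10
    (fun r τ h => by rw [h.2.2.2.2.2.1]; simp) ?_ s2 _ ?_) ?_
  · rintro r τ ⟨hr, hA, hmem, h3, h4, h7, h13, h14, h15, h16⟩
    have hre : (r + 1) * e < 2 ^ w := lt_of_le_of_lt (Nat.mul_le_mul hr he1.le) hW4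
    have hmod : ((r + 1) * e) % (p - 1) < p - 1 := Nat.mod_lt _ (by omega)
    have h6 := hm6 _ hmod
    have hXlt : m 0 (b * s2 + r) < p := hm0 _ (by omega)
    have hprod : m 6 (((r + 1) * e) % (p - 1)) * vv ≤ p * p := Nat.mul_le_mul h6.le hvvp.le
    refine Wp.mono (counterBody_wp hp h3 h4 h7 h13 h14 h15 h16 hre (by omega) (by omega)
      (show _ < s2 * B by omega) rfl (hA 6 (by norm_num) _)
      ((hmem _).trans (if_neg (by omega))) (by omega) (by omega) rfl) ?_
    rintro τ' T ⟨hT, hmem', h7', hreg⟩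
    refine ⟨hT, by omega, fun A h i => by simp [hmem', h, hA], fun i => ?_, ?_⟩
    swap
    · exact ⟨(hreg 3 (by decide) (by decide)).trans h3, (hreg 4 (by decide) (by decide)).trans h4,
        h7', (hreg 13 (by decide) (by decide)).trans h13,
        (hreg 14 (by decide) (by decide)).trans h14, (hreg 15 (by decide) (by decide)).trans h15,
        (hreg 16 (by decide) (by decide)).trans h16⟩
    simp only [hmem', RamState.setMem_mem, true_and, hmem]
    rcases lt_trichotomy i (b * s2 + r) with hi | rfl | hi
    · rw [if_neg (by omega), if_neg (by omega), if_neg (by omega)]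
    · rw [if_pos rfl, if_pos (by omega), Nat.add_sub_cancel_left]
    · rw [if_neg (by omega)]
      by_cases hi2 : i < b * s2 + s2
      · rw [if_pos (by omega), if_pos (by omega)]
      · rw [if_neg (by omega), if_neg (by omega)]
  · refine ⟨le_rfl, fun A h i => congrFun (congrFun hmem _) _, fun i => ?_, h3, h4, h7, rfl, rfl,
      rfl, rfl⟩
    rw [if_neg (by omega)]
    exact congrFun (congrFun hmem _) _
  rintro τ' T' ⟨hT', -, hA, hmem', -⟩
  refine Wp.skip ⟨?_, hA, fun i => (hmem' i).trans (by rw [Nat.add_zero])⟩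
  simp only [← add_assoc]
  linarith only [hT, hT', hs2]

end TLE

/-! ### Counters in memory and the processing of a whole stream -/

namespace TLE

section Stream

variable {n k p ℓ₁ ℓ₂ : ℕ} [Fact p.Prime] (g : (ZMod p)ˣ) (c : Fin (tPar k) → Fin ℓ₁)
  (d : Fin 2 → Fin ℓ₂)

/-- The memory `m` holds the counters `X`, and otherwise what it held before the stream. -/
def Holds (m : Mem) (X : ℕ → ℕ → ZMod p) : Prop :=
  (∀ A ≠ 0, ∀ i, m A i = initMem k g c d A i) ∧
  ∀ j ∈ Finset.Icc 1 (buckets k), ∀ z ∈ Finset.Icc 1 (2 * sPar k),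
    m 0 ((j - 1) * (2 * sPar k) + (z - 1)) = (X j z).val

variable {g c d}

theorem Holds.lt {m : Mem} {X : ℕ → ℕ → ZMod p} (h : Holds g c d m X) {i : ℕ}
    (hi : i < 2 * sPar k * buckets k) : m 0 i < p := by
  have hs := sPar_pos k
  have hj : i / (2 * sPar k) < buckets k := Nat.div_lt_of_lt_mul hi
  have hz : i % (2 * sPar k) < 2 * sPar k := Nat.mod_lt _ (by omega)
  have := h.2 (i / (2 * sPar k) + 1) (by simp; omega) (i % (2 * sPar k) + 1) (by simp; omega)
  rw [Nat.add_sub_cancel, Nat.add_sub_cancel, Nat.div_add_mod'] at this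
  rw [this]
  exact ZMod.val_lt _

theorem toNat_emod_cast (v : ℤ) : (((v % p).toNat : ℕ) : ZMod p) = (v : ZMod p) := by
  have hp : (p : ℤ) ≠ 0 := by exact_mod_cast (Fact.out : p.Prime).ne_zero
  have h : (((v % p).toNat : ℕ) : ℤ) = v % p := Int.toNat_of_nonneg (Int.emod_nonneg _ hp)
  calc (((v % p).toNat : ℕ) : ZMod p) = ((((v % p).toNat : ℕ) : ℤ) : ZMod p) :=
        (Int.cast_natCast _).symm
    _ = _ := by rw [h, ZMod.intCast_mod]

/-- With `e` the discrete logarithm of `h₂(i)`, the machine adds `v · g ^ (z e) = v · h₂(i) ^ z`. -/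
theorem Holds.update {w : ℕ} (hW : WordBounds w n k p ℓ₁ ℓ₂) (hk : 2 ≤ k) (hp : cPar k ≤ p)
    (hg : ∀ x : (ZMod p)ˣ, x ∈ Subgroup.zpowers g) (hℓ₁ : 0 < ℓ₁) (hℓ₂ : 0 < ℓ₂)
    {m : Mem} {X : ℕ → ℕ → ZMod p} (h : Holds g c d m X) (u : Fin n × ℤ) :
    Wp w (fullLayout k p ℓ₁ ℓ₂) updateProg
      (fun σ T => T ≤ 6 * tPar k + 22 * sPar k + 24 ∧
        Holds g c d σ.mem
          (updateCounters p (polyHash n (buckets k) c) (polyHash n (p - 1) d) X u))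
      ⟨inputRegs u, m⟩ := by
  have hB := one_le_buckets hk
  have hpar := param_lt hk hp
  have hp2 : 2 ≤ p := (Fact.out : p.Prime).two_le
  have hs := sPar_pos k
  obtain ⟨hA, hX⟩ := id h
  have hm2 : ∀ j (hj : j < tPar k), m 2 j = c ⟨j, hj⟩ := fun j hj => by
    rw [hA 2 (by norm_num)]; exact dif_pos hj
  have hm3 : ∀ j (hj : j < 2), m 3 j = d ⟨j, hj⟩ := fun j hj => by
    rw [hA 3 (by norm_num)]; exact dif_pos hj
  have hm7 : ∀ i < p - 1, m 7 i < p - 1 ∧ (g : ZMod p) ^ m 7 i = ((i + 1 : ℕ) : ZMod p) := by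
    intro i hi
    rw [hA 7 (by norm_num)]
    exact table₂_spec hg (by omega) (by omega)
  refine Wp.mono (updateProg_wp hW hB hp2 ⟨hpar.2.1, hpar.2.2.1, hpar.2.2.2.1⟩ hℓ₁ hℓ₂
    (u.1 + 1) (by omega) u.2 m (hA 1 (by norm_num) 0) (hA 1 (by norm_num) 1)
    (hA 1 (by norm_num) 2) (hA 1 (by norm_num) 3) (fun j hj => by rw [hm2 j hj]; exact (c _).2)
    (fun j hj => by rw [hm3 j hj]; exact (d _).2) (hA 4 (by norm_num) 0) (hA 5 (by norm_num) 0)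
    (fun i _ => by rw [hA 6 (by norm_num)]; exact table₁_lt g i)
    (fun i hi => (hm7 i hi).1.trans_le (Nat.sub_le _ _)) (fun i hi => h.lt hi) _ rfl
    (by simp [inputRegs]) (by simp [inputRegs]) _ _ rfl rfl) ?_
  rintro σ T ⟨hT, hσA, hσ0⟩
  refine ⟨hT, fun A hA0 i => (hσA A hA0 i).trans (hA A hA0 i), fun j hj z hz => ?_⟩
  rw [hσ0]
  have hh1 : polyHash n (buckets k) c u.1 =
      (∑ j ∈ Finset.range (tPar k), m 2 j * (u.1 + 1 : ℕ) ^ j) % ℓ₁ % buckets k + 1 := by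
    rw [polyHash, Finset.sum_range]
    simp only [hm2 _ (Fin.isLt _)]
  have hh2 : polyHash n (p - 1) d u.1 =
      (m 3 1 * (u.1 + 1 : ℕ) + m 3 0) % ℓ₂ % (p - 1) + 1 := by
    rw [polyHash, Fin.sum_univ_two, hm3 0 (by norm_num), hm3 1 (by norm_num)]
    simp [add_comm]
  generalize hb : (∑ j ∈ Finset.range (tPar k), m 2 j * (u.1 + 1 : ℕ) ^ j) % ℓ₁ % buckets k = b
    at *
  generalize hq : (m 3 1 * (u.1 + 1 : ℕ) + m 3 0) % ℓ₂ % (p - 1) = q at *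
  have hqp : q < p - 1 := hq ▸ Nat.mod_lt _ (by omega)
  simp only [Finset.mem_Icc] at hj hz
  unfold updateCounters
  rw [hh1, hh2]
  -- Buckets occupy disjoint blocks of length `2s`, so the block containing an index determines `j`;
  -- `b` is the zero-based bucket number.
  have hcond : (b * (2 * sPar k) ≤ (j - 1) * (2 * sPar k) + (z - 1) ∧
      (j - 1) * (2 * sPar k) + (z - 1) < b * (2 * sPar k) + 2 * sPar k) ↔ j = b + 1 := by
    constructor
    · rintro ⟨h1, h2⟩
      have h3 : b < (j - 1) + 1 := by
        by_contra! h
        have := Nat.mul_le_mul_right (2 * sPar k) h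
        rw [Nat.succ_mul] at this
        omega
      have h4 : j - 1 < b + 1 := by
        by_contra! h
        have := Nat.mul_le_mul_right (2 * sPar k) h
        rw [Nat.succ_mul] at this
        omega
      omega
    · rintro rfl
      rw [Nat.add_sub_cancel]; omega
  have hXj := hX j (by simpa using hj) z (by simpa using hz)
  by_cases hjb : j = b + 1
  · rw [if_pos (hcond.2 hjb), if_pos hjb, hXj, hjb, Nat.add_sub_cancel, Nat.add_sub_cancel_left,
      Nat.sub_add_cancel hz.1, ← ZMod.val_natCast]
    congr 1
    have h6 : m 6 (z * m 7 q % (p - 1)) = table₁ g (z * m 7 q % (p - 1)) := hA 6 (by norm_num) _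
    rw [h6]
    push_cast
    rw [ZMod.natCast_zmod_val, table₁_mod, mul_comm z, pow_mul, (hm7 q hqp).2,
      toNat_emod_cast, mul_comm]
    push_cast
    ring
  · rw [if_neg (fun h => hjb (hcond.1 h)), if_neg hjb, hXj]

theorem exists_streamRun {w : ℕ} (hW : WordBounds w n k p ℓ₁ ℓ₂) (hk : 2 ≤ k) (hp : cPar k ≤ p)
    (hg : ∀ x : (ZMod p)ˣ, x ∈ Subgroup.zpowers g) (hℓ₁ : 0 < ℓ₁) (hℓ₂ : 0 < ℓ₂) {B : ℝ}
    (hB : ((6 * tPar k + 22 * sPar k + 24 : ℕ) : ℝ) ≤ B) (stream : List (Fin n × ℤ)) :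
    ∀ (m : Mem) (X : ℕ → ℕ → ZMod p), Holds g c d m X →
      ∃ m', StreamRun w (fullLayout k p ℓ₁ ℓ₂) B m stream m' ∧
        Holds g c d m' (stream.foldl
          (updateCounters p (polyHash n (buckets k) c) (polyHash n (p - 1) d)) X) := by
  induction stream with
  | nil => exact fun m X h => ⟨m, .nil m, h⟩
  | cons u us ih =>
    intro m X h
    obtain ⟨σ, T, he, hT, h'⟩ := h.update hW hk hp hg hℓ₁ hℓ₂ u
    obtain ⟨m', hr, h''⟩ := ih _ _ h'
    exact ⟨m', .cons he ((Nat.cast_le.2 hT).trans hB) hr, h''⟩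

variable (g c d) in
theorem holds_initMem : Holds g c d (initMem k g c d) (fun _ _ => 0) :=
  ⟨fun _ _ _ => rfl, fun _ _ _ _ => by rw [ZMod.val_zero]; rfl⟩

end Stream

theorem update_time_le {k : ℕ} (hk : 2 ≤ k) :
    ((6 * tPar k + 22 * sPar k + 24 : ℕ) : ℝ) ≤ 1000000 * Real.logb 2 k := by
  have hl := one_le_logb hk
  have hc := ceilLog_le k hk
  rw [sPar_eq, tPar]
  push_cast
  linarith

theorem layout_fits {k p ℓ₁ ℓ₂ : ℕ} [Fact p.Prime] {g : (ZMod p)ˣ} (hk : 2 ≤ k)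
    (hp : cPar k ≤ p) (hg : ∀ x : (ZMod p)ˣ, x ∈ Subgroup.zpowers g)
    (c : Fin (tPar k) → Fin ℓ₁) (d : Fin 2 → Fin ℓ₂) :
    (fullLayout k p ℓ₁ ℓ₂).Fits (initMem k g c d) := by
  have hpar := param_lt hk hp
  have hs : ∀ {x y : ℕ}, x ≤ y → x < 2 ^ Nat.size y := fun h => h.trans_lt (Nat.lt_size_self _)
  intro A i hi
  match A, hi with
  | 0, _ => exact Nat.two_pow_pos _
  | 1, hi =>
    change _ < 2 ^ Nat.size p
    have hi : i < 4 := hi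
    interval_cases i
    · exact hs le_rfl
    · exact hs hpar.2.2.2.1.le
    · exact hs hpar.2.2.1.le
    · exact hs hpar.2.1.le
  | 2, hi =>
    have hi : i < tPar k := hi
    change (if h : i < tPar k then (c ⟨i, h⟩ : ℕ) else 0) < 2 ^ Nat.size ℓ₁
    rw [dif_pos hi]; exact hs (c _).2.le
  | 3, hi =>
    have hi : i < 2 := hi
    change (if h : i < 2 then (d ⟨i, h⟩ : ℕ) else 0) < 2 ^ Nat.size ℓ₂
    rw [dif_pos hi]; exact hs (d _).2.le
  | 4, _ => exact Nat.lt_size_self _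
  | 5, _ => exact Nat.lt_size_self _
  | 6, _ => exact hs (table₁_lt g i).le
  | 7, hi =>
    have hi : i < p - 1 := hi
    exact hs ((table₂_spec hg (by omega) (by omega)).1.le.trans (Nat.sub_le _ _))
  | _ + 8, _ => exact Nat.two_pow_pos _

end TLE

/-! ### Candidates for the vector of a bucket -/

namespace TLE

/-- The number before the `q`-th exponent in the check that the exponents increase. -/
def prevExp (e : ℕ → ℕ) : ℕ → ℕ
  | 0 => 0
  | q + 1 => e q + 1

/-- The sequences of `s` exponents `e` and values `v` are increasing and have power sums `Y`
modulo `p`, where `T` is the table of powers. -/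
def IsCandidate (p s : ℕ) (T Y : ℕ → ℕ) (e v : ℕ → ℕ) : Prop :=
  (∀ q < s, prevExp e q < e q + 1) ∧
  ∀ z, 1 ≤ z → z ≤ 2 * s → (∑ q ∈ Finset.range s, T ((z * e q) % (p - 1)) * v q) % p = Y z

/-- The sum of the absolute values of the signed representatives. -/
def absSum (p s : ℕ) (v : ℕ → ℕ) : ℕ := ∑ q ∈ Finset.range s, min (v q) (p - v q)

theorem absSum_le (p s : ℕ) {v : ℕ → ℕ} (hv : ∀ q < s, v q < p) : absSum p s v ≤ s * p := by
  unfold absSum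
  refine (Finset.sum_le_card_nsmul _ _ p fun q hq => ?_).trans (by simp)
  have := hv q (Finset.mem_range.1 hq)
  omega

theorem strictMono_of_prevExp {s : ℕ} {e : ℕ → ℕ} (h : ∀ q < s, prevExp e q < e q + 1) {i j : ℕ}
    (hij : i < j) (hj : j < s) : e i < e j := by
  induction j with
  | zero => omega
  | succ j ih =>
    have h1 : e j + 1 < e (j + 1) + 1 := h (j + 1) hj
    rcases (Nat.lt_succ_iff_lt_or_eq.1 hij) with h2 | rfl
    · have := ih h2 (by omega); omega
    · omega

theorem natAbs_signed {p : ℕ} [Fact p.Prime] {v : ℕ} (hv : v < p) :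
    (signed (v : ZMod p)).natAbs = min v (p - v) := by
  unfold signed
  rw [ZMod.val_natCast, Nat.mod_eq_of_lt hv]
  split_ifs <;> omega

variable {p s : ℕ} [Fact p.Prime] {g : (ZMod p)ˣ} {Y : ℕ → ZMod p}

open Classical in
/-- The vector with the entries `v i` at the positions `a i`, for `i ∈ S`. -/
noncomputable def vectorOf {ι : Type*} (S : Finset ι) (a : ι → (ZMod p)ˣ) (v : ι → ZMod p)
    (x : (ZMod p)ˣ) : ZMod p :=
  ∑ i ∈ S, if a i = x then v i else 0

section VectorOf

variable {ι : Type*} {S : Finset ι} {a : ι → (ZMod p)ˣ} {v : ι → ZMod p}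

theorem sum_vectorOf_mul (F : (ZMod p)ˣ → ZMod p) :
    ∑ x, vectorOf S a v x * F x = ∑ i ∈ S, v i * F (a i) := by
  classical
  simp only [vectorOf, Finset.sum_mul]
  rw [Finset.sum_comm]
  refine Finset.sum_congr rfl fun q _ => ?_
  simp [ite_mul]

/-- Serves twice: for decoded candidates in the search, and for the true frequencies of a bucket in
the correctness proof. -/
theorem isSparseSolution_vectorOf (hS : S.card ≤ s)
    (hY : ∀ z ∈ Finset.Icc 1 (2 * s), ∑ i ∈ S, v i * (a i : ZMod p) ^ z = Y z) :
    IsSparseSolution p s Y (vectorOf S a v) := by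
  classical
  refine ⟨?_, fun z hz => (sum_vectorOf_mul fun x => (x : ZMod p) ^ z).trans (hY z hz)⟩
  calc _ ≤ (S.image a).card := by
        refine Finset.card_le_card fun x hx => ?_
        simp only [Finset.mem_filter, Finset.mem_univ, true_and] at hx
        obtain ⟨q, hq, h⟩ := Finset.exists_ne_zero_of_sum_ne_zero hx
        exact Finset.mem_image.2 ⟨q, hq, by by_contra h'; exact h (if_neg h')⟩
    _ ≤ s := Finset.card_image_le.trans hS

/-- Distinct positions are essential here: colliding entries would be added before `F` is applied.
-/
theorem sum_apply_vectorOf {A : Type*} [AddCommMonoid A] (ha : Set.InjOn a S) (F : ZMod p → A)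
    (hF : F 0 = 0) : ∑ x, F (vectorOf S a v x) = ∑ i ∈ S, F (v i) := by
  classical
  have hval : ∀ i ∈ S, vectorOf S a v (a i) = v i := by
    intro i hi
    unfold vectorOf
    rw [Finset.sum_eq_single i]
    · simp
    · intro j hj hne
      exact if_neg fun h => hne (ha hj hi h)
    · intro h; exact absurd hi h
  have himg : ∑ x ∈ S.image a, F (vectorOf S a v x) = ∑ i ∈ S, F (v i) := by
    rw [Finset.sum_image ha]
    exact Finset.sum_congr rfl fun i hi => by rw [hval i hi]
  rw [← himg]
  symm
  refine Finset.sum_subset (Finset.subset_univ _) fun x _ hx => ?_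
  have : vectorOf S a v x = 0 :=
    Finset.sum_eq_zero fun i hi => if_neg fun h => hx (Finset.mem_image.2 ⟨i, hi, h⟩)
  rw [this, hF]

end VectorOf

theorem IsCandidate.isSparseSolution {e v : ℕ → ℕ}
    (hc : IsCandidate p s (table₁ g) (fun z => (Y z).val) e v) :
    IsSparseSolution p s Y
      (vectorOf (Finset.range s) (fun q => g ^ e q) (fun q => (v q : ZMod p))) := by
  refine isSparseSolution_vectorOf (by simp) fun z hz => ?_
  rw [Finset.mem_Icc] at hz
  have h : _ = (Y z).val := hc.2 z hz.1 hz.2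
  rw [← ZMod.natCast_zmod_val (Y z), ← h, ZMod.natCast_mod]
  push_cast
  refine Finset.sum_congr rfl fun q _ => ?_
  rw [table₁_mod, mul_comm z, pow_mul, mul_comm]

theorem injOn_of_prevExp (hg : ∀ x : (ZMod p)ˣ, x ∈ Subgroup.zpowers g) {e : ℕ → ℕ}
    (hmono : ∀ q < s, prevExp e q < e q + 1) (he : ∀ q < s, e q < p - 1) :
    Set.InjOn (fun q => g ^ e q) (Finset.range s) := by
  intro i hi j hj h
  have hi : i < s := by simpa using hi
  have hj : j < s := by simpa using hj
  have h' := pow_generator_injOn hg (he i hi) (he j hj) h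
  rcases lt_trichotomy i j with h1 | h1 | h1
  · have := strictMono_of_prevExp hmono h1 hj; omega
  · exact h1
  · have := strictMono_of_prevExp hmono h1 hi; omega

/-- The discrete logarithms of the support, listed in increasing order, are the exponents of a
candidate. -/
theorem IsSparseSolution.exists_candidate (hg : ∀ x : (ZMod p)ˣ, x ∈ Subgroup.zpowers g)
    (hs : s ≤ p - 1) {r : (ZMod p)ˣ → ZMod p} (hr : IsSparseSolution p s Y r) :
    ∃ e v : ℕ → ℕ, IsCandidate p s (table₁ g) (fun z => (Y z).val) e v ∧
      (∀ q, e q < p - 1) ∧ ∀ q, v q < p := by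
  classical
  have hp : 1 < p := (Fact.out : p.Prime).one_lt
  set S := (Finset.range (p - 1)).filter fun i => r (g ^ i) ≠ 0
  have hS : S.card ≤ s := by
    refine le_trans ?_ hr.1
    refine Finset.card_le_card_of_injOn (fun i => g ^ i) (fun i hi => ?_) fun i hi j hj h => ?_
    · simpa using (Finset.mem_filter.1 hi).2
    · exact pow_generator_injOn hg (Finset.mem_range.1 (Finset.mem_filter.1 hi).1)
        (Finset.mem_range.1 (Finset.mem_filter.1 hj).1) h
  -- A candidate has exactly `s` entries, so the support is padded with further positions, where the
  -- value is zero. There is room because `s ≤ p - 1`.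
  obtain ⟨S', hSS', hS'r, hcard⟩ := Finset.exists_subsuperset_card_eq
    (Finset.filter_subset _ _ : S ⊆ Finset.range (p - 1)) hS (by simpa using hs)
  let f := S'.orderEmbOfFin hcard
  let e : ℕ → ℕ := fun q => if h : q < s then f ⟨q, h⟩ else 0
  have he : ∀ q (h : q < s), e q = f ⟨q, h⟩ := fun q h => dif_pos h
  let v : ℕ → ℕ := fun q => (r (g ^ e q)).val
  refine ⟨e, v, ⟨?_, fun z hz1 hz2 => ?_⟩, fun q => ?_, fun q => ZMod.val_lt _⟩
  · rintro (_ | q) hq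
    · exact Nat.succ_pos _
    · have : f ⟨q, by omega⟩ < f ⟨q + 1, hq⟩ := f.strictMono (by simp [Fin.lt_def])
      rw [prevExp, he q (by omega), he (q + 1) hq]
      omega
  · have h1 := hr.2 z (Finset.mem_Icc.2 ⟨hz1, hz2⟩)
    dsimp only
    rw [← h1, ← ZMod.val_natCast]
    congr 1
    push_cast
    have h2 : ∀ q ∈ Finset.range s,
        (table₁ g ((z * e q) % (p - 1)) : ZMod p) * (v q : ZMod p) =
          r (g ^ e q) * ((g ^ e q : (ZMod p)ˣ) : ZMod p) ^ z := by
      intro q _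
      rw [table₁_mod, ZMod.natCast_zmod_val, mul_comm z, pow_mul, mul_comm]
      push_cast
      rfl
    rw [Finset.sum_congr rfl h2]
    have h3 : ∑ q ∈ Finset.range s, r (g ^ e q) * ((g ^ e q : (ZMod p)ˣ) : ZMod p) ^ z =
        ∑ i ∈ S', r (g ^ i) * ((g ^ i : (ZMod p)ˣ) : ZMod p) ^ z := by
      rw [Finset.sum_range, ← Finset.sum_coe_sort S']
      refine Fintype.sum_equiv (S'.orderIsoOfFin hcard).toEquiv _ _ fun q => ?_
      rw [he q q.2]
      rfl
    rw [h3]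
    have h4 : ∑ i ∈ S', r (g ^ i) * ((g ^ i : (ZMod p)ˣ) : ZMod p) ^ z =
        ∑ i ∈ Finset.range (p - 1), r (g ^ i) * ((g ^ i : (ZMod p)ˣ) : ZMod p) ^ z := by
      refine Finset.sum_subset hS'r fun i hi hi' => ?_
      have : r (g ^ i) = 0 := by
        by_contra h
        exact hi' (hSS' (Finset.mem_filter.2 ⟨hi, h⟩))
      rw [this, zero_mul]
    rw [h4]
    refine Finset.sum_bij (fun i _ => g ^ i) (fun _ _ => Finset.mem_univ _) ?_ ?_ ?_
    · intro i hi j hj h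
      exact pow_generator_injOn hg (Finset.mem_range.1 hi) (Finset.mem_range.1 hj) h
    · intro x _
      obtain ⟨i, hi, hx⟩ := exists_dlog hg x
      exact ⟨i, Finset.mem_range.2 hi, hx⟩
    · intro i _; rfl
  · by_cases h : q < s
    · rw [he q h]
      exact Finset.mem_range.1 (hS'r (Finset.orderEmbOfFin_mem S' hcard _))
    · have : e q = 0 := dif_neg h
      rw [this]; omega

/-- Every sequence of digits in base `b` is that of a number. -/
theorem exists_digits {b : ℕ} (D : ℕ → ℕ) (hD : ∀ q, D q < b) (s : ℕ) :
    ∃ N < b ^ s, ∀ q < s, N / b ^ q % b = D q := by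
  induction s generalizing D with
  | zero => exact ⟨0, by simp, by simp⟩
  | succ s ih =>
    obtain ⟨N, hN, h⟩ := ih (fun q => D (q + 1)) fun q => hD _
    have h0 := hD 0
    refine ⟨D 0 + b * N, ?_, ?_⟩
    · calc D 0 + b * N < b + b * N := by omega
        _ = b * (N + 1) := by ring
        _ ≤ b * b ^ s := Nat.mul_le_mul_left _ hN
        _ = b ^ (s + 1) := by ring
    · rintro (_ | q) hq
      · simp [Nat.mod_eq_of_lt h0]
      · rw [pow_succ', ← Nat.div_div_eq_div_mul, Nat.add_mul_div_left _ _ (by omega),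
          Nat.div_eq_of_lt h0, zero_add]
        exact h q (by omega)

/-- The `q`-th exponent coded by `N`. -/
def codeExp (p N q : ℕ) : ℕ := N / (p * (p - 1)) ^ q % (p * (p - 1)) / p

/-- The `q`-th value coded by `N`. -/
def codeVal (p N q : ℕ) : ℕ := N / (p * (p - 1)) ^ q % (p * (p - 1)) % p

/-- The output contribution of a bucket. -/
noncomputable def bucketOut (s : ℕ) (Y : ℕ → ZMod p) : ℕ :=
  ∑ x, (signed (recover p s Y x)).natAbs

/-- By uniqueness of sparse solutions all candidates describe the recovered vector, so it does not
matter which of them the search keeps. -/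
theorem bucketOut_eq (hg : ∀ x : (ZMod p)ˣ, x ∈ Subgroup.zpowers g) {N : ℕ}
    (h : IsCandidate p s (table₁ g) (fun z => (Y z).val) (codeExp p N) (codeVal p N)) :
    absSum p s (codeVal p N) = bucketOut s Y := by
  have hp : 1 < p := (Fact.out : p.Prime).one_lt
  rw [bucketOut, h.isSparseSolution.recover_eq,
    sum_apply_vectorOf (F := fun y => (signed y).natAbs) (injOn_of_prevExp hg h.1 fun q _ =>
      Nat.div_lt_of_lt_mul (Nat.mod_lt _ (Nat.mul_pos (by omega) (by omega)))) (by simp)]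
  exact Finset.sum_congr rfl fun q _ => (natAbs_signed (Nat.mod_lt _ (by omega))).symm

/-- The search is complete: the digits `p e + v` of a candidate, all below `p (p - 1)`, form some
`N` in the range. Hence an unsuccessful search means that recovery returns zero. -/
theorem bucketOut_eq_zero (hg : ∀ x : (ZMod p)ˣ, x ∈ Subgroup.zpowers g) (hs : s ≤ p - 1)
    (h : ∀ N < (p * (p - 1)) ^ s,
      ¬ IsCandidate p s (table₁ g) (fun z => (Y z).val) (codeExp p N) (codeVal p N)) :
    bucketOut s Y = 0 := by
  have hp : 1 < p := (Fact.out : p.Prime).one_lt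
  have hno : ¬ ∃ r, IsSparseSolution p s Y r := by
    rintro ⟨r, hr⟩
    obtain ⟨e, v, hc, he, hv⟩ := hr.exists_candidate hg hs
    obtain ⟨N, hN, hD⟩ := exists_digits (b := p * (p - 1)) (fun q => p * e q + v q) (fun q => by
      have h1 := hv q
      have h2 : p * (e q + 1) ≤ p * (p - 1) := Nat.mul_le_mul_left _ (he q)
      rw [Nat.mul_succ] at h2
      omega) s
    refine h N hN ?_
    have h1 : ∀ q < s, codeExp p N q = e q := fun q hq => by
      rw [codeExp, hD q hq, Nat.mul_add_div (by omega), Nat.div_eq_of_lt (hv q), add_zero]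
    have h2 : ∀ q < s, codeVal p N q = v q := fun q hq => by
      rw [codeVal, hD q hq, Nat.mul_add_mod, Nat.mod_eq_of_lt (hv q)]
    refine ⟨fun q hq => ?_, fun z hz1 hz2 => ?_⟩
    · have := hc.1 q hq
      rw [h1 q hq]
      cases q with
      | zero => exact this
      | succ q => rw [prevExp, h1 q (by omega)]; exact this
    · rw [← hc.2 z hz1 hz2]
      congr 1
      refine Finset.sum_congr rfl fun q hq => ?_
      rw [h1 q (Finset.mem_range.1 hq), h2 q (Finset.mem_range.1 hq)]
  rw [bucketOut, recover, dif_neg hno]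
  simp

end TLE

/-! ### Post-processing -/

namespace TLE

/-- Reads the next digit of the candidate, checks that the exponent increases and adds the absolute
value of the value. -/
def scanBody : Prog := .block [
    .op .sub 13 13 1,
    .load 14 8 13,
    .op .div 15 14 2,
    .op .mod 16 14 2,
    .op .add 15 15 1,
    .op .lt 19 11 15,
    .op .mul 10 10 19,
    .op .mul 11 15 1,
    .op .sub 19 2 16,
    .op .lt 21 19 16,
    .branch 21 (.block [.op .add 12 12 19]) (.block [.op .add 12 12 16])]

/-- Adds the contribution of the next digit to the power sum with exponent `R[17]`. -/
def powBody : Prog := .block [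
    .op .sub 13 13 1,
    .load 14 8 13,
    .op .div 15 14 2,
    .op .mod 16 14 2,
    .op .mul 19 17 15,
    .op .mod 19 19 5,
    .load 19 6 19,
    .op .mul 19 19 16,
    .op .add 18 18 19,
    .op .mod 18 18 2]

/-- Compares the power sum with exponent `R[17]` with the counter. -/
def checkBody : Prog := .block [
    .const 18 0,
    .op .mul 13 4 1,
    .loop 13 powBody,
    .op .sub 17 17 1,
    .op .add 19 20 17,
    .load 19 0 19,
    .op .sub 19 19 18,
    .branch 19 (.block [.const 10 0]) .skip]

/-- Adds the carry `R[22]` to the next digit. -/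
def carryBody : Prog := .block [
    .op .sub 13 13 1,
    .load 14 8 13,
    .op .add 14 14 22,
    .op .div 22 14 6,
    .op .mod 14 14 6,
    .store 8 13 14]

/-- Tests a candidate and proceeds to the next one. -/
def tryBody : Prog := .block [
    .const 10 1,
    .const 11 0,
    .const 12 0,
    .op .mul 13 4 1,
    .loop 13 scanBody,
    .op .mul 17 3 1,
    .loop 17 checkBody,
    .branch 10 (.block [.op .mul 8 12 1]) .skip,
    .const 22 1,
    .op .mul 13 4 1,
    .loop 13 carryBody,
    .op .sub 9 1 22]

/-- Adds the contribution of the next bucket to the output. -/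
def bucketBody : Prog := .block [
    .op .sub 7 7 1,
    .op .mul 20 7 3,
    .const 8 0,
    .const 9 1,
    .loop 9 tryBody,
    .op .add 0 0 8]

/-- The computation of the output from the final counters. -/
def postProg : Prog := .block [
    .const 1 1,
    .const 19 0,
    .load 2 1 19,
    .load 7 1 1,
    .const 19 3,
    .load 3 1 19,
    .const 19 2,
    .op .div 4 3 19,
    .op .sub 5 2 1,
    .op .mul 6 2 5,
    .loop 7 bucketBody]

variable {w : ℕ} {L : Layout}

theorem scanBody_wp {σ : RamState} {p r s o pr sm dd : ℕ} (h1 : σ.reg 1 = 1) (h2 : σ.reg 2 = p)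
    (h10 : σ.reg 10 = o) (h11 : σ.reg 11 = pr) (h12 : σ.reg 12 = sm)
    (h13 : σ.reg 13 = (r + 1 : ℕ)) (hr : r < s) (hsw : s < 2 ^ w) (hL : L.len 8 = s)
    (hd : σ.mem 8 r = dd) (hdw : dd + 1 < 2 ^ w) (hp : 0 < p) (hpw : p < 2 ^ w) (ho : o ≤ 1)
    (hw : 1 < 2 ^ w) (hsm : sm + p < 2 ^ w) :
    Wp w L scanBody (fun σ' _ => σ'.mem = σ.mem ∧ σ'.reg 13 = r ∧
      σ'.reg 10 = (o * (if pr < dd / p + 1 then 1 else 0) : ℕ) ∧ σ'.reg 11 = (dd / p + 1 : ℕ) ∧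
      σ'.reg 12 = (sm + min (dd % p) (p - dd % p) : ℕ) ∧
      ∀ a ∉ [10, 11, 12, 13, 14, 15, 16, 19, 21], σ'.reg a = σ.reg a) σ := by
  have hw0 : 0 < w := by
    rcases Nat.eq_zero_or_pos w with rfl | h
    · simp at hw
    · exact h
  have hmod : dd % p < p := Nat.mod_lt _ hp
  have hdiv : dd / p ≤ dd := Nat.div_le_self _ _
  unfold scanBody Prog.block
  simp only [List.foldr]
  refine Wp.sub (r + 1) 1 h13 h1 (by omega) (by omega) ?_
  refine Wp.load r dd rfl hd (by omega) (by omega) ?_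
  refine Wp.div dd p rfl h2 hp (by omega) ?_
  refine Wp.mod dd p rfl h2 hp (by omega) ?_
  refine Wp.add (dd / p) 1 rfl h1 (by omega) ?_
  refine Wp.lt pr (dd / p + 1) h11 rfl hw0 ?_
  refine Wp.mul o (if pr < dd / p + 1 then 1 else 0) h10 rfl (by split_ifs <;> omega) ?_
  -- Multiplication by `R[1] = 1` copies a register. What is remembered is the exponent plus one, so
  -- that the initial value 0 lies below every exponent.
  refine Wp.mul (dd / p + 1) 1 rfl h1 (by omega) ?_
  refine Wp.sub p (dd % p) h2 rfl (by omega) hpw ?_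
  refine Wp.lt (p - dd % p) (dd % p) rfl rfl hw0 ?_
  refine Wp.seq (Wp.branch (fun hb => ?_) fun hb => ?_)
  · have hlt : p - dd % p < dd % p := by
      by_contra h
      exact hb (by simp [h])
    refine Wp.add sm (p - dd % p) h12 rfl (by omega) ?_
    refine Wp.skip (Wp.skip ⟨rfl, rfl, rfl, ?_, ?_, fun a ha => ?_⟩)
    · change ((_ : ℕ) : ℤ) = _; rw [Nat.mul_one]
    · rw [Nat.min_eq_right hlt.le]; rfl
    · simp only [List.mem_cons, not_or, List.not_mem_nil, not_false_eq_true, and_true] at ha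
      simp [ha]
  · have hlt : ¬ p - dd % p < dd % p := by
      intro h
      simp [h] at hb
    refine Wp.add sm (dd % p) h12 rfl (by omega) ?_
    refine Wp.skip (Wp.skip ⟨rfl, rfl, rfl, ?_, ?_, fun a ha => ?_⟩)
    · change ((_ : ℕ) : ℤ) = _; rw [Nat.mul_one]
    · rw [Nat.min_eq_left (not_lt.1 hlt)]; rfl
    · simp only [List.mem_cons, not_or, List.not_mem_nil, not_false_eq_true, and_true] at ha
      simp [ha]

theorem powBody_wp {σ : RamState} {p r s z acc dd y : ℕ} (h1 : σ.reg 1 = 1) (h2 : σ.reg 2 = p)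
    (h5 : σ.reg 5 = (p - 1 : ℕ)) (h13 : σ.reg 13 = (r + 1 : ℕ)) (h17 : σ.reg 17 = z)
    (h18 : σ.reg 18 = acc) (hr : r < s) (hsw : s < 2 ^ w) (hL : L.len 8 = s)
    (hL6 : L.len 6 = p - 1) (hd : σ.mem 8 r = dd) (hdw : dd < 2 ^ w) (hp : 2 ≤ p)
    (hz : z * (dd / p) < 2 ^ w) (hy : σ.mem 6 ((z * (dd / p)) % (p - 1)) = y)
    (hyw : y < 2 ^ w) (hacc : acc + y * (dd % p) < 2 ^ w) :
    Wp w L powBody (fun σ' _ => σ'.mem = σ.mem ∧ σ'.reg 13 = r ∧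
      σ'.reg 18 = ((acc + y * (dd % p)) % p : ℕ) ∧
      ∀ a ∉ [13, 14, 15, 16, 18, 19], σ'.reg a = σ.reg a) σ := by
  unfold powBody Prog.block
  simp only [List.foldr]
  refine Wp.sub (r + 1) 1 h13 h1 (by omega) (by omega) ?_
  refine Wp.load r dd rfl hd (by omega) (by omega) ?_
  refine Wp.div dd p rfl h2 (by omega) (by omega) ?_
  refine Wp.mod dd p rfl h2 (by omega) (by omega) ?_
  refine Wp.mul z (dd / p) h17 rfl hz ?_
  refine Wp.mod (z * (dd / p)) (p - 1) rfl h5 (by omega) hz ?_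
  refine Wp.load ((z * (dd / p)) % (p - 1)) y rfl hy (by rw [hL6]; exact Nat.mod_lt _ (by omega))
    hyw ?_
  refine Wp.mul y (dd % p) rfl rfl (by omega) ?_
  refine Wp.add acc (y * (dd % p)) h18 rfl hacc ?_
  refine Wp.mod (acc + y * (dd % p)) p rfl h2 (by omega) hacc ?_
  refine Wp.skip ⟨rfl, rfl, rfl, fun a ha => ?_⟩
  simp only [List.mem_cons, not_or, List.not_mem_nil, not_false_eq_true, and_true] at ha
  simp [ha]

theorem carryBody_wp {σ : RamState} {b r s cy dd : ℕ} (h1 : σ.reg 1 = 1) (h6 : σ.reg 6 = b)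
    (h13 : σ.reg 13 = (r + 1 : ℕ)) (h22 : σ.reg 22 = cy) (hr : r < s) (hsw : s < 2 ^ w)
    (hL : L.len 8 = s) (hd : σ.mem 8 r = dd) (hb : 0 < b) (hw : dd + cy < 2 ^ w)
    (hbL : b ≤ 2 ^ L.width 8) :
    Wp w L carryBody (fun σ' _ => σ'.mem = (σ.setMem 8 r ((dd + cy) % b)).mem ∧ σ'.reg 13 = r ∧
      σ'.reg 22 = ((dd + cy) / b : ℕ) ∧
      ∀ a ∉ [13, 14, 22], σ'.reg a = σ.reg a) σ := by
  unfold carryBody Prog.block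
  simp only [List.foldr]
  refine Wp.sub (r + 1) 1 h13 h1 (by omega) (by omega) ?_
  refine Wp.load r dd rfl hd (by omega) (by omega) ?_
  refine Wp.add dd cy rfl h22 hw ?_
  refine Wp.div (dd + cy) b rfl h6 hb hw ?_
  refine Wp.mod (dd + cy) b rfl h6 hb hw ?_
  refine Wp.store r ((dd + cy) % b) rfl rfl (by omega) ((Nat.mod_lt _ hb).trans_le hbL) ?_
  refine Wp.skip ⟨rfl, rfl, rfl, fun a ha => ?_⟩
  simp only [List.mem_cons, not_or, List.not_mem_nil, not_false_eq_true, and_true] at ha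
  simp [ha]

end TLE

/-! ### Invariants of the inner loops of the post-processing -/

namespace TLE

/-- The registers that hold the parameters during the post-processing. -/
def PostRegs (p s : ℕ) (σ : RamState) : Prop :=
  σ.reg 1 = 1 ∧ σ.reg 2 = p ∧ σ.reg 3 = (2 * s : ℕ) ∧ σ.reg 4 = s ∧ σ.reg 5 = (p - 1 : ℕ) ∧
    σ.reg 6 = (p * (p - 1) : ℕ)

/-- Word length and layout suffice for the post-processing. -/
structure PostEnv (w : ℕ) (L : Layout) (p s B : ℕ) : Prop where
  two_le : 2 ≤ p
  len0 : L.len 0 = B * (2 * s)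
  len6 : L.len 6 = p - 1
  len8 : L.len 8 = s
  width8 : p * (p - 1) ≤ 2 ^ L.width 8
  prime_sq : p * p + p < 2 ^ w
  exponent : 2 * s * p < 2 ^ w
  index : B * (2 * s) < 2 ^ w
  total : B * (s * p) < 2 ^ w
  four : 4 < 2 ^ w

theorem PostEnv.bounds {w : ℕ} {L : Layout} {p s B : ℕ} (h : PostEnv w L p s B) :
    p * (p - 1) + p < 2 ^ w ∧ 0 < p * (p - 1) ∧ 2 * s < 2 ^ w ∧ s * p + p < 2 ^ w := by
  have h2 := h.two_le
  have h3 := h.prime_sq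
  have h4 := h.exponent
  have h5 : p * (p - 1) ≤ p * p := Nat.mul_le_mul_left _ (Nat.sub_le _ _)
  have h6 : 2 * s ≤ 2 * s * p := Nat.le_mul_of_pos_right _ (by omega)
  refine ⟨by omega, Nat.mul_pos (by omega) (by omega), by omega, ?_⟩
  rcases Nat.eq_zero_or_pos s with rfl | hs
  · omega
  · have : p ≤ s * p := Nat.le_mul_of_pos_left _ hs
    rw [mul_assoc, two_mul] at h4
    omega

variable {w : ℕ} {L : Layout} {p s B : ℕ} {σ : RamState}

/-- A frame rule: `l` lists the registers that a program may change, and disjointness from the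
parameter registers is decidable. -/
theorem PostRegs.of_frame {l : List ℕ} {τ : RamState} (h : PostRegs p s σ)
    (hf : ∀ a ∉ l, τ.reg a = σ.reg a) (hl : ∀ a ∈ [1, 2, 3, 4, 5, 6], a ∉ l) :
    PostRegs p s τ := by
  obtain ⟨h1, h2, h3, h4, h5, h6⟩ := h
  exact ⟨(hf _ (hl 1 (by decide))).trans h1, (hf _ (hl 2 (by decide))).trans h2,
    (hf _ (hl 3 (by decide))).trans h3, (hf _ (hl 4 (by decide))).trans h4,
    (hf _ (hl 5 (by decide))).trans h5, (hf _ (hl 6 (by decide))).trans h6⟩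

/-- Cell `r` holds digit `s - 1 - r`, so the descending index visits the digits in ascending order.
The flag is a product of comparisons, hence nonzero just when all succeed. -/
theorem scanLoop_wp (hE : PostEnv w L p s B) (hR : PostRegs p s σ) {D : ℕ → ℕ}
    (hD : ∀ q, D q < p * (p - 1)) (hmem : ∀ r < s, σ.mem 8 r = D (s - 1 - r))
    (h10 : σ.reg 10 = 1) (h11 : σ.reg 11 = 0) (h12 : σ.reg 12 = 0) (h13 : σ.reg 13 = s) :
    Wp w L (.loop 13 scanBody) (fun σ' _ => σ'.mem = σ.mem ∧
      (∃ o : ℕ, σ'.reg 10 = o ∧ o ≤ 1 ∧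
        (o ≠ 0 ↔ ∀ q < s, prevExp (fun q => D q / p) q < D q / p + 1)) ∧
      σ'.reg 12 = absSum p s (fun q => D q % p) ∧
      ∀ a ∉ [10, 11, 12, 13, 14, 15, 16, 19, 21], σ'.reg a = σ.reg a) σ := by
  obtain ⟨hb1, hb2, hb3, hb4⟩ := hE.bounds
  have hp := hE.two_le
  have hsp : ∀ q ≤ s, absSum p q (fun q => D q % p) ≤ s * p := fun q hq =>
    (absSum_le p q fun i _ => Nat.mod_lt _ (by omega)).trans (Nat.mul_le_mul_right _ hq)
  refine Wp.mono (Wp.loop (fun r τ => r ≤ s ∧ τ.mem = σ.mem ∧ τ.reg 13 = r ∧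
      (∃ o : ℕ, τ.reg 10 = o ∧ o ≤ 1 ∧
        (o ≠ 0 ↔ ∀ q < s - r, prevExp (fun q => D q / p) q < D q / p + 1)) ∧
      τ.reg 11 = prevExp (fun q => D q / p) (s - r) ∧
      τ.reg 12 = absSum p (s - r) (fun q => D q % p) ∧
      ∀ a ∉ [10, 11, 12, 13, 14, 15, 16, 19, 21], τ.reg a = σ.reg a)
    (fun r τ h => by rw [h.2.2.1]; simp) ?_ s σ ?_) ?_
  · rintro r τ ⟨hr, hm, h13, ⟨o, h10, ho, hoq⟩, h11, h12, hf⟩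
    have hR' := hR.of_frame hf (by decide)
    have hs1 : s - r = (s - (r + 1)) + 1 := by omega
    have hs2 : s - 1 - r = s - (r + 1) := by omega
    have hDr := hD (s - (r + 1))
    refine Wp.mono (scanBody_wp hR'.1 hR'.2.1 h10 h11 h12 h13 hr (by omega) hE.len8
      (by rw [hm, hmem r hr, hs2]) (by omega) (by omega) (by omega) ho (by omega) ?_) ?_
    · have := hsp (s - (r + 1)) (by omega); omega
    rintro τ' - ⟨hm', h13', h10', h11', h12', hf'⟩
    refine ⟨by omega, hm'.trans hm, h13', ⟨_, h10', ?_, ?_⟩, ?_, ?_,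
      fun a ha => (hf' a ha).trans (hf a ha)⟩
    · split_ifs <;> omega
    · rw [hs1, Nat.forall_lt_succ_right, ← hoq, mul_ne_zero_iff]
      refine and_congr_right fun _ => ?_
      split_ifs with h <;> simp [h]
    · rw [h11', hs1, prevExp]
    · rw [h12', hs1, absSum, absSum, Finset.sum_range_succ]
  · refine ⟨le_rfl, rfl, h13, ⟨1, h10, le_rfl, by simp⟩, by simp [h11, prevExp],
      by simp [h12, absSum], fun _ _ => rfl⟩
  · rintro σ' - ⟨-, hm, -, ho, -, h12, hf⟩
    exact ⟨hm, ho, h12, hf⟩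

theorem powLoop_wp (hE : PostEnv w L p s B) (hR : PostRegs p s σ) {D T : ℕ → ℕ}
    (hD : ∀ q, D q < p * (p - 1)) (hmem : ∀ r < s, σ.mem 8 r = D (s - 1 - r))
    (hT : ∀ i < p - 1, σ.mem 6 i = T i) (hTp : ∀ i < p - 1, T i < p) {z : ℕ} (hz : z ≤ 2 * s)
    (h13 : σ.reg 13 = s) (h17 : σ.reg 17 = z) (h18 : σ.reg 18 = 0) :
    Wp w L (.loop 13 powBody) (fun σ' _ => σ'.mem = σ.mem ∧
      σ'.reg 18 = ((∑ q ∈ Finset.range s, T ((z * (D q / p)) % (p - 1)) * (D q % p)) % p : ℕ) ∧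
      ∀ a ∉ [13, 14, 15, 16, 18, 19], σ'.reg a = σ.reg a) σ := by
  obtain ⟨hb1, hb2, hb3, hb4⟩ := hE.bounds
  have hp := hE.two_le
  have hpp := hE.prime_sq
  have hze := hE.exponent
  refine Wp.mono (Wp.loop (fun r τ => r ≤ s ∧ τ.mem = σ.mem ∧ τ.reg 13 = r ∧
      τ.reg 18 = ((∑ q ∈ Finset.range (s - r),
        T ((z * (D q / p)) % (p - 1)) * (D q % p)) % p : ℕ) ∧
      ∀ a ∉ [13, 14, 15, 16, 18, 19], τ.reg a = σ.reg a)
    (fun r τ h => by rw [h.2.2.1]; simp) ?_ s σ ?_) ?_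
  · rintro r τ ⟨hr, hm, h13, h18, hf⟩
    have hR' := hR.of_frame hf (by decide)
    have hs1 : s - r = (s - (r + 1)) + 1 := by omega
    have hs2 : s - 1 - r = s - (r + 1) := by omega
    have hDr := hD (s - (r + 1))
    have hmod : (z * (D (s - (r + 1)) / p)) % (p - 1) < p - 1 := Nat.mod_lt _ (by omega)
    have hy := hTp _ hmod
    have hv : D (s - (r + 1)) % p < p := Nat.mod_lt _ (by omega)
    have he : D (s - (r + 1)) / p < p - 1 := Nat.div_lt_of_lt_mul hDr
    have h1 : z * (D (s - (r + 1)) / p) ≤ 2 * s * p := Nat.mul_le_mul hz (by omega)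
    have h2 : T ((z * (D (s - (r + 1)) / p)) % (p - 1)) * (D (s - (r + 1)) % p) ≤ p * p :=
      Nat.mul_le_mul hy.le hv.le
    have h3 : (∑ q ∈ Finset.range (s - (r + 1)),
        T ((z * (D q / p)) % (p - 1)) * (D q % p)) % p < p := Nat.mod_lt _ (by omega)
    refine Wp.mono (powBody_wp hR'.1 hR'.2.1 hR'.2.2.2.2.1 h13 ((hf 17 (by decide)).trans h17) h18
      hr (by omega) hE.len8 hE.len6 (by rw [hm, hmem r hr, hs2]) (by omega) hp (by omega)
      (by rw [hm, hT _ hmod]) (by omega) (by omega)) ?_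
    rintro τ' - ⟨hm', h13', h18', hf'⟩
    refine ⟨by omega, hm'.trans hm, h13', ?_, fun a ha => (hf' a ha).trans (hf a ha)⟩
    rw [h18', hs1, Finset.sum_range_succ, Nat.mod_add_mod]
  · exact ⟨le_rfl, rfl, h13, by simp [h18], fun _ _ => rfl⟩
  · rintro σ' - ⟨-, hm, -, h18, hf⟩
    exact ⟨hm, h18, hf⟩

/-- The flag is cleared at a mismatch and never set again, so it survives only if it was set before
and all `2s` power sums agree. -/
theorem checkLoop_wp (hE : PostEnv w L p s B) (hR : PostRegs p s σ) {D T Y : ℕ → ℕ}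
    (hD : ∀ q, D q < p * (p - 1)) (hmem : ∀ r < s, σ.mem 8 r = D (s - 1 - r))
    (hT : ∀ i < p - 1, σ.mem 6 i = T i) (hTp : ∀ i < p - 1, T i < p) {off o : ℕ}
    (hoff : off + 2 * s ≤ B * (2 * s)) (hY : ∀ r < 2 * s, σ.mem 0 (off + r) = Y (r + 1))
    (hYp : ∀ z, Y z < p) (h10 : σ.reg 10 = o) (h17 : σ.reg 17 = (2 * s : ℕ))
    (h20 : σ.reg 20 = off) :
    Wp w L (.loop 17 checkBody) (fun σ' _ => σ'.mem = σ.mem ∧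
      (σ'.reg 10 ≠ 0 ↔ o ≠ 0 ∧ ∀ z, 1 ≤ z → z ≤ 2 * s →
        (∑ q ∈ Finset.range s, T ((z * (D q / p)) % (p - 1)) * (D q % p)) % p = Y z) ∧
      ∀ a ∉ [10, 13, 14, 15, 16, 17, 18, 19], σ'.reg a = σ.reg a) σ := by
  obtain ⟨hb1, hb2, hb3, hb4⟩ := hE.bounds
  have hp := hE.two_le
  have hpp := hE.prime_sq
  have hidx := hE.index
  have hf4 := hE.four
  refine Wp.mono (Wp.loop (fun r τ => r ≤ 2 * s ∧ τ.mem = σ.mem ∧ τ.reg 17 = r ∧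
      (τ.reg 10 ≠ 0 ↔ o ≠ 0 ∧ ∀ z, r + 1 ≤ z → z ≤ 2 * s →
        (∑ q ∈ Finset.range s, T ((z * (D q / p)) % (p - 1)) * (D q % p)) % p = Y z) ∧
      ∀ a ∉ [10, 13, 14, 15, 16, 17, 18, 19], τ.reg a = σ.reg a)
    (fun r τ h => by rw [h.2.2.1]; simp) ?_ (2 * s) σ ?_) ?_
  · rintro r τ ⟨hr, hm, h17, h10, hf⟩
    have hR' := hR.of_frame hf (by decide)
    unfold checkBody Prog.block
    simp only [List.foldr]
    refine Wp.const (by simp) ?_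
    refine Wp.mul s 1 hR'.2.2.2.1 hR'.1 (by omega) ?_
    refine Wp.seq (Wp.mono (powLoop_wp hE (by exact hR') hD (fun i hi => by
      rw [← hmem i hi]; exact congrFun (congrFun hm _) _) (fun i hi => by
      rw [← hT i hi]; exact congrFun (congrFun hm _) _) hTp hr
      (by change ((s * 1 : ℕ) : ℤ) = s; rw [Nat.mul_one]) h17 rfl) ?_)
    rintro τ' - ⟨hm', h18, hf'⟩
    have hlt : (∑ q ∈ Finset.range s,
        T (((r + 1) * (D q / p)) % (p - 1)) * (D q % p)) % p < p := Nat.mod_lt _ (by omega)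
    generalize hacc : (∑ q ∈ Finset.range s,
        T (((r + 1) * (D q / p)) % (p - 1)) * (D q % p)) % p = acc at *
    have h1 : τ'.reg 1 = 1 := (hf' 1 (by decide)).trans hR'.1
    have h17' : τ'.reg 17 = (r + 1 : ℕ) := (hf' 17 (by decide)).trans h17
    have h20' : τ'.reg 20 = off := (hf' 20 (by decide)).trans ((hf 20 (by decide)).trans h20)
    have h10' : τ'.reg 10 = τ.reg 10 := hf' 10 (by decide)
    have hmm : τ'.mem = σ.mem := hm'.trans hm
    have hYr := hYp (r + 1)
    refine Wp.sub (r + 1) 1 h17' h1 (by omega) (by omega) ?_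
    refine Wp.add off r h20' rfl (by omega) ?_
    refine Wp.load (off + r) (Y (r + 1)) rfl
      ((congrFun (congrFun hmm _) _).trans (hY r (by omega))) (by rw [hE.len0]; omega)
      (by omega) ?_
    -- A signed difference, used only as a test for equality.
    refine Wp.op ((Y (r + 1) : ℤ) - acc) trivial (by rw [← h18]; rfl) ?_ ?_
    · rw [abs_lt]
      have : (p : ℤ) < 2 ^ w := by exact_mod_cast (by omega : p < 2 ^ w)
      constructor <;> omega
    have hfr : ∀ a ∉ [10, 13, 14, 15, 16, 17, 18, 19], τ'.reg a = σ.reg a := fun a ha => by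
      simp only [List.mem_cons, not_or, List.not_mem_nil, not_false_eq_true, and_true] at ha
      rw [hf' a (by simp [ha]), ← hf a (by simp [ha])]
      simp [ha]
    have hstep : (o ≠ 0 ∧ ∀ z, r + 1 ≤ z → z ≤ 2 * s →
        (∑ q ∈ Finset.range s, T ((z * (D q / p)) % (p - 1)) * (D q % p)) % p = Y z) ↔
        τ.reg 10 ≠ 0 ∧ acc = Y (r + 1) := by
      rw [h10, and_assoc]
      refine and_congr_right fun _ => ⟨fun h => ⟨fun z hz => h z (by omega),
        hacc.symm.trans (h (r + 1) le_rfl hr)⟩, fun h z hz hz2 => ?_⟩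
      rcases Nat.lt_or_ge (r + 1) z with h' | h'
      · exact h.1 z h' hz2
      · obtain rfl : z = r + 1 := by omega
        rw [hacc]; exact h.2
    refine Wp.seq (Wp.branch (fun hb => ?_) fun hb => ?_)
    · have hne : acc ≠ Y (r + 1) := by
        rintro rfl
        exact hb (by simp)
      refine Wp.const (by simp) ?_
      refine Wp.skip (Wp.skip ⟨by omega, hmm, rfl, ?_, fun a ha => ?_⟩)
      · rw [hstep]
        simp [hne]
      · rw [← hfr a ha]
        simp only [List.mem_cons, not_or, List.not_mem_nil, not_false_eq_true, and_true] at ha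
        simp [ha]
    · have heq : acc = Y (r + 1) := by
        have : (Y (r + 1) : ℤ) - acc = 0 := by simpa using hb
        omega
      refine Wp.skip (Wp.skip ⟨by omega, hmm, rfl, ?_, fun a ha => ?_⟩)
      · rw [hstep]
        simp only [heq, and_true, ne_eq]
        rw [← h10']
        rfl
      · rw [← hfr a ha]
        simp only [List.mem_cons, not_or, List.not_mem_nil, not_false_eq_true, and_true] at ha
        simp [ha]
  · refine ⟨le_rfl, rfl, h17, ?_, fun _ _ => rfl⟩
    rw [h10]
    simp only [ne_eq, Nat.cast_eq_zero, iff_self_and]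
    intro _ z hz hz2; omega
  · rintro σ' - ⟨-, hm, -, h10, hf⟩
    exact ⟨hm, by simpa using h10, hf⟩

/-- When 1 is added to `N`, the carry into digit `q` is `(N + 1) / b ^ q - N / b ^ q`. The identity
`x % b + (y - x) = y - b * (x / b)` for `x ≤ y` gives both the new digit and the next carry. -/
theorem carry_step (b N q : ℕ) :
    (N / b ^ q % b + ((N + 1) / b ^ q - N / b ^ q)) % b = (N + 1) / b ^ q % b ∧
    (N / b ^ q % b + ((N + 1) / b ^ q - N / b ^ q)) / b =
      (N + 1) / b ^ (q + 1) - N / b ^ (q + 1) := by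
  rw [pow_succ, ← Nat.div_div_eq_div_mul, ← Nat.div_div_eq_div_mul]
  have h : N / b ^ q ≤ (N + 1) / b ^ q := Nat.div_le_div_right (Nat.le_succ N)
  generalize N / b ^ q = x at *
  generalize (N + 1) / b ^ q = y at *
  have h1 : x % b + (y - x) = y - b * (x / b) := by
    have := Nat.div_add_mod x b
    omega
  have h2 : b * (x / b) ≤ y := (Nat.mul_div_le x b).trans h
  rw [h1]
  exact ⟨Nat.sub_mul_mod h2, Nat.sub_mul_div y b _⟩

/-- In the invariant the cells from `r` on already show `N + 1` and the others still show `N`. The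
carry left at the end is the overflow past the top digit. -/
theorem carryLoop_wp (hE : PostEnv w L p s B) (hR : PostRegs p s σ) {N : ℕ}
    (hmem : ∀ r < s, σ.mem 8 r = N / (p * (p - 1)) ^ (s - 1 - r) % (p * (p - 1)))
    (h13 : σ.reg 13 = s) (h22 : σ.reg 22 = 1) :
    Wp w L (.loop 13 carryBody) (fun σ' _ => (∀ A ≠ 8, σ'.mem A = σ.mem A) ∧
      (∀ r < s, σ'.mem 8 r = (N + 1) / (p * (p - 1)) ^ (s - 1 - r) % (p * (p - 1))) ∧
      σ'.reg 22 = ((N + 1) / (p * (p - 1)) ^ s - N / (p * (p - 1)) ^ s : ℕ) ∧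
      ∀ a ∉ [13, 14, 22], σ'.reg a = σ.reg a) σ := by
  obtain ⟨hb1, hb2, hb3, hb4⟩ := hE.bounds
  have hp := hE.two_le
  set b := p * (p - 1) with hb
  have hcar : ∀ q, (N + 1) / b ^ q - N / b ^ q ≤ 1 := fun q => by
    rw [Nat.sub_le_iff_le_add, Nat.succ_div]
    split_ifs <;> omega
  refine Wp.mono (Wp.loop (fun r τ => r ≤ s ∧ τ.reg 13 = r ∧ (∀ A ≠ 8, τ.mem A = σ.mem A) ∧
      (∀ i < s, τ.mem 8 i = (if r ≤ i then N + 1 else N) / b ^ (s - 1 - i) % b) ∧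
      τ.reg 22 = ((N + 1) / b ^ (s - r) - N / b ^ (s - r) : ℕ) ∧
      ∀ a ∉ [13, 14, 22], τ.reg a = σ.reg a)
    (fun r τ h => by rw [h.2.1]; simp) ?_ s σ ?_) ?_
  · rintro r τ ⟨hr, h13, hA, hm, h22, hf⟩
    have hR' := hR.of_frame hf (by decide)
    have hs1 : s - r = (s - (r + 1)) + 1 := by omega
    have hs2 : s - 1 - r = s - (r + 1) := by omega
    have hmod : N / b ^ (s - (r + 1)) % b < b := Nat.mod_lt _ hb2
    have hc := hcar (s - (r + 1))
    refine Wp.mono (carryBody_wp hR'.1 hR'.2.2.2.2.2 h13 h22 hr (by omega) hE.len8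
      ((hm r hr).trans (by rw [if_neg (by omega), hs2])) hb2 (by omega) hE.width8) ?_
    rintro τ' - ⟨hm', h13', h22', hf'⟩
    refine ⟨by omega, h13', fun A h => ?_, fun i hi => ?_, ?_,
      fun a ha => (hf' a ha).trans (hf a ha)⟩
    · rw [← hA A h, hm']
      funext i
      simp [h]
    · rw [hm', RamState.setMem_mem]
      by_cases hir : i = r
      · subst hir
        rw [if_pos ⟨rfl, rfl⟩, if_pos le_rfl, hs2]
        exact (carry_step b N _).1
      · rw [if_neg (by simp [hir]), hm i hi]
        congr 2
        by_cases h : r ≤ i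
        · rw [if_pos h, if_pos (by omega)]
        · rw [if_neg h, if_neg (by omega)]
    · rw [h22', hs1, (carry_step b N _).2]
  · refine ⟨le_rfl, h13, fun _ _ => rfl, fun i hi => ?_, by simp [h22], fun _ _ => rfl⟩
    rw [hmem i hi, if_neg (by omega)]
  · rintro σ' - ⟨-, -, hA, hm, h22, hf⟩
    exact ⟨hA, fun r hr => by rw [hm r hr, if_pos (Nat.zero_le _)], by simpa using h22, hf⟩

end TLE

/-! ### The exhaustive search and the sum over the buckets -/

namespace TLE

variable {w : ℕ} {L : Layout} {p s B : ℕ} {σ : RamState}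

/-- Register 9 is one minus the overflow of the increment, hence becomes 0 just after the last
candidate and ends the search. -/
theorem tryBody_wp (hE : PostEnv w L p s B) (hR : PostRegs p s σ) {T Y : ℕ → ℕ} {N : ℕ}
    (hmem : ∀ r < s, σ.mem 8 r = N / (p * (p - 1)) ^ (s - 1 - r) % (p * (p - 1)))
    (hT : ∀ i < p - 1, σ.mem 6 i = T i) (hTp : ∀ i < p - 1, T i < p) {off : ℕ}
    (hoff : off + 2 * s ≤ B * (2 * s)) (hY : ∀ r < 2 * s, σ.mem 0 (off + r) = Y (r + 1))
    (hYp : ∀ z, Y z < p) (h20 : σ.reg 20 = off) (hN : N < (p * (p - 1)) ^ s) :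
    Wp w L tryBody (fun σ' _ => (∀ A ≠ 8, σ'.mem A = σ.mem A) ∧
      (∀ r < s, σ'.mem 8 r = (N + 1) / (p * (p - 1)) ^ (s - 1 - r) % (p * (p - 1))) ∧
      (IsCandidate p s T Y (codeExp p N) (codeVal p N) →
        σ'.reg 8 = absSum p s (codeVal p N)) ∧
      (¬ IsCandidate p s T Y (codeExp p N) (codeVal p N) → σ'.reg 8 = σ.reg 8) ∧
      σ'.reg 9 = (1 - (N + 1) / (p * (p - 1)) ^ s : ℕ) ∧
      ∀ a ∉ [8, 9, 10, 11, 12, 13, 14, 15, 16, 17, 18, 19, 21, 22], σ'.reg a = σ.reg a) σ := by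
  obtain ⟨hb1, hb2, hb3, hb4⟩ := hE.bounds
  have hp := hE.two_le
  have hf4 := hE.four
  have hsp : absSum p s (codeVal p N) ≤ s * p :=
    absSum_le p s fun i _ => Nat.mod_lt _ (by omega)
  have hD : ∀ q, N / (p * (p - 1)) ^ q % (p * (p - 1)) < p * (p - 1) := fun q => Nat.mod_lt _ hb2
  unfold tryBody Prog.block
  simp only [List.foldr]
  refine Wp.const (by rw [abs_one]; exact_mod_cast (by omega : 1 < 2 ^ w)) ?_
  refine Wp.const (by simp) ?_
  refine Wp.const (by simp) ?_
  refine Wp.mul s 1 hR.2.2.2.1 hR.1 (by omega) ?_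
  refine Wp.seq (Wp.mono (scanLoop_wp hE (by exact hR) hD hmem rfl rfl rfl
    (by change ((s * 1 : ℕ) : ℤ) = s; rw [Nat.mul_one])) ?_)
  rintro σ₁ - ⟨hm1, ⟨o, h10, ho, hoq⟩, h12, hf1⟩
  have hm1 : σ₁.mem = σ.mem := hm1
  have hfr1 : ∀ a ∉ [10, 11, 12, 13, 14, 15, 16, 19, 21], σ₁.reg a = σ.reg a := fun a ha => by
    rw [hf1 a ha]
    simp only [List.mem_cons, not_or, List.not_mem_nil, not_false_eq_true, and_true] at ha
    simp [ha]
  clear hf1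
  have hR1 := hR.of_frame hfr1 (by decide)
  refine Wp.mul (2 * s) 1 hR1.2.2.1 hR1.1 (by omega) ?_
  refine Wp.seq (Wp.mono (checkLoop_wp hE (by exact hR1) hD (fun r hr => by
    rw [← hmem r hr, ← hm1]; rfl) (fun i hi => by rw [← hT i hi, ← hm1]; rfl) hTp hoff
    (fun r hr => by rw [← hY r hr, ← hm1]; rfl) hYp h10
    (by change ((2 * s * 1 : ℕ) : ℤ) = _; rw [Nat.mul_one])
    ((hfr1 20 (by decide)).trans h20)) ?_)
  rintro σ₂ - ⟨hm2, h10', hf2⟩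
  have hm2 : σ₂.mem = σ.mem := hm2.trans hm1
  have hfr2 : ∀ a ∉ [10, 13, 14, 15, 16, 17, 18, 19], σ₂.reg a = σ₁.reg a := fun a ha => by
    rw [hf2 a ha]
    simp only [List.mem_cons, not_or, List.not_mem_nil, not_false_eq_true, and_true] at ha
    simp [ha]
  clear hf2
  have hR2 := hR1.of_frame hfr2 (by decide)
  have hcand : σ₂.reg 10 ≠ 0 ↔ IsCandidate p s T Y (codeExp p N) (codeVal p N) := by
    rw [h10', hoq]; rfl
  have h12' : σ₂.reg 12 = absSum p s (codeVal p N) := (hfr2 12 (by decide)).trans h12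
  have h8' : σ₂.reg 8 = σ.reg 8 := (hfr2 8 (by decide)).trans (hfr1 8 (by decide))
  have hfr12 : ∀ a ∉ [8, 9, 10, 11, 12, 13, 14, 15, 16, 17, 18, 19, 21, 22],
      σ₂.reg a = σ.reg a := fun a ha => by
    simp only [List.mem_cons, not_or, List.not_mem_nil, not_false_eq_true, and_true] at ha
    rw [hfr2 a (by simp [ha]), hfr1 a (by simp [ha])]
  refine Wp.seq (Wp.mono (Q := fun τ _ => τ.mem = σ.mem ∧
      (IsCandidate p s T Y (codeExp p N) (codeVal p N) →
        τ.reg 8 = absSum p s (codeVal p N)) ∧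
      (¬ IsCandidate p s T Y (codeExp p N) (codeVal p N) → τ.reg 8 = σ.reg 8) ∧
      ∀ a ≠ 8, τ.reg a = σ₂.reg a) (Wp.branch (fun hb => ?_) fun hb => ?_) ?_)
  · refine Wp.mul _ 1 h12' hR2.1 (by omega) ?_
    refine Wp.skip ⟨hm2, fun _ => ?_, fun h => absurd (hcand.1 hb) h, fun a ha => ?_⟩
    · change ((_ * 1 : ℕ) : ℤ) = _
      rw [Nat.mul_one]
    · simp [ha]
  · exact Wp.skip ⟨hm2, fun h => absurd hb (hcand.2 h), fun _ => h8', fun _ _ => rfl⟩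
  rintro σ₃ - ⟨hm3, hc, hc', hf3⟩
  have hR3 := hR2.of_frame (l := [8]) (fun a ha => hf3 a (by simpa using ha)) (by decide)
  refine Wp.const (by rw [abs_one]; exact_mod_cast (by omega : 1 < 2 ^ w)) ?_
  refine Wp.mul s 1 hR3.2.2.2.1 hR3.1 (by omega) ?_
  refine Wp.seq (Wp.mono (carryLoop_wp hE (by exact hR3) (N := N) (fun r hr => by
    rw [← hmem r hr, ← hm3]; rfl) (by change ((s * 1 : ℕ) : ℤ) = s; rw [Nat.mul_one]) rfl) ?_)
  rintro σ₄ - ⟨hA, hm4, h22, hf4⟩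
  have h22' : σ₄.reg 22 = ((N + 1) / (p * (p - 1)) ^ s : ℕ) := by
    rw [h22, Nat.div_eq_of_lt hN, Nat.sub_zero]
  have h1 : σ₄.reg 1 = 1 := (hf4 1 (by decide)).trans hR3.1
  have hle : (N + 1) / (p * (p - 1)) ^ s ≤ 1 :=
    Nat.div_le_of_le_mul (by rw [Nat.mul_one]; exact hN)
  refine Wp.sub 1 _ h1 h22' hle (by omega) ?_
  have h8 : σ₄.reg 8 = σ₃.reg 8 := hf4 8 (by decide)
  refine Wp.skip ⟨fun A h => (hA A h).trans (congrFun hm3 A), hm4, fun h => h8.trans (hc h),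
    fun h => h8.trans (hc' h), rfl, fun a ha => ?_⟩
  rw [← hfr12 a ha]
  simp only [List.mem_cons, not_or, List.not_mem_nil, not_false_eq_true, and_true] at ha
  rw [← hf3 a (by simp [ha])]
  simp only [RamState.setReg_reg, if_neg ha.2.1]
  rw [hf4 a (by simp [ha])]
  simp [ha]

/-- The search does not stop at a success. Register 8 is 0 until the first candidate and `out` from
then on, since later candidates write the same value. -/
theorem bucketBody_wp (hE : PostEnv w L p s B) (hR : PostRegs p s σ) {T Y : ℕ → ℕ}
    (hmem : ∀ i < s, σ.mem 8 i = 0)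
    (hT : ∀ i < p - 1, σ.mem 6 i = T i) (hTp : ∀ i < p - 1, T i < p) {j tot out : ℕ}
    (hj : j < B) (hY : ∀ r < 2 * s, σ.mem 0 (j * (2 * s) + r) = Y (r + 1))
    (hYp : ∀ z, Y z < p) (h7 : σ.reg 7 = (j + 1 : ℕ)) (h0 : σ.reg 0 = tot)
    (hBw : B < 2 ^ w) (htot : tot + out < 2 ^ w)
    (hout : ∀ N < (p * (p - 1)) ^ s, IsCandidate p s T Y (codeExp p N) (codeVal p N) →
      absSum p s (codeVal p N) = out)
    (hout0 : (∀ N < (p * (p - 1)) ^ s, ¬ IsCandidate p s T Y (codeExp p N) (codeVal p N)) →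
      out = 0) :
    Wp w L bucketBody (fun σ' _ => (∀ A ≠ 8, σ'.mem A = σ.mem A) ∧ (∀ i < s, σ'.mem 8 i = 0) ∧
      σ'.reg 7 = j ∧ σ'.reg 0 = (tot + out : ℕ) ∧ PostRegs p s σ') σ := by
  obtain ⟨hb1, hb2, hb3, hb4⟩ := hE.bounds
  have hp := hE.two_le
  have hf4 := hE.four
  have hidx := hE.index
  have hoff : j * (2 * s) + 2 * s ≤ B * (2 * s) :=
    (Nat.succ_mul j (2 * s)).symm.trans_le (Nat.mul_le_mul_right _ hj)
  set b := p * (p - 1) with hb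
  unfold bucketBody Prog.block
  simp only [List.foldr]
  refine Wp.sub (j + 1) 1 h7 hR.1 (by omega) (by omega) ?_
  refine Wp.mul j (2 * s) rfl hR.2.2.1 (by omega) ?_
  refine Wp.const (by simp) ?_
  refine Wp.const (by rw [abs_one]; exact_mod_cast (by omega : 1 < 2 ^ w)) ?_
  refine Wp.seq (Wp.mono (Wp.loop (fun r τ => ∃ N, N + r = b ^ s ∧
      (∀ A ≠ 8, τ.mem A = σ.mem A) ∧
      (∀ i < s, τ.mem 8 i = N / b ^ (s - 1 - i) % b) ∧ τ.reg 9 = (1 - N / b ^ s : ℕ) ∧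
      ((∀ N' < N, ¬ IsCandidate p s T Y (codeExp p N') (codeVal p N')) ∧ τ.reg 8 = 0 ∨
        τ.reg 8 = out) ∧
      PostRegs p s τ ∧ τ.reg 20 = (j * (2 * s) : ℕ) ∧ τ.reg 7 = j ∧ τ.reg 0 = tot)
    ?_ ?_ (b ^ s) _ ?_) ?_)
  · rintro r τ ⟨N, hN, -, -, h9, -⟩
    have hbs : 0 < b ^ s := Nat.pow_pos hb2
    rw [h9]
    rcases Nat.eq_zero_or_pos r with rfl | hr
    · have : N = b ^ s := by omega
      simp [this, Nat.div_self hbs]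
    · rw [Nat.div_eq_of_lt (by omega)]
      simp; omega
  · rintro r τ ⟨N, hN, hA, hm, h9, hval, hR', h20, h7, h0⟩
    refine Wp.mono (tryBody_wp hE hR' hm (fun i hi => by rw [hA 6 (by decide), hT i hi]) hTp hoff
      (fun i hi => by rw [hA 0 (by decide), hY i hi]) hYp h20 (show N < b ^ s by omega)) ?_
    rintro τ' - ⟨hA', hm', hc, hc', h9', hf⟩
    refine ⟨N + 1, by omega, fun A h => (hA' A h).trans (hA A h), hm', h9', ?_,
      hR'.of_frame hf (by decide), (hf 20 (by decide)).trans h20, (hf 7 (by decide)).trans h7,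
      (hf 0 (by decide)).trans h0⟩
    by_cases hcand : IsCandidate p s T Y (codeExp p N) (codeVal p N)
    · right
      rw [hc hcand, hout N (by omega) hcand]
    · rw [hc' hcand]
      refine hval.imp_left fun h => ⟨fun N' hN' => ?_, h.2⟩
      rcases Nat.lt_succ_iff_lt_or_eq.1 hN' with h' | rfl
      · exact h.1 N' h'
      · exact hcand
  · refine ⟨0, by simp, fun _ _ => rfl, fun i hi => ?_, by simp, Or.inl ⟨by simp, rfl⟩, hR, rfl,
      rfl, h0⟩
    simpa using hmem i hi
  · rintro τ - ⟨N, hN, hA, hm, -, hval, hR', -, h7, h0⟩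
    have hN : N = b ^ s := hN
    have h8 : τ.reg 8 = out := by
      rcases hval with ⟨h, h8⟩ | h8
      · rw [h8, hout0 (hN ▸ h)]; rfl
      · exact h8
    refine Wp.add tot out h0 h8 htot ?_
    refine Wp.skip ⟨hA, fun i hi => ?_, h7, rfl, hR'⟩
    refine (hm i hi).trans ?_
    -- After the overflow all `s` digits of `b ^ s` are zero, so the work space is clean for the
    -- next bucket.
    have : b ^ s = b ^ (i + 1) * b ^ (s - 1 - i) := by rw [← pow_add]; congr 1; omega
    rw [hN, this, Nat.mul_div_cancel _ (Nat.pow_pos hb2), pow_succ, Nat.mul_mod_left]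

theorem postProg_wp (hE : PostEnv w L p s B) {T : ℕ → ℕ} {Y : ℕ → ℕ → ℕ} {m : Mem}
    (hL1 : L.len 1 = 4) (hm10 : m 1 0 = p) (hm11 : m 1 1 = B) (hm13 : m 1 3 = 2 * s)
    (hm8 : ∀ i < s, m 8 i = 0)
    (hT : ∀ i < p - 1, m 6 i = T i) (hTp : ∀ i < p - 1, T i < p)
    (hY : ∀ j < B, ∀ r < 2 * s, m 0 (j * (2 * s) + r) = Y j (r + 1))
    (hYp : ∀ j z, Y j z < p) (hBw : B < 2 ^ w) (out : ℕ → ℕ) (hle : ∀ j < B, out j ≤ s * p)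
    (hout : ∀ j < B, ∀ N < (p * (p - 1)) ^ s,
      IsCandidate p s T (Y j) (codeExp p N) (codeVal p N) → absSum p s (codeVal p N) = out j)
    (hout0 : ∀ j < B, (∀ N < (p * (p - 1)) ^ s,
      ¬ IsCandidate p s T (Y j) (codeExp p N) (codeVal p N)) → out j = 0) :
    Wp w L postProg (fun σ' _ => σ'.reg 0 = (∑ j ∈ Finset.range B, out j : ℕ))
      ⟨fun _ => 0, m⟩ := by
  obtain ⟨hb1, hb2, hb3, hb4⟩ := hE.bounds
  have hp := hE.two_le
  have hf4 := hE.four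
  have htot := hE.total
  unfold postProg Prog.block
  simp only [List.foldr]
  refine Wp.const (by rw [abs_one]; exact_mod_cast (by omega : 1 < 2 ^ w)) ?_
  refine Wp.const (by simp) ?_
  refine Wp.load 0 p rfl hm10 (by omega) (by omega) ?_
  refine Wp.load 1 B rfl hm11 (by omega) hBw ?_
  refine Wp.const (by exact_mod_cast (by omega : 3 < 2 ^ w)) ?_
  refine Wp.load 3 (2 * s) rfl hm13 (by omega) hb3 ?_
  refine Wp.const (by exact_mod_cast (by omega : 2 < 2 ^ w)) ?_
  -- Memory stores `2s` only, so `s` is recovered by halving.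
  refine Wp.div (2 * s) 2 rfl rfl (by omega) hb3 ?_
  rw [Nat.mul_div_cancel_left s (by norm_num)]
  refine Wp.sub p 1 rfl rfl (by omega) (by omega) ?_
  refine Wp.mul p (p - 1) rfl rfl (by omega) ?_
  refine Wp.seq (Wp.mono (Wp.loop (fun r τ => r ≤ B ∧ τ.reg 7 = r ∧
      (∀ A ≠ 8, τ.mem A = m A) ∧ (∀ i < s, τ.mem 8 i = 0) ∧
      τ.reg 0 = (∑ j ∈ Finset.Ico r B, out j : ℕ) ∧ PostRegs p s τ)
    (fun r τ h => by rw [h.2.1]; simp) ?_ B _ ?_) ?_)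
  · rintro r τ ⟨hr, h7, hA, hm, h0, hR⟩
    have hsum : ∑ j ∈ Finset.Ico (r + 1) B, out j + out r = ∑ j ∈ Finset.Ico r B, out j := by
      rw [Finset.sum_eq_sum_Ico_succ_bot hr, add_comm]
    have hbound : ∑ j ∈ Finset.Ico r B, out j ≤ B * (s * p) := by
      refine (Finset.sum_le_card_nsmul _ _ (s * p) fun j hj => hle j (Finset.mem_Ico.1 hj).2).trans ?_
      rw [Nat.card_Ico, smul_eq_mul]
      exact Nat.mul_le_mul_right _ (Nat.sub_le _ _)
    refine Wp.mono (bucketBody_wp hE hR hm (fun i hi => by rw [hA 6 (by decide), hT i hi]) hTp hr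
      (fun i hi => by rw [hA 0 (by decide), hY r hr i hi]) (hYp r) h7 h0 hBw (by omega)
      (hout r hr) (hout0 r hr)) ?_
    rintro τ' - ⟨hA', hm', h7', h0', hR'⟩
    exact ⟨by omega, h7', fun A h => (hA' A h).trans (hA A h), hm', by rw [h0', hsum], hR'⟩
  · exact ⟨le_rfl, rfl, fun _ _ => rfl, hm8, by simp, rfl, rfl, rfl, rfl, rfl, rfl⟩
  · rintro τ - ⟨-, -, -, -, h0, -⟩
    refine Wp.skip ?_
    rw [h0, Finset.range_eq_Ico]

end TLE

/-! ### Sufficient word length, and the output from the final counters -/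

namespace TLE

/-- Every quantity is polynomial in `N = n + M + k`, and `N ≥ 3` lets numerical constants be
absorbed into powers of `N`. The largest power needed is `N ^ 23`, so the exponent 40 is generous.
-/
theorem wordBounds_of_pow_le {w n M k p ℓ₁ ℓ₂ : ℕ} (hn : 1 ≤ n) (hk : 2 ≤ k)
    (hp : p ≤ 2 * cPar k) (h₁ : ℓ₁ ≤ 4 * max n (buckets k)) (h₂ : ℓ₂ ≤ 4 * max n (p - 1))
    (hw : (n + M + k) ^ 40 ≤ 2 ^ w) : WordBounds w n k p ℓ₁ ℓ₂ := by
  obtain ⟨N, hN⟩ : ∃ N, N = n + M + k := ⟨_, rfl⟩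
  rw [← hN] at hw
  have hlt : 1 < N → ∀ {x : ℕ}, x ≤ N ^ 39 → x < 2 ^ w := fun h1 _ h =>
    lt_of_lt_of_le (lt_of_le_of_lt h (Nat.pow_lt_pow_right h1 (by norm_num))) hw
  clear hw
  have hN3 : 3 ≤ N := by omega
  replace hlt := @hlt (by omega)
  have hpow : ∀ {a b : ℕ}, a ≤ b → N ^ a ≤ N ^ b := fun h => Nat.pow_le_pow_right (by omega) h
  have h3 : ∀ a, 3 ^ a ≤ N ^ a := fun a => Nat.pow_le_pow_left hN3 a
  have hB : buckets k ≤ N := (buckets_le hk).trans (by omega)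
  have hpN : p ≤ N ^ 11 := by
    calc p ≤ 2313 * k ^ 3 := hp.trans (cPar_le hk)
      _ ≤ 3 ^ 8 * N ^ 3 := Nat.mul_le_mul (by norm_num) (Nat.pow_le_pow_left (by omega) 3)
      _ ≤ N ^ 8 * N ^ 3 := Nat.mul_le_mul_right _ (h3 8)
      _ = N ^ 11 := by ring
  have hs : sPar k ≤ N ^ 4 := by
    have := ceilLog_le_self k
    rw [sPar_eq]
    calc 5 * ceilLog k + 24 ≤ 27 * N := by omega
      _ ≤ N ^ 3 * N := Nat.mul_le_mul_right _ (h3 3)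
      _ = N ^ 4 := by ring
  have h2N : ∀ a, 2 * N ^ a ≤ N ^ (a + 1) := fun a => by
    rw [pow_succ']; exact Nat.mul_le_mul_right _ (by omega)
  have hNa : ∀ a, 0 < a → N ≤ N ^ a := fun a ha => by simpa using hpow (a := 1) ha
  have hℓ : ∀ {x y : ℕ}, x ≤ 4 * max n y → y ≤ N ^ 11 → x ≤ N ^ 13 := fun {x y} hx hy => by
    calc x ≤ 4 * max n y := hx
      _ ≤ 3 ^ 2 * N ^ 11 := Nat.mul_le_mul (by norm_num)
        (max_le ((by omega : n ≤ N).trans (hNa 11 (by norm_num))) hy)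
      _ ≤ N ^ 2 * N ^ 11 := Nat.mul_le_mul_right _ (h3 2)
      _ = N ^ 13 := by ring
  have hash : ∀ {x : ℕ}, x ≤ N ^ 13 → n * x + x < 2 ^ w := fun {x} hx => hlt (by
    calc n * x + x = (n + 1) * x := by ring
      _ ≤ N * N ^ 13 := Nat.mul_le_mul (by omega) hx
      _ = N ^ 14 := by ring
      _ ≤ N ^ 39 := hpow (by norm_num))
  have h2s : 2 * sPar k ≤ N ^ 5 := (Nat.mul_le_mul_left 2 hs).trans (h2N 4)
  refine ⟨hash (hℓ h₁ (hB.trans (hNa 11 (by norm_num)))),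
    hash (hℓ h₂ ((Nat.sub_le _ _).trans hpN)), hlt ?_, hlt ?_, hlt ?_, hlt ?_, hlt ?_⟩
  · calc p * p + p = (p + 1) * p := by ring
      _ ≤ (2 * N ^ 11) * N ^ 11 := Nat.mul_le_mul
        (by have : 0 < N ^ 11 := Nat.pow_pos (by omega)
            omega) hpN
      _ = 2 * N ^ 22 := by ring
      _ ≤ N ^ 23 := h2N 22
      _ ≤ _ := hpow (by norm_num)
  · calc 2 * sPar k * p ≤ N ^ 5 * N ^ 11 := Nat.mul_le_mul h2s hpN
      _ = N ^ 16 := by ring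
      _ ≤ _ := hpow (by norm_num)
  · calc buckets k * (2 * sPar k) ≤ N * N ^ 5 := Nat.mul_le_mul hB h2s
      _ = N ^ 6 := by ring
      _ ≤ _ := hpow (by norm_num)
  · calc buckets k * (sPar k * p) ≤ N * (N ^ 4 * N ^ 11) :=
          Nat.mul_le_mul hB (Nat.mul_le_mul hs hpN)
      _ = N ^ 16 := by ring
      _ ≤ _ := hpow (by norm_num)
  · calc 4 ≤ 3 ^ 2 := by norm_num
      _ ≤ N ^ 2 := h3 2
      _ ≤ _ := hpow (by norm_num)

theorem WordBounds.postEnv {w n k p ℓ₁ ℓ₂ : ℕ} (h : WordBounds w n k p ℓ₁ ℓ₂) (hp : 2 ≤ p) :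
    PostEnv w (fullLayout k p ℓ₁ ℓ₂) p (sPar k) (buckets k) where
  two_le := hp
  len0 := (show 2 * sPar k * buckets k = _ from mul_comm _ _)
  len6 := rfl
  len8 := rfl
  width8 := by
    change p * (p - 1) ≤ 2 ^ (2 * Nat.size p)
    have := (Nat.lt_size_self p).le
    rw [two_mul, pow_add]
    exact Nat.mul_le_mul this ((Nat.sub_le _ _).trans this)
  prime_sq := h.prime_sq
  exponent := h.exponent
  index := h.index
  total := h.total
  four := h.four

theorem Holds.returns {n k p ℓ₁ ℓ₂ w : ℕ} [Fact p.Prime] {g : (ZMod p)ˣ}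
    {c : Fin (tPar k) → Fin ℓ₁} {d : Fin 2 → Fin ℓ₂} (hW : WordBounds w n k p ℓ₁ ℓ₂) (hk : 2 ≤ k)
    (hp : cPar k ≤ p) (hg : ∀ x : (ZMod p)ˣ, x ∈ Subgroup.zpowers g) {m : Mem}
    {X : ℕ → ℕ → ZMod p} (h : Holds g c d m X) :
    Returns w (fullLayout k p ℓ₁ ℓ₂) postProg m (outputOf k p X) := by
  have hp2 : 2 ≤ p := (Fact.out : p.Prime).two_le
  have hpar := param_lt hk hp
  have hE := hW.postEnv hp2
  have hsp : sPar k ≤ p - 1 := by have := hpar.2.1; have := sPar_pos k; omega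
  have hout0 : ∀ j, (∀ N < (p * (p - 1)) ^ sPar k,
      ¬ IsCandidate p (sPar k) (table₁ g) (fun z => (X (j + 1) z).val) (codeExp p N)
        (codeVal p N)) → bucketOut (sPar k) (X (j + 1)) = 0 := fun j =>
    bucketOut_eq_zero hg hsp
  -- Needed so that the running total fits into a word, even for streams with `L₁ > k`, where the
  -- recovered vectors are unrelated to the frequencies.
  have hle : ∀ j, bucketOut (sPar k) (X (j + 1)) ≤ sPar k * p := by
    intro j
    by_cases hex : ∃ N < (p * (p - 1)) ^ sPar k,
      IsCandidate p (sPar k) (table₁ g) (fun z => (X (j + 1) z).val) (codeExp p N) (codeVal p N)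
    · obtain ⟨N, -, hN⟩ := hex
      rw [← bucketOut_eq hg hN]
      exact absSum_le _ _ fun i _ => Nat.mod_lt _ (by omega)
    · push Not at hex
      rw [hout0 j hex]; exact Nat.zero_le _
  obtain ⟨σ, T, he, h0⟩ := postProg_wp hE (T := table₁ g)
    (Y := fun j z => (X (j + 1) z).val) (m := m) rfl (h.1 1 (by decide) 0) (h.1 1 (by decide) 1)
    (h.1 1 (by decide) 3) (fun i _ => h.1 8 (by decide) i) (fun i _ => h.1 6 (by decide) i)
    (fun i _ => table₁_lt g i)
    (fun j hj r hr => by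
      have := h.2 (j + 1) (by simp; omega) (r + 1) (by simp; omega)
      simpa using this)
    (fun j z => ZMod.val_lt _)
    (hpar.2.2.2.1.trans (by have := hW.prime_sq; omega))
    (fun j => bucketOut (sPar k) (X (j + 1))) (fun j _ => hle j)
    (fun j _ N _ hN => bucketOut_eq hg hN) (fun j _ => hout0 j)
  refine ⟨σ, T, he, ?_⟩
  rw [h0, outputOf, Finset.range_eq_Ico, Finset.sum_Ico_add' (fun j => bucketOut (sPar k) (X j))]
  push_cast
  refine Finset.sum_congr (by ext; simp) fun j _ => ?_
  rw [bucketOut]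
  push_cast
  rfl

end TLE

/-! ### Probabilities -/

section Prob

variable {Ω : Type} [Fintype Ω]

theorem prob_eq_sum (E : Ω → Prop) [DecidablePred E] :
    prob E = (∑ ω, if E ω then (1 : ℝ) else 0) / Fintype.card Ω := by
  rw [prob, Finset.sum_boole, Nat.card_eq_fintype_card, Fintype.card_subtype]

theorem prob_nonneg (E : Ω → Prop) : 0 ≤ prob E := by unfold prob; positivity

/-- Markov's inequality: if on `E` at least `c` of the events `A i` happen, then `c` times the
probability of `E` is at most the sum of their probabilities. -/
theorem mul_prob_le_sum {ι : Type*} (s : Finset ι) (A : ι → Ω → Prop) (E : Ω → Prop) (c : ℕ)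
    (h : ∀ ω, E ω → ∃ s' ⊆ s, c ≤ s'.card ∧ ∀ i ∈ s', A i ω) :
    c * prob E ≤ ∑ i ∈ s, prob (A i) := by
  classical
  simp only [prob_eq_sum]
  rw [← Finset.sum_div, ← mul_div_assoc]
  refine div_le_div_of_nonneg_right ?_ (by positivity)
  rw [Finset.sum_comm, Finset.mul_sum]
  refine Finset.sum_le_sum fun ω _ => ?_
  split_ifs with hE
  · obtain ⟨s', hs, hc, hA⟩ := h ω hE
    rw [mul_one]
    calc (c : ℝ) ≤ s'.card := by exact_mod_cast hc
      _ = ∑ i ∈ s', if A i ω then (1 : ℝ) else 0 := by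
          rw [Finset.sum_congr rfl fun i hi => if_pos (hA i hi)]; simp
      _ ≤ _ := Finset.sum_le_sum_of_subset_of_nonneg hs fun i _ _ => by positivity
  · rw [mul_zero]
    exact Finset.sum_nonneg fun i _ => by positivity

theorem prob_le_sum {ι : Type*} (s : Finset ι) (A : ι → Ω → Prop) (E : Ω → Prop)
    (h : ∀ ω, E ω → ∃ i ∈ s, A i ω) : prob E ≤ ∑ i ∈ s, prob (A i) := by
  have := mul_prob_le_sum s A E 1 fun ω hω => by
    obtain ⟨i, hi, hA⟩ := h ω hω
    exact ⟨{i}, by simpa using hi, by simp, by simpa using hA⟩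
  simpa using this

theorem prob_eq_zero {E : Ω → Prop} (h : ∀ ω, ¬ E ω) : prob E = 0 := by
  have : IsEmpty {ω // E ω} := ⟨fun x => h x.1 x.2⟩
  simp [prob]

theorem prob_true [Nonempty Ω] : prob (fun _ : Ω => True) = 1 := by
  classical
  rw [prob_eq_sum]
  simp

/-- The union bound for the complement of `E`. -/
theorem one_sub_le_prob [Nonempty Ω] {E A B : Ω → Prop} (h : ∀ ω, ¬ A ω → ¬ B ω → E ω) :
    1 - prob A - prob B ≤ prob E := by
  have := prob_le_sum (Finset.univ : Finset (Fin 3)) ![A, B, E] (fun _ : Ω => True) fun ω _ => by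
    by_cases hA : A ω
    · exact ⟨0, by simp, hA⟩
    by_cases hB : B ω
    · exact ⟨1, by simp, hB⟩
    exact ⟨2, by simp, h ω hA hB⟩
  rw [prob_true, Fin.sum_univ_three] at this
  change 1 ≤ prob A + prob B + prob E at this
  linarith

theorem prob_prod {Ω' : Type} [Fintype Ω'] (E : Ω → Prop) (F : Ω' → Prop) :
    prob (fun ω : Ω × Ω' => E ω.1 ∧ F ω.2) = prob E * prob F := by
  classical
  simp only [prob_eq_sum]
  rw [Fintype.card_prod, div_mul_div_comm, Nat.cast_mul, Finset.sum_mul_sum,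
    Fintype.sum_prod_type]
  congr 1
  refine Finset.sum_congr rfl fun a _ => Finset.sum_congr rfl fun b _ => ?_
  by_cases h1 : E a <;> by_cases h2 : F b <;> simp [h1, h2]

theorem prob_fst {Ω' : Type} [Fintype Ω'] [Nonempty Ω'] (E : Ω → Prop) :
    prob (fun ω : Ω × Ω' => E ω.1) = prob E := by
  have := prob_prod E (fun _ : Ω' => True)
  simpa [prob_true] using this

theorem sum_prob_eq [Nonempty Ω] {h : Ω → ℕ} {s : Finset ℕ} (hh : ∀ ω, h ω ∈ s) :
    ∑ y ∈ s, prob (fun ω => h ω = y) = 1 := by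
  classical
  simp only [prob_eq_sum]
  rw [← Finset.sum_div, Finset.sum_comm]
  have : ∀ ω, ∑ y ∈ s, (if h ω = y then (1 : ℝ) else 0) = 1 := fun ω => by
    rw [Finset.sum_ite_eq, if_pos (hh ω)]
  simp [this]

namespace IsHashFamily

variable [Nonempty Ω] {m a b : ℕ} {h : Ω → Fin a → ℕ}

/-- Summing the comparison with `y'` over all `b` values gives `b · P(y) ≤ 2`. -/
theorem prob_le (H : IsHashFamily m a b h) (x : Fin a) (y : ℕ) :
    prob (fun ω => h ω x = y) ≤ 2 / b := by
  by_cases hy : y ∈ Finset.Icc 1 b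
  · have hb : 0 < b := by have := Finset.mem_Icc.1 hy; omega
    rw [le_div_iff₀ (by exact_mod_cast hb)]
    have h1 : ∑ y' ∈ Finset.Icc 1 b, prob (fun ω => h ω x = y) ≤
        ∑ y' ∈ Finset.Icc 1 b, 2 * prob (fun ω => h ω x = y') :=
      Finset.sum_le_sum fun y' hy' => H.2.2 x y hy y' hy'
    rw [← Finset.mul_sum, sum_prob_eq fun ω => H.1 ω x] at h1
    simp only [Finset.sum_const, Nat.card_Icc, nsmul_eq_mul, Nat.add_sub_cancel] at h1
    linarith
  · rw [prob_eq_zero]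
    · positivity
    · rintro ω rfl
      exact hy (H.1 ω x)

theorem prob_forall_le (H : IsHashFamily m a b h) {S : Finset (Fin a)} (hS : S.card ≤ m) (y : ℕ) :
    prob (fun ω => ∀ x ∈ S, h ω x = y) ≤ (2 / b) ^ S.card := by
  rw [H.2.1 S hS fun _ => y]
  exact (Finset.prod_le_prod (fun _ _ => prob_nonneg _) fun x _ => H.prob_le x y).trans
    (Finset.prod_const _).le

/-- Split by the common value `y`: one factor is at most `2 / b`, and the other sums to 1. -/
theorem prob_collision_le (H : IsHashFamily m a b h) (hm : 2 ≤ m) {x x' : Fin a} (hx : x ≠ x') :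
    prob (fun ω => h ω x = h ω x') ≤ 2 / b := by
  calc prob (fun ω => h ω x = h ω x')
      ≤ ∑ y ∈ Finset.Icc 1 b, prob (fun ω => ∀ i ∈ ({x, x'} : Finset (Fin a)), h ω i = y) :=
        prob_le_sum _ _ _ fun ω hω => ⟨h ω x, H.1 ω x, by simp [hω]⟩
    _ = ∑ y ∈ Finset.Icc 1 b, prob (fun ω => h ω x = y) * prob (fun ω => h ω x' = y) := by
        refine Finset.sum_congr rfl fun y _ => ?_
        rw [H.2.1 _ (by rw [Finset.card_pair hx]; exact hm) fun _ => y, Finset.prod_pair hx]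
    _ ≤ ∑ y ∈ Finset.Icc 1 b, prob (fun ω => h ω x = y) * (2 / b) :=
        Finset.sum_le_sum fun y _ =>
          mul_le_mul_of_nonneg_left (H.prob_le x' y) (prob_nonneg _)
    _ = 2 / b := by rw [← Finset.sum_mul, sum_prob_eq fun ω => H.1 ω x, one_mul]

/-- The probability that more than `s` of at most `K` points have the hash value `y`. -/
theorem prob_bucket_le (H : IsHashFamily m a b h) (S : Finset (Fin a)) {s : ℕ} (hs : m ≤ s + 1)
    (y : ℕ) :
    prob (fun ω => s < (S.filter fun x => h ω x = y).card) ≤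
      (S.card * (2 / b) / (s + 2 - m : ℕ)) ^ m := by
  -- Markov's inequality for the number of `m`-subsets mapped entirely to `y`: an overfull bucket
  -- contains at least `(s + 1).choose m` of them.
  have h1 := mul_prob_le_sum (S.powersetCard m) (fun T ω => ∀ x ∈ T, h ω x = y)
    (fun ω => s < (S.filter fun x => h ω x = y).card) ((s + 1).choose m) fun ω hω => by
      refine ⟨(S.filter fun x => h ω x = y).powersetCard m,
        Finset.powersetCard_mono (Finset.filter_subset _ _), ?_, fun T hT x hx => ?_⟩
      · rw [Finset.card_powersetCard]
        exact Nat.choose_le_choose m hω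
      · exact (Finset.mem_filter.1 ((Finset.mem_powersetCard.1 hT).1 hx)).2
  have h2 : ∑ T ∈ S.powersetCard m, prob (fun ω => ∀ x ∈ T, h ω x = y) ≤
      S.card.choose m * (2 / b : ℝ) ^ m := by
    refine (Finset.sum_le_card_nsmul _ _ ((2 / b : ℝ) ^ m) fun T hT => ?_).trans ?_
    · have hc := (Finset.mem_powersetCard.1 hT).2
      have := H.prob_forall_le (hc.le) y
      rwa [hc] at this
    · rw [Finset.card_powersetCard, nsmul_eq_mul]
  -- The upper and lower estimates of the two binomial coefficients carry the same `m!`, which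
  -- cancels.
  have h3 : (S.card.choose m : ℝ) ≤ (S.card : ℝ) ^ m / m.factorial := Nat.choose_le_pow_div m _
  have h4 : (((s + 1 + 1 - m : ℕ) ^ m : ℕ) : ℝ) / m.factorial ≤ (s + 1).choose m := by
    have := Nat.pow_le_choose (α := ℝ) m (s + 1)
    exact_mod_cast this
  have hpos : (0 : ℝ) < (s + 2 - m : ℕ) := by exact_mod_cast (by omega : 0 < s + 2 - m)
  have hf : (0 : ℝ) < m.factorial := by exact_mod_cast m.factorial_pos
  rw [div_pow, le_div_iff₀ (pow_pos hpos m)]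
  have h5 : ((s + 2 - m : ℕ) : ℝ) ^ m / m.factorial *
      prob (fun ω => s < (S.filter fun x => h ω x = y).card) ≤
      (S.card : ℝ) ^ m / m.factorial * (2 / b : ℝ) ^ m := by
    calc _ ≤ ((s + 1).choose m : ℝ) * prob (fun ω => s < (S.filter fun x => h ω x = y).card) := by
          refine mul_le_mul_of_nonneg_right ?_ (prob_nonneg _)
          exact_mod_cast h4
      _ ≤ S.card.choose m * (2 / b : ℝ) ^ m := h1.trans h2
      _ ≤ _ := by gcongr
  rw [div_mul_eq_mul_div, div_mul_eq_mul_div, div_le_div_iff_of_pos_right hf] at h5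
  rw [mul_pow, mul_comm]
  exact h5

end IsHashFamily

end Prob

/-! ### Correctness of the output -/

namespace TLE

section Freq

variable {n : ℕ}

theorem freq_nil (i : Fin n) : freq [] i = 0 := rfl

theorem freq_cons (u : Fin n × ℤ) (us : List (Fin n × ℤ)) (i : Fin n) :
    freq (u :: us) i = (if u.1 = i then u.2 else 0) + freq us i := by
  unfold freq
  by_cases h : u.1 = i <;> simp [h]

/-- Counters are linear in the updates, so they depend on the stream only through its frequency
vector. -/
theorem foldl_updateCounters (p : ℕ) (h₁ h₂ : Fin n → ℕ) (j z : ℕ) (stream : List (Fin n × ℤ)) :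
    ∀ X : ℕ → ℕ → ZMod p, stream.foldl (updateCounters p h₁ h₂) X j z =
      X j z + ∑ i, if h₁ i = j then (freq stream i : ZMod p) * (h₂ i : ZMod p) ^ z else 0 := by
  induction stream with
  | nil => intro X; simp [freq_nil]
  | cons u us ih =>
    intro X
    have : ∀ i, (if h₁ i = j then (freq (u :: us) i : ZMod p) * (h₂ i : ZMod p) ^ z else 0) =
        (if u.1 = i then (if h₁ i = j then (u.2 : ZMod p) * (h₂ i : ZMod p) ^ z else 0) else 0) +
        if h₁ i = j then (freq us i : ZMod p) * (h₂ i : ZMod p) ^ z else 0 := by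
      intro i
      rw [freq_cons]
      split_ifs <;> push_cast <;> ring
    rw [List.foldl_cons, ih]
    simp only [this, Finset.sum_add_distrib, Finset.sum_ite_eq, Finset.mem_univ, if_true]
    rw [← add_assoc]
    congr 1
    unfold updateCounters
    by_cases h : h₁ u.1 = j
    · rw [if_pos h.symm, if_pos h]
    · rw [if_neg (Ne.symm h), if_neg h, add_zero]

theorem counters_eq (p : ℕ) (h₁ h₂ : Fin n → ℕ) (j z : ℕ) (stream : List (Fin n × ℤ)) :
    counters p h₁ h₂ stream j z =
      ∑ i, if h₁ i = j then (freq stream i : ZMod p) * (h₂ i : ZMod p) ^ z else 0 := by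
  rw [counters, foldl_updateCounters, zero_add]

/-- The support of the frequency vector. -/
def support (stream : List (Fin n × ℤ)) : Finset (Fin n) :=
  Finset.univ.filter fun i => freq stream i ≠ 0

theorem card_support_le (stream : List (Fin n × ℤ)) :
    ((support stream).card : ℤ) ≤ normL1 stream := by
  calc ((support stream).card : ℤ) = ∑ i ∈ support stream, 1 := by simp
    _ ≤ ∑ i ∈ support stream, |freq stream i| :=
        Finset.sum_le_sum fun i hi => Int.one_le_abs (Finset.mem_filter.1 hi).2
    _ ≤ normL1 stream :=
        Finset.sum_le_sum_of_subset_of_nonneg (Finset.subset_univ _) fun _ _ _ => abs_nonneg _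

/-- The deterministic part: bounded loads make the vector of each bucket `s`-sparse, and the absence
of collisions keeps its frequencies at separate positions. -/
theorem output_eq_normL1 {k p : ℕ} [Fact p.Prime] (hk : 2 ≤ k) (hp : cPar k ≤ p)
    {h₁ h₂ : Fin n → ℕ} {stream : List (Fin n × ℤ)} (hL : normL1 stream ≤ k)
    (hh₁ : ∀ i, h₁ i ∈ Finset.Icc 1 (buckets k)) (hh₂ : ∀ i, h₂ i ∈ Finset.Icc 1 (p - 1))
    (hload : ∀ j ∈ Finset.Icc 1 (buckets k),
      ((support stream).filter fun i => h₁ i = j).card ≤ sPar k)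
    (hinj : ∀ i ∈ support stream, ∀ i' ∈ support stream, i ≠ i' → ¬ (h₁ i = h₁ i' ∧ h₂ i = h₂ i')) :
    output k p h₁ h₂ stream = normL1 stream := by
  classical
  have h2k := (param_lt hk hp).1
  have hne : ∀ i, (h₂ i : ZMod p) ≠ 0 := fun i => by
    have := Finset.mem_Icc.1 (hh₂ i)
    rw [Ne, ZMod.natCast_eq_zero_iff]
    exact fun h => absurd (Nat.le_of_dvd this.1 h) (by omega)
  have hf : ∀ i, signed ((freq stream i : ℤ) : ZMod p) = freq stream i := fun i => by
    refine signed_intCast ?_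
    have : |freq stream i| ≤ normL1 stream :=
      Finset.single_le_sum (f := fun i => |freq stream i|) (fun _ _ => abs_nonneg _)
        (Finset.mem_univ i)
    omega
  have hrec : ∀ j ∈ Finset.Icc 1 (buckets k),
      ∑ x, |signed (recover p (sPar k) (counters p h₁ h₂ stream j) x)| =
        ∑ i ∈ (support stream).filter fun i => h₁ i = j, |freq stream i| := by
    intro j hj
    have hsol := isSparseSolution_vectorOf (Y := counters p h₁ h₂ stream j)
      (a := fun i => Units.mk0 _ (hne i)) (v := fun i => ((freq stream i : ℤ) : ZMod p))
      (hload j hj) (fun z _ => by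
        rw [counters_eq, Finset.sum_filter, support, Finset.sum_filter]
        refine Finset.sum_congr rfl fun i _ => ?_
        by_cases h0 : freq stream i = 0
        · simp [h0]
        · simp [h0])
    rw [hsol.recover_eq, sum_apply_vectorOf (F := fun y => |signed y|) ?_ (by simp)]
    · exact Finset.sum_congr rfl fun i _ => by rw [hf i]
    -- Inside a bucket the values of `h₁` agree, so `h₂` must separate the elements; its values lie
    -- in `[p - 1]`, where congruence modulo `p` is equality.
    · intro i hi i' hi' h
      have hi := Finset.mem_filter.1 (Finset.mem_coe.1 hi)
      have hi' := Finset.mem_filter.1 (Finset.mem_coe.1 hi')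
      by_contra hii
      refine hinj i hi.1 i' hi'.1 hii ⟨hi.2.trans hi'.2.symm, ?_⟩
      have h1 := Finset.mem_Icc.1 (hh₂ i)
      have h2 := Finset.mem_Icc.1 (hh₂ i')
      have h3 := congrArg (fun x : (ZMod p)ˣ => (x : ZMod p)) h
      simp only [Units.val_mk0] at h3
      rw [ZMod.natCast_eq_natCast_iff', Nat.mod_eq_of_lt (by omega),
        Nat.mod_eq_of_lt (by omega)] at h3
      exact h3
  rw [output, outputOf, Finset.sum_congr rfl hrec,
    Finset.sum_fiberwise_of_maps_to fun i _ => hh₁ i, normL1]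
  refine Finset.sum_subset (Finset.subset_univ _) fun i _ hi => ?_
  have : freq stream i = 0 := by simpa [support] using hi
  rw [this, abs_zero]

end Freq

/-- Write `l = ⌈log k⌉`. Then `2K / B ≤ 2l` and `s + 2 - t = 3l + 14`, so the base is at most 2/3.
In `t = 2l + 12` the part `2l` beats the number of buckets, `B ≤ 2 ^ l`, because `2 · (2/3)² < 1`;
the part 12 supplies `(2/3) ^ 12 < 1/100`. -/
theorem tail_le {k : ℕ} (hk : 2 ≤ k) {K : ℝ} (h0 : 0 ≤ K) (hK : K ≤ k) :
    buckets k * (K * (2 / buckets k) / (sPar k + 2 - tPar k : ℕ)) ^ tPar k ≤ 1 / 100 := by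
  have hB : (0 : ℝ) < buckets k := by exact_mod_cast one_le_buckets hk
  have hBk : (buckets k : ℝ) ≤ k := by exact_mod_cast buckets_le hk
  have hc : Real.logb 2 k ≤ ceilLog k := logb_le_ceilLog k hk
  have hkB : (k : ℝ) ≤ buckets k * ceilLog k := (le_buckets_mul hk).trans (by gcongr)
  have hd : (sPar k + 2 - tPar k : ℕ) = 3 * ceilLog k + 14 := by unfold sPar tPar; omega
  have hk2 : (k : ℝ) ≤ 2 ^ ceilLog k := by exact_mod_cast Nat.le_pow_clog (by norm_num) k
  rw [hd]
  have hbase : K * (2 / buckets k) / (3 * ceilLog k + 14 : ℕ) ≤ 2 / 3 := by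
    push_cast
    rw [div_le_iff₀ (by positivity)]
    calc K * (2 / buckets k) ≤ buckets k * ceilLog k * (2 / buckets k) := by
          gcongr; exact hK.trans hkB
      _ = 2 * ceilLog k := by field_simp
      _ ≤ _ := by linarith
  calc (buckets k : ℝ) * (K * (2 / buckets k) / (3 * ceilLog k + 14 : ℕ)) ^ tPar k
      ≤ 2 ^ ceilLog k * (2 / 3) ^ tPar k := by gcongr; exact hBk.trans hk2
    _ = (2 * (2 / 3) ^ 2) ^ ceilLog k * (2 / 3) ^ 12 := by
        rw [tPar, pow_add, pow_mul, mul_pow]; ring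
    _ ≤ 1 * (2 / 3) ^ 12 := by
        gcongr
        exact pow_le_one₀ (by norm_num) (by norm_num)
    _ ≤ _ := by norm_num

/-- As `K ≤ B s / 5` and `p - 1 ≥ 4 s² B`, all parameters cancel and `1 / 25` remains. -/
theorem collision_le {k p : ℕ} (hk : 2 ≤ k) (hp : cPar k ≤ p) {K : ℕ} (hK : K ≤ k) :
    (K : ℝ) * K * (2 / buckets k * (2 / (p - 1 : ℕ))) ≤ 1 / 25 := by
  have hB : (0 : ℝ) < buckets k := by exact_mod_cast one_le_buckets hk
  have hc : Real.logb 2 k ≤ ceilLog k := logb_le_ceilLog k hk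
  have hkB : (k : ℝ) ≤ buckets k * ceilLog k := (le_buckets_mul hk).trans (by gcongr)
  have hK' : (K : ℝ) ≤ k := by exact_mod_cast hK
  have hs : (0 : ℝ) < sPar k := by exact_mod_cast sPar_pos k
  have hs5 : 5 * (ceilLog k : ℝ) ≤ sPar k := by
    rw [sPar_eq]; push_cast; linarith
  have hp1 : 4 * (sPar k : ℝ) ^ 2 * buckets k ≤ (p - 1 : ℕ) := by
    have := (param_lt hk hp).2.2.2.2
    exact_mod_cast (by omega : 4 * sPar k ^ 2 * buckets k ≤ p - 1)
  have hx : (K : ℝ) ≤ buckets k * (sPar k / 5) :=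
    (hK'.trans hkB).trans (by gcongr; linarith)
  calc (K : ℝ) * K * (2 / buckets k * (2 / (p - 1 : ℕ)))
      ≤ (buckets k * (sPar k / 5)) * (buckets k * (sPar k / 5)) *
        (2 / buckets k * (2 / (4 * (sPar k : ℝ) ^ 2 * buckets k))) := by gcongr
    _ = 1 / 25 := by field_simp; norm_num

/-- Union bound over overfull buckets `A` and collisions `C`. Independence of `h₁` and `h₂` is the
product space, so the collision probabilities multiply. -/
theorem prob_output_ge {n k p : ℕ} [Fact p.Prime] (hk : 2 ≤ k) (hp : cPar k ≤ p)
    {Ω₁ Ω₂ : Type} [Fintype Ω₁] [Nonempty Ω₁] [Fintype Ω₂] [Nonempty Ω₂]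
    {h₁ : Ω₁ → Fin n → ℕ} {h₂ : Ω₂ → Fin n → ℕ} (H₁ : IsHashFamily (tPar k) n (buckets k) h₁)
    (H₂ : IsHashFamily 2 n (p - 1) h₂) (stream : List (Fin n × ℤ)) (hL : normL1 stream ≤ k) :
    3 / 4 ≤ prob (fun ω : Ω₁ × Ω₂ => output k p (h₁ ω.1) (h₂ ω.2) stream = normL1 stream) := by
  classical
  set S := support stream
  have hS : S.card ≤ k := by exact_mod_cast (card_support_le stream).trans hL
  let A : Ω₁ × Ω₂ → Prop := fun ω => ∃ j ∈ Finset.Icc 1 (buckets k),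
    sPar k < (S.filter fun i => h₁ ω.1 i = j).card
  let C : Ω₁ × Ω₂ → Prop := fun ω => ∃ q ∈ S.offDiag,
    h₁ ω.1 q.1 = h₁ ω.1 q.2 ∧ h₂ ω.2 q.1 = h₂ ω.2 q.2
  have hA : prob A ≤ 1 / 100 := by
    calc prob A ≤ ∑ j ∈ Finset.Icc 1 (buckets k),
          prob (fun ω : Ω₁ × Ω₂ => sPar k < (S.filter fun i => h₁ ω.1 i = j).card) :=
          prob_le_sum _ _ _ fun ω h => h
      _ ≤ ∑ j ∈ Finset.Icc 1 (buckets k),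
          (S.card * (2 / buckets k) / (sPar k + 2 - tPar k : ℕ) : ℝ) ^ tPar k := by
          refine Finset.sum_le_sum fun j _ => ?_
          rw [prob_fst (fun ω => sPar k < (S.filter fun i => h₁ ω i = j).card)]
          exact H₁.prob_bucket_le S (by unfold sPar; omega) j
      _ ≤ 1 / 100 := by
          rw [Finset.sum_const, Nat.card_Icc, Nat.add_sub_cancel, nsmul_eq_mul]
          exact tail_le hk (by positivity) (by exact_mod_cast hS)
  have hC : prob C ≤ 1 / 25 := by
    calc prob C ≤ ∑ q ∈ S.offDiag, prob (fun ω : Ω₁ × Ω₂ =>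
          h₁ ω.1 q.1 = h₁ ω.1 q.2 ∧ h₂ ω.2 q.1 = h₂ ω.2 q.2) := prob_le_sum _ _ _ fun ω h => h
      _ ≤ S.offDiag.card • (2 / buckets k * (2 / (p - 1 : ℕ)) : ℝ) := by
          refine Finset.sum_le_card_nsmul _ _ _ fun q hq => ?_
          have hne := (Finset.mem_offDiag.1 hq).2.2
          rw [prob_prod (fun ω => h₁ ω q.1 = h₁ ω q.2) (fun ω => h₂ ω q.1 = h₂ ω q.2)]
          exact mul_le_mul (H₁.prob_collision_le (by unfold tPar; omega) hne)
            (H₂.prob_collision_le le_rfl hne) (prob_nonneg _) (by positivity)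
      _ ≤ S.card * S.card * (2 / buckets k * (2 / (p - 1 : ℕ)) : ℝ) := by
          rw [nsmul_eq_mul]
          gcongr
          rw [Finset.offDiag_card]
          exact_mod_cast Nat.sub_le _ _
      _ ≤ 1 / 25 := collision_le hk hp hS
  refine le_trans ?_ (one_sub_le_prob (A := A) (B := C) fun ω hA hC => ?_)
  · linarith
  · refine output_eq_normL1 hk hp hL (H₁.1 _) (H₂.1 _) (fun j hj => ?_) fun i hi i' hi' hne h => ?_
    · by_contra! h
      exact hA ⟨j, hj, h⟩
    · exact hC ⟨(i, i'), Finset.mem_offDiag.2 ⟨hi, hi', hne⟩, h⟩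

end TLE

/-! ### Polynomial hash functions -/

theorem prob_congr_equiv {Ω Ω' : Type} [Fintype Ω] [Fintype Ω'] (e : Ω ≃ Ω') {E : Ω → Prop}
    {F : Ω' → Prop} (h : ∀ ω, E ω ↔ F (e ω)) : prob E = prob F := by
  rw [prob, prob, Fintype.card_congr e, Nat.card_congr (e.subtypeEquiv h)]

/-- A surjective homomorphism of finite groups maps a uniformly random element to a uniformly
random element. -/
theorem prob_mem_of_surjective {G H : Type} [AddGroup G] [AddGroup H] [Fintype G] [Fintype H]
    (f : G →+ H) (hf : Function.Surjective f) (A : Finset H) :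
    prob (fun x => f x ∈ A) = A.card / Fintype.card H := by
  classical
  set κ := (Finset.univ.filter fun x => f x = 0).card
  have hκ : ∀ y, (Finset.univ.filter fun x => f x = y).card = κ := fun y =>
    AddMonoidHom.card_fiber_eq_of_mem_range f (hf y) (hf 0)
  have hG : Fintype.card G = Fintype.card H * κ := by
    rw [← Finset.card_univ, Finset.card_eq_sum_card_fiberwise
      (f := f) (t := Finset.univ) (fun _ _ => Finset.mem_univ _)]
    simp [hκ]
  have hA : (Finset.univ.filter fun x => f x ∈ A).card = A.card * κ := by
    rw [Finset.card_eq_sum_card_fiberwise (f := f) (t := A) fun x hx => by simpa using hx]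
    rw [Finset.sum_congr rfl fun y hy => ?_, Finset.sum_const, smul_eq_mul]
    rw [← hκ y, Finset.filter_filter]
    congr 1
    ext x
    simp only [Finset.mem_filter, Finset.mem_univ, true_and, and_iff_right_iff_imp]
    rintro rfl
    exact hy
  have hpos : 0 < κ := Finset.card_pos.2 ⟨0, by simp⟩
  rw [prob, Nat.card_eq_fintype_card, Fintype.card_subtype, hA, hG]
  push_cast
  rw [mul_div_mul_right _ _ (by exact_mod_cast hpos.ne')]

/-- The residues modulo `ℓ` as elements of the field. -/
def finEquivZMod (ℓ : ℕ) [NeZero ℓ] : Fin ℓ ≃ ZMod ℓ where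
  toFun a := ((a : ℕ) : ZMod ℓ)
  invFun z := ⟨z.val, ZMod.val_lt z⟩
  left_inv a := by ext; simp [ZMod.val_natCast, Nat.mod_eq_of_lt a.2]
  right_inv z := by simp

section PolyHash

variable {n m ℓ : ℕ} [Fact ℓ.Prime]

/-- The values at the points of `S` of a polynomial with coefficients `c`. -/
def evalHom (m ℓ : ℕ) (S : Finset (Fin n)) : (Fin m → ZMod ℓ) →+ (S → ZMod ℓ) :=
  AddMonoidHom.mk' (fun c x => ∑ j : Fin m, c j * (((x : Fin n) : ℕ) + 1 : ZMod ℓ) ^ (j : ℕ))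
    fun c c' => by
      funext x
      simp [add_mul, Finset.sum_add_distrib]

/-- Lagrange interpolation: the nodes `x + 1` stay distinct modulo `ℓ` because `n < ℓ`. -/
theorem evalHom_surjective (hn : n < ℓ) {S : Finset (Fin n)} (hS : S.card ≤ m) :
    Function.Surjective (evalHom m ℓ S) := by
  classical
  intro y
  let v : S → ZMod ℓ := fun x => ((x : Fin n) : ℕ) + 1
  have hv : Set.InjOn v (Finset.univ : Finset S) := by
    intro x _ x' _ h
    have h1 : (((x : Fin n) + 1 : ℕ) : ZMod ℓ) = (((x' : Fin n) + 1 : ℕ) : ZMod ℓ) := by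
      push_cast; exact h
    have h2 := (x : Fin n).2
    have h3 := (x' : Fin n).2
    rw [ZMod.natCast_eq_natCast_iff', Nat.mod_eq_of_lt (by omega), Nat.mod_eq_of_lt (by omega)] at h1
    exact Subtype.ext (Fin.ext (by omega))
  let q := Lagrange.interpolate Finset.univ v y
  refine ⟨fun j => q.coeff j, ?_⟩
  funext x
  have h1 : q.eval (v x) = y x := Lagrange.eval_interpolate_at_node y hv (Finset.mem_univ x)
  have h2 : q.degree < m := by
    refine (Lagrange.degree_interpolate_lt y hv).trans_le ?_
    simpa using hS
  rw [← h1]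
  change ∑ j : Fin m, q.coeff j * v x ^ (j : ℕ) = _
  rcases Nat.eq_zero_or_pos m with rfl | hm
  · have : q = 0 := by
      rw [← Polynomial.degree_eq_bot]
      simpa using h2
    simp [this]
  · rw [Polynomial.eval_eq_sum_range' (n := m), Finset.sum_range]
    by_cases h0 : q = 0
    · simpa [h0] using hm
    · exact (Polynomial.natDegree_lt_iff_degree_lt h0).2 h2

/-- By surjectivity the vector of values on `S` is uniform, and the event is a box. Arbitrary sets
`A x` are allowed so that the subsequent reduction modulo `b` is covered. -/
theorem prob_poly_mem (hn : n < ℓ) {S : Finset (Fin n)} (hS : S.card ≤ m)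
    (A : Fin n → Finset (ZMod ℓ)) :
    prob (fun c : Fin m → Fin ℓ => ∀ x ∈ S,
      ((∑ j : Fin m, (c j : ℕ) * ((x : ℕ) + 1) ^ (j : ℕ) : ℕ) : ZMod ℓ) ∈ A x) =
      ∏ x ∈ S, ((A x).card / ℓ : ℝ) := by
  classical
  rw [prob_congr_equiv (Equiv.arrowCongr (Equiv.refl (Fin m)) (finEquivZMod ℓ))
    (F := fun c => evalHom m ℓ S c ∈ Fintype.piFinset fun x : S => A x) fun c => ?_,
    prob_mem_of_surjective _ (evalHom_surjective hn hS)]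
  · rw [Fintype.card_piFinset, Finset.prod_div_distrib, Finset.prod_const]
    have h1 : ∏ x : S, (A x).card = ∏ x ∈ S, (A x).card :=
      Finset.prod_coe_sort S fun x => (A x).card
    rw [h1]
    simp [ZMod.card]
  · simp [evalHom, finEquivZMod]

/-- The residue classes modulo `b` split `{0, …, ℓ - 1}` into parts whose sizes differ by at most
one. -/
theorem card_val_mod {b y : ℕ} (hb : 0 < b) (hy : y ∈ Finset.Icc 1 b) :
    ℓ / b ≤ (Finset.univ.filter fun z : ZMod ℓ => z.val % b + 1 = y).card ∧
      (Finset.univ.filter fun z : ZMod ℓ => z.val % b + 1 = y).card ≤ ℓ / b + 1 := by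
  rw [Finset.mem_Icc] at hy
  have h : (Finset.univ.filter fun z : ZMod ℓ => z.val % b + 1 = y).card =
      ℓ.count (· ≡ y - 1 [MOD b]) := by
    rw [Nat.count_eq_card_filter_range]
    refine Finset.card_bij (fun z _ => z.val) ?_ (fun z _ z' _ h => ZMod.val_injective ℓ h) ?_
    · intro z hz
      simp only [Finset.mem_filter, Finset.mem_univ, true_and, Finset.mem_range] at hz ⊢
      refine ⟨ZMod.val_lt z, ?_⟩
      rw [Nat.ModEq, Nat.mod_eq_of_lt (by omega : y - 1 < b)]
      omega
    · intro x hx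
      have hx := Finset.mem_filter.1 hx
      rw [Finset.mem_range, Nat.ModEq, Nat.mod_eq_of_lt (by omega : y - 1 < b)] at hx
      have hval : ((x : ℕ) : ZMod ℓ).val = x := by rw [ZMod.val_natCast, Nat.mod_eq_of_lt hx.1]
      exact ⟨x, by simp [hval]; omega, hval⟩
  rw [h, Nat.count_modEq_card _ hb]
  split_ifs <;> omega

/-- Polynomials of degree less than `m` modulo a prime `ℓ ≥ 2 max (n, b)` are an `m`-wise
independent family. -/
theorem isHashFamily_polyHash {b : ℕ} (hb : 0 < b) (hm : 0 < m) (hℓ : 2 * max n b ≤ ℓ) :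
    IsHashFamily m n b (fun c : Fin m → Fin ℓ => polyHash n b c) := by
  classical
  have hℓ0 : 0 < ℓ := (Fact.out : ℓ.Prime).pos
  have hn : n < ℓ := by
    have := le_max_left n b; have := le_max_right n b; omega
  have hb2 : 2 * b ≤ ℓ := by have := le_max_right n b; omega
  let A : ℕ → Finset (ZMod ℓ) := fun y => Finset.univ.filter fun z : ZMod ℓ => z.val % b + 1 = y
  have hA : ∀ (c : Fin m → Fin ℓ) (x : Fin n) (y : ℕ), polyHash n b c x = y ↔
      ((∑ j : Fin m, (c j : ℕ) * ((x : ℕ) + 1) ^ (j : ℕ) : ℕ) : ZMod ℓ) ∈ A y := by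
    intro c x y
    rw [Finset.mem_filter, ZMod.val_natCast]
    simp [polyHash]
  have h1 : ∀ x y, prob (fun c : Fin m → Fin ℓ => polyHash n b c x = y) = (A y).card / ℓ := by
    intro x y
    have := prob_poly_mem (m := m) hn (S := {x}) (by rwa [Finset.card_singleton]) fun _ => A y
    simp only [Finset.mem_singleton, forall_eq, Finset.prod_singleton] at this
    simpa only [hA] using this
  refine ⟨fun c x => ?_, fun S hS y => ?_, fun x y hy y' hy' => ?_⟩
  · have := Nat.mod_lt ((∑ j : Fin m, (c j : ℕ) * ((x : ℕ) + 1) ^ (j : ℕ)) % ℓ) hb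
    have h2 : polyHash n b c x =
      (∑ j : Fin m, (c j : ℕ) * ((x : ℕ) + 1) ^ (j : ℕ)) % ℓ % b + 1 := rfl
    dsimp only
    rw [Finset.mem_Icc, h2]
    omega
  · simp only [h1]
    simp only [hA]
    exact prob_poly_mem hn hS fun x => A (y x)
  · rw [h1, h1, ← mul_div_assoc]
    refine div_le_div_of_nonneg_right ?_ (by positivity)
    have h2 := (card_val_mod (ℓ := ℓ) hb hy).2
    have h3 := (card_val_mod (ℓ := ℓ) hb hy').1
    -- Class sizes lie between `ℓ / b` and `ℓ / b + 1`, and the latter is at most twice the former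
    -- once `ℓ / b` is positive.
    have h4 : 2 ≤ ℓ / b := (Nat.le_div_iff_mul_le hb).2 hb2
    have : (A y).card ≤ 2 * (A y').card := by
      change (Finset.univ.filter fun z : ZMod ℓ => z.val % b + 1 = y).card ≤
        2 * (Finset.univ.filter fun z : ZMod ℓ => z.val % b + 1 = y').card
      omega
    exact_mod_cast this

end PolyHash

/-! ### The main theorem -/

theorem mainTheorem3 :
    ∃ (K a : ℕ) (post : Prog) (work : ℕ → ℕ → Layout),
      ∀ (n M k p : ℕ) [Fact p.Prime] (g : (ZMod p)ˣ),
        1 ≤ n → 2 ≤ k →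
        TLE.cPar k ≤ p → p ≤ 2 * TLE.cPar k →
        (∀ x : (ZMod p)ˣ, x ∈ Subgroup.zpowers g) →
        -- the implementation with polynomial hash functions modulo primes `ℓ₁`, `ℓ₂`
        (∀ ℓ₁ ℓ₂ : ℕ, ℓ₁.Prime → ℓ₂.Prime →
          2 * max n (TLE.buckets k) ≤ ℓ₁ → ℓ₁ ≤ 4 * max n (TLE.buckets k) →
          2 * max n (p - 1) ≤ ℓ₂ → ℓ₂ ≤ 4 * max n (p - 1) →
          -- space in bits, without and for the hash functions and tables
          ((Layout.bits (TLE.coreLayout k p ++ work k p) : ℕ) : ℝ)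
              ≤ K * ((k : ℝ) * Real.logb 2 k) ∧
          ((Layout.bits (TLE.auxLayout k p ℓ₁ ℓ₂) : ℕ) : ℝ)
              ≤ K * (Real.logb 2 k * Real.logb 2 n + (k : ℝ) * Real.logb 2 k ^ 2) ∧
          (∀ (c : Fin (TLE.tPar k) → Fin ℓ₁) (d : Fin 2 → Fin ℓ₂),
            Layout.Fits (TLE.coreLayout k p ++ TLE.auxLayout k p ℓ₁ ℓ₂ ++ work k p)
              (TLE.initMem k g c d)) ∧
          -- update time and the computed output, on words of at least `a log (n + M + k)` bits
          (∀ w : ℕ, (n + M + k) ^ a ≤ 2 ^ w →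
            ∀ stream : List (Fin n × ℤ), (∀ u ∈ stream, |u.2| ≤ (M : ℤ)) →
            ∀ (c : Fin (TLE.tPar k) → Fin ℓ₁) (d : Fin 2 → Fin ℓ₂),
              ∃ m : Mem,
                TLE.StreamRun w (TLE.coreLayout k p ++ TLE.auxLayout k p ℓ₁ ℓ₂ ++ work k p)
                  ((K : ℝ) * Real.logb 2 k) (TLE.initMem k g c d) stream m ∧
                (∀ j ∈ Finset.Icc 1 (TLE.buckets k), ∀ z ∈ Finset.Icc 1 (2 * TLE.sPar k),
                  m 0 ((j - 1) * (2 * TLE.sPar k) + (z - 1)) =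
                    (TLE.counters p (polyHash n (TLE.buckets k) c) (polyHash n (p - 1) d)
                      stream j z).val) ∧
                TLE.Returns w (TLE.coreLayout k p ++ TLE.auxLayout k p ℓ₁ ℓ₂ ++ work k p)
                  post m
                  (TLE.output k p (polyHash n (TLE.buckets k) c) (polyHash n (p - 1) d)
                    stream)) ∧
          -- correctness
          (∀ stream : List (Fin n × ℤ), TLE.normL1 stream ≤ (k : ℤ) →
            3 / 4 ≤ prob (fun ω : (Fin (TLE.tPar k) → Fin ℓ₁) × (Fin 2 → Fin ℓ₂) =>
              TLE.output k p (polyHash n (TLE.buckets k) ω.1) (polyHash n (p - 1) ω.2) stream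
                = TLE.normL1 stream))) ∧
        -- correctness with arbitrary `t`-wise and pairwise independent families
        (∀ (Ω₁ Ω₂ : Type) [Fintype Ω₁] [Nonempty Ω₁] [Fintype Ω₂] [Nonempty Ω₂]
          (h₁ : Ω₁ → Fin n → ℕ) (h₂ : Ω₂ → Fin n → ℕ),
          IsHashFamily (TLE.tPar k) n (TLE.buckets k) h₁ →
          IsHashFamily 2 n (p - 1) h₂ →
          ∀ stream : List (Fin n × ℤ), TLE.normL1 stream ≤ (k : ℤ) →
            3 / 4 ≤ prob (fun ω : Ω₁ × Ω₂ =>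
              TLE.output k p (h₁ ω.1) (h₂ ω.2) stream = TLE.normL1 stream)) := by
  -- One generous constant covers both space bounds and the update time; 40 is the exponent of
  -- `wordBounds_of_pow_le`.
  refine ⟨1000000, 40, TLE.postProg, TLE.workLayout, ?_⟩
  intro n M k p _ g hn hk hp hp' hg
  have hp2 : 2 ≤ p := (Fact.out : p.Prime).two_le
  refine ⟨fun ℓ₁ ℓ₂ hℓ₁ hℓ₂ h₁ h₁' h₂ h₂' => ⟨?_, ?_, ?_, ?_, ?_⟩, ?_⟩
  · exact_mod_cast TLE.core_bits_le hk (by omega) hp'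
  · exact_mod_cast TLE.aux_bits_le hn hk hp2 hp' hℓ₁.one_lt.le h₁' hℓ₂.one_lt.le h₂'
  · exact TLE.layout_fits hk hp hg
  · intro w hw stream _ c d
    have hW := TLE.wordBounds_of_pow_le hn hk hp' h₁' h₂' hw
    obtain ⟨m, hrun, hm⟩ := TLE.exists_streamRun hW hk hp hg hℓ₁.pos hℓ₂.pos
      (B := ((1000000 : ℕ) : ℝ) * Real.logb 2 k) (by exact_mod_cast TLE.update_time_le hk)
      stream _ _ (TLE.holds_initMem g c d)
    exact ⟨m, hrun, hm.2, hm.returns hW hk hp hg⟩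
  · intro stream hL
    have : Fact ℓ₁.Prime := ⟨hℓ₁⟩
    have : Fact ℓ₂.Prime := ⟨hℓ₂⟩
    exact TLE.prob_output_ge hk hp
      (isHashFamily_polyHash (TLE.one_le_buckets hk) (by unfold TLE.tPar; omega) h₁)
      (isHashFamily_polyHash (by omega) (by norm_num) h₂) stream hL
  · intro Ω₁ Ω₂ _ _ _ _ h₁ h₂ H₁ H₂ stream hL
    exact TLE.prob_output_ge hk hp H₁ H₂ stream hL
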